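/- Let $\Omega\subset\mathbb R^2$ be a simply connected domain (bounded or unbounded). A planar network $\mathcal N$ in $\Omega$ is a finite union of embedded arcs, with relative interiors in $\Omega$, that meet each other only at their ends. The ends are the vertices: interior vertices, lying in $\Omega$ and common to at least two arcs, and exterior vertices, lying on $\partial\Omega$ or at infinity; a vertex at infinity is a prescribed curve going to infinity, to which the arc is asymptotic (curves prescribed for different vertices stay a positive distance apart near infinity). The regions of $\mathcal N$ are the connected components of $\Omega\setminus\mathcal N$; two different regions are adjacent if their boundaries share an arc of $\mathcal N$. A three-coloring assigns to each region one of three fixed colors so that adjacent regions have different colors. Two networks $\mathcal N,\mathcal N'$ in $\Omega$ belong to the same topological class if there is a homotopy between them relative to the exterior vertices, that is, a continuous motion inside $\Omega$ of the vertices and arcs of $\mathcal N$ that fixes the exterior vertices (at infinity: the arcs stay asymptotic to the prescribed curves, uniformly in time) and ends with the vertices and arcs of $\mathcal N'$, inducing an isomorphism of the underlying graphs. Let $\mathcal N$ be a connected network in $\Omega$ which is tree-like (its graph is a tree), whose interior vertices are all trivalent, and whose exterior vertices are all simple (ends of exactly one arc). Then: 1. The partition of $\Omega\setminus\mathcal N$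 into regions has a three-coloring, and it is unique up to a permutation of the three colors. 2. The same coloring is associated to every network $\mathcal N'$ in the topological class of $\mathcal N$. Precisely, for every homotopy from $\mathcal N$ to $\mathcal N'$ as above there is a bijection $\Phi$ from the regions of $\mathcal N$ to those of $\mathcal N'$ such that (a) an arc of $\mathcal N$ lies on the boundary of a region $R$ if and only if the corresponding arc of $\mathcal N'$ lies on the boundary of $\Phi(R)$; (b) a point of $\Omega$ through which the moving network never passes lies in $R$ if and only if it lies in $\Phi(R)$; and (c) an assignment $c$ of colors to the regions of $\mathcal N$ is a three-coloring if and only if $c\circ\Phi^{-1}$ is a three-coloring for $\mathcal N'$. -/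

import Mathlib

open Set Filter Topology

/-- The Euclidean plane `ℝ²`, realised as `ℂ` (same underlying metric space). -/
abbrev Plane : Type := ℂ

/-- Where a vertex of a planar network sits: at a point of the domain (interior vertex), at a point
of the boundary of the domain, or at infinity.  A vertex at infinity is given by a fixed curve
`σ(s)`, `0 < s < 1`, that leaves every bounded set as `s → 0⁺`; the arc ending at that vertex is
required to be asymptotic to `σ`. -/
inductive VertexSite : Type
  | inner (p : Plane)
  | boundary (p : Plane)
  | infinity (σ : ℝ → Plane)

namespace VertexSite

/-- The vertex is an interior one. -/
def IsInner : VertexSite → Prop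
  | inner _ => True
  | boundary _ => False
  | infinity _ => False

/-- The curve that the arcs ending at the vertex approach as their parameter tends to `0⁺`; it is
constant for vertices at finite distance. -/
def track : VertexSite → ℝ → Plane
  | inner p => fun _ => p
  | boundary p => fun _ => p
  | infinity σ => σ

/-- The site is compatible with the domain `Ω`. -/
def IsValid (Ω : Set Plane) : VertexSite → Prop
  | inner p => p ∈ Ω
  | boundary p => p ∈ frontier Ω
  | infinity σ => ContinuousOn σ (Ioo 0 1) ∧ Tendsto (fun s => ‖σ s‖) (𝓝[>] (0 : ℝ)) atTop

end VertexSite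

/-- A planar network in `Ω` with vertex set `V`: finitely many arcs embedded in the plane, with
relative interiors in `Ω`, that can meet each other only at their ends.  Each end is a vertex, where
the arc either meets another arc or reaches the boundary of `Ω` (or infinity).

The arc joining adjacent vertices `u` and `v` is the curve `arc u v s`, `0 < s < 1`, which tends to
`u` as `s → 0⁺` and, being `arc v u` run backwards, to `v` as `s → 1⁻`.  It is convenient to record
the incidences by a simple graph: in a tree there are no multiple edges and no loops. -/
structure PlanarNetwork (Ω : Set Plane) (V : Type*) where
  /-- Which pairs of vertices are joined by an arc. -/
  graph : SimpleGraph V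
  /-- The location of the vertices. -/
  site : V → VertexSite
  /-- The (relatively open) arcs, as parametrised curves. -/
  arc : V → V → ℝ → Plane
  site_valid : ∀ v, (site v).IsValid Ω
  /-- Distinct vertices have distinct locations (for vertices at infinity: the prescribed curves
  do not come close to each other near infinity). -/
  site_separated : ∀ u v, u ≠ v →
    ∃ δ > (0 : ℝ), ∀ s ∈ Ioo 0 δ, ∀ s' ∈ Ioo 0 δ, δ ≤ dist ((site u).track s) ((site v).track s')
  arc_symm : ∀ u v, graph.Adj u v → ∀ s ∈ Ioo (0 : ℝ) 1, arc v u s = arc u v (1 - s)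
  arc_continuous : ∀ u v, graph.Adj u v → ContinuousOn (arc u v) (Ioo 0 1)
  arc_injective : ∀ u v, graph.Adj u v → InjOn (arc u v) (Ioo 0 1)
  arc_mem : ∀ u v, graph.Adj u v → MapsTo (arc u v) (Ioo 0 1) Ω
  /-- The arc ends at its end vertex (for a vertex at infinity: is asymptotic to the given curve). -/
  arc_end : ∀ u v, graph.Adj u v →
    Tendsto (fun s => dist (arc u v s) ((site u).track s)) (𝓝[>] 0) (𝓝 0)
  /-- The relative interior of an arc contains no vertex. -/
  arc_avoids : ∀ u v, graph.Adj u v → ∀ w p, site w = .inner p → p ∉ arc u v '' Ioo 0 1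
  /-- The relative interiors of different arcs are disjoint. -/
  arc_disjoint : ∀ u v u' v', graph.Adj u v → graph.Adj u' v' → s(u, v) ≠ s(u', v') →
    Disjoint (arc u v '' Ioo 0 1) (arc u' v' '' Ioo 0 1)
  /-- Every vertex is an end of some arc, and an end inside `Ω` lies on at least two arcs. -/
  exists_adj : ∀ v, ∃ u, graph.Adj v u ∧ ((site v).IsInner → ∃ w, w ≠ u ∧ graph.Adj v w)

namespace PlanarNetwork

variable {Ω : Set Plane} {V W : Type*}

/-- The network is connected and tree-like: its graph is a tree. -/
def IsConnectedTreeLike (N : PlanarNetwork Ω V) : Prop :=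
  N.graph.Connected ∧ N.graph.IsAcyclic

/-- All interior vertices are trivalent. -/
def HasTrivalentInterior (N : PlanarNetwork Ω V) : Prop :=
  ∀ v, (N.site v).IsInner → (N.graph.neighborSet v).ncard = 3

/-- All exterior vertices are simple, that is, ends of exactly one arc. -/
def HasSimpleBoundary (N : PlanarNetwork Ω V) : Prop :=
  ∀ v, ¬ (N.site v).IsInner → (N.graph.neighborSet v).ncard = 1

/-- The part of the network lying in `Ω`: interior vertices and relative interiors of arcs. -/
def carrier (N : PlanarNetwork Ω V) : Set Plane :=
  {p | ∃ v, N.site v = .inner p} ∪ {p | ∃ u v, N.graph.Adj u v ∧ p ∈ N.arc u v '' Ioo 0 1}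

/-- The regions of the partition associated to the network: the connected components of the
complement of the network in `Ω`. -/
def Region (N : PlanarNetwork Ω V) : Type :=
  {R : Set Plane // ∃ x ∈ Ω \ N.carrier, R = connectedComponentIn (Ω \ N.carrier) x}

/-- The arc joining `u` and `v` is part of the boundary of the region `R`. -/
def Borders (N : PlanarNetwork Ω V) (R : N.Region) (u v : V) : Prop :=
  N.arc u v '' Ioo 0 1 ⊆ frontier R.1

/-- Two different regions are adjacent if they have an arc of the network as common boundary. -/
def AdjacentRegions (N : PlanarNetwork Ω V) (R S : N.Region) : Prop :=
  R ≠ S ∧ ∃ u v, N.graph.Adj u v ∧ N.Borders R u v ∧ N.Borders S u v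

/-- A three-coloring of the partition: one of three colors for each region, such that adjacent
regions have different colors. -/
def IsThreeColoring (N : PlanarNetwork Ω V) (c : N.Region → Fin 3) : Prop :=
  ∀ R S, N.AdjacentRegions R S → c R ≠ c S

end PlanarNetwork

/-- A homotopy, relative to the exterior vertices, from a network `N₁` to a network `N₂` in the
same domain.  The vertices and arcs of `N₁` are moved continuously inside `Ω` (arcs need not remain
embedded or disjoint at intermediate times), the exterior vertices stay fixed, and at time `1` the
arcs of `N₂` are obtained.  For a vertex at infinity, staying fixed means that the moving arc is
asymptotic to the given curve, uniformly in time. -/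
structure NetworkHomotopy {Ω : Set Plane} {V W : Type*}
    (N₁ : PlanarNetwork Ω V) (N₂ : PlanarNetwork Ω W) where
  /-- The resulting matching of vertices and arcs. -/
  iso : N₁.graph ≃g N₂.graph
  isInner_iff : ∀ v, (N₂.site (iso v)).IsInner ↔ (N₁.site v).IsInner
  exterior_fixed : ∀ v, ¬ (N₁.site v).IsInner → N₂.site (iso v) = N₁.site v
  /-- The position `vertex v t s` of an interior vertex `v` at time `t` (which does not depend on
  `s`), or the unchanged curve `s ↦ (N₁.site v).track s` attached to an exterior vertex. -/
  vertex : V → ℝ → ℝ → Plane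
  vertex_exterior : ∀ v, ¬ (N₁.site v).IsInner → ∀ t s, vertex v t s = (N₁.site v).track s
  vertex_inner : ∀ v, (N₁.site v).IsInner → ∀ t s s', vertex v t s = vertex v t s'
  vertex_continuous : ∀ v s, ContinuousOn (fun t => vertex v t s) (Icc 0 1)
  vertex_mem : ∀ v, (N₁.site v).IsInner → ∀ t ∈ Icc (0 : ℝ) 1, ∀ s, vertex v t s ∈ Ω
  vertex_zero : ∀ v s, vertex v 0 s = (N₁.site v).track s
  vertex_one : ∀ v s, vertex v 1 s = (N₂.site (iso v)).track s
  /-- The point with parameter `s` on the arc from `u` to `v` at time `t` is `arc u v t s`. -/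
  arc : V → V → ℝ → ℝ → Plane
  arc_symm : ∀ u v, N₁.graph.Adj u v → ∀ t ∈ Icc (0 : ℝ) 1, ∀ s ∈ Ioo (0 : ℝ) 1,
    arc v u t s = arc u v t (1 - s)
  arc_continuous : ∀ u v, N₁.graph.Adj u v →
    ContinuousOn (fun q : ℝ × ℝ => arc u v q.1 q.2) (Icc 0 1 ×ˢ Ioo 0 1)
  arc_mem : ∀ u v, N₁.graph.Adj u v →
    ∀ t ∈ Icc (0 : ℝ) 1, ∀ s ∈ Ioo (0 : ℝ) 1, arc u v t s ∈ Ω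
  arc_end : ∀ u v, N₁.graph.Adj u v →
    TendstoUniformlyOn (fun s t => dist (arc u v t s) (vertex u t s)) (fun _ => 0)
      (𝓝[>] 0) (Icc 0 1)
  arc_zero : ∀ u v, N₁.graph.Adj u v → ∀ s ∈ Ioo (0 : ℝ) 1, arc u v 0 s = N₁.arc u v s
  arc_one : ∀ u v, N₁.graph.Adj u v → ∀ s ∈ Ioo (0 : ℝ) 1,
    arc u v 1 s = N₂.arc (iso u) (iso v) s

namespace NetworkHomotopy

variable {Ω : Set Plane} {V W : Type*} {N₁ : PlanarNetwork Ω V} {N₂ : PlanarNetwork Ω W}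

/-- The points of `Ω` through which some part of the moving network passes. -/
def sweptSet (h : NetworkHomotopy N₁ N₂) : Set Plane :=
  {p | ∃ t ∈ Icc (0 : ℝ) 1, (∃ v, (N₁.site v).IsInner ∧ p = h.vertex v t 0) ∨
    ∃ u v, N₁.graph.Adj u v ∧ ∃ s ∈ Ioo (0 : ℝ) 1, p = h.arc u v t s}

/-- `Φ` is an identification of the regions of the two partitions that is induced by the homotopy:
corresponding regions are bordered by corresponding arcs, and a point that is never hit by the
moving network lies in corresponding regions at the beginning and at the end.  (In particular
corresponding regions coincide near the boundary of `Ω` away from the exterior vertices.) -/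
def IdentifiesRegions (h : NetworkHomotopy N₁ N₂) (Φ : N₁.Region ≃ N₂.Region) : Prop :=
  (∀ R u v, N₁.graph.Adj u v → (N₁.Borders R u v ↔ N₂.Borders (Φ R) (h.iso u) (h.iso v))) ∧
  (∀ x ∈ Ω, x ∉ h.sweptSet → ∀ R, x ∈ R.1 ↔ x ∈ (Φ R).1)

end NetworkHomotopy

/-- Two networks belong to the same topological class if there is a homotopy between them relative
to the exterior vertices. -/
def SameTopologicalClass {Ω : Set Plane} {V W : Type*}
    (N₁ : PlanarNetwork Ω V) (N₂ : PlanarNetwork Ω W) : Prop :=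
  Nonempty (NetworkHomotopy N₁ N₂)

/-- The same colorings are associated to two networks of the same topological class: every homotopy
between them identifies the regions of the two partitions, and under this identification the
three-colorings of one partition are exactly the three-colorings of the other. -/
def HaveSameColorings {Ω : Set Plane} {V W : Type*}
    (N₁ : PlanarNetwork Ω V) (N₂ : PlanarNetwork Ω W) : Prop :=
  ∀ h : NetworkHomotopy N₁ N₂, ∃ Φ : N₁.Region ≃ N₂.Region, h.IdentifiesRegions Φ ∧
    ∀ c : N₁.Region → Fin 3, N₁.IsThreeColoring c ↔ N₂.IsThreeColoring (c ∘ Φ.symm)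

/-! The plane topology is done with complex logarithms in place of the Jordan curve theorem. For
`x`, `y` in `Ω` there is a function with zero at `x` and pole at `y` that equals `1` off a compact
subset of `Ω` (`exists_isSeparator`, which uses simple connectivity). In the spirit of Eilenberg's
criterion, a part `F` of the network fails to separate `x` from `y` exactly when this function has a
logarithm on `F` that vanishes near the boundary of `Ω` and near infinity. Along the arcs of a tree
a continuous logarithm always exists (`exists_isArcLog`); its values `k` at the exterior vertices
lie in `2πiℤ`, and the only obstruction is that these values may differ. In particular the path
between two exterior vertices `a`, `b` separates `x` from `y` iff `k a ≠ k b`.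

From this criterion a path between exterior vertices has at most two sides (`side_or`); it has at
least two (`not_isPreconnected_diff_pathSet`), and each of its arcs lies in the frontier of every
side (`arc_subset_frontier_side`). Every region is a side of such a path (`exists_side_disjoint`),
and every arc borders exactly two regions (`exists_two_borders`).

What remains of the coloring is combinatorial (`IsFaceSystem`). Around a trivalent vertex each
region can be named by the one edge it does not border. The names at the two ends of an edge differ
by a permutation of three symbols, and on a tree these permutations can be undone simultaneously,
which gives a coloring. For uniqueness, the colors of the two regions along one edge force all
others, vertex by vertex.

Under a homotopy the total change of the logarithm along a moving path between exterior vertices is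
continuous in time with values in `2πiℤ`, hence constant. So the sides of the path are preserved for
points that are never hit (`NetworkHomotopy.side_iff`), and also for the ends of the other arcs near
the exterior vertices (`leafArc_subset_iff`). With at least three exterior vertices a region is
determined by the two exterior vertices on its boundary, and regions are matched through these
pairs; the case of two exterior vertices, with exactly two regions, is treated apart. -/

section Logarithms

/-! ### Continuous logarithms of functions without zeros. -/

open Complex

/-- The homotopy lifting property of the exponential, for functions defined on a set. -/
theorem exists_log_homotopy {X : Type*} [TopologicalSpace X] {S : Set X} {H : ℝ → X → ℂ}
    (hH : ContinuousOn (fun q : ℝ × X => H q.1 q.2) (Icc 0 1 ×ˢ S))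
    (hne : ∀ t ∈ Icc (0 : ℝ) 1, ∀ x ∈ S, H t x ≠ 0) {g : X → ℂ} (hg : ContinuousOn g S)
    (hg0 : ∀ x ∈ S, exp (g x) = H 0 x) :
    ∃ G : ℝ → X → ℂ, ContinuousOn (fun q : ℝ × X => G q.1 q.2) (Icc 0 1 ×ˢ S) ∧
      (∀ t ∈ Icc (0 : ℝ) 1, ∀ x ∈ S, exp (G t x) = H t x) ∧ ∀ x ∈ S, G 0 x = g x := by
  classical
  let H' : C(unitInterval × S, {z : ℂ // z ≠ 0}) :=
    ⟨fun q => ⟨H q.1 q.2, hne _ q.1.2 _ q.2.2⟩, by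
      refine Continuous.subtype_mk ?_ _
      exact hH.comp_continuous (f := fun q : unitInterval × S => ((q.1 : ℝ), (q.2 : X)))
        (by fun_prop) (fun q => ⟨q.1.2, q.2.2⟩)⟩
  let g' : C(S, ℂ) := ⟨fun x => g x, hg.domRestrict⟩
  have h0 : ∀ a : S, H' (0, a) = (fun z : ℂ => (⟨exp z, exp_ne_zero z⟩ : {z : ℂ // z ≠ 0})) (g' a) :=
    fun a => Subtype.ext (hg0 a a.2).symm
  let L := isCoveringMap_exp.liftHomotopy H' g' h0
  have hL : ∀ q, exp (L q) = H q.1 q.2 := fun q =>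
    congrArg Subtype.val (congrFun (isCoveringMap_exp.liftHomotopy_lifts H' g' h0) q)
  -- The lift lives on a subtype; the value `0` elsewhere is never read.
  refine ⟨fun t x => if h : t ∈ Icc (0 : ℝ) 1 ∧ x ∈ S then L (⟨t, h.1⟩, ⟨x, h.2⟩) else 0,
    ?_, ?_, ?_⟩
  · rw [continuousOn_iff_continuous_domRestrict]
    have : Continuous fun q : ↥(Icc (0 : ℝ) 1 ×ˢ S) =>
        L (⟨q.1.1, q.2.1⟩, ⟨q.1.2, q.2.2⟩) := by fun_prop
    refine this.congr fun q => ?_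
    have hq : q.1.1 ∈ Icc (0 : ℝ) 1 ∧ q.1.2 ∈ S := q.2
    simp only [domRestrict_apply]
    rw [dif_pos hq]
  · intro t ht x hx
    simp only [ht, hx, and_self, dite_true]
    exact hL _
  · intro x hx
    have h01 : (0 : ℝ) ∈ Icc (0 : ℝ) 1 := by simp
    simp only [h01, hx, and_self, dite_true]
    exact isCoveringMap_exp.liftHomotopy_zero H' g' h0 ⟨x, hx⟩

/-- The difference divided by `2πi` is continuous with values in the discrete set `ℤ`, hence
constant on a preconnected set. -/
theorem IsPreconnected.exists_int_of_exp_eq {X : Type*} [TopologicalSpace X] {S : Set X}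
    (hS : IsPreconnected S) {f g : X → ℂ} (hf : ContinuousOn f S) (hg : ContinuousOn g S)
    (h : ∀ x ∈ S, exp (f x) = exp (g x)) :
    ∃ n : ℤ, ∀ x ∈ S, f x = g x + n * (2 * Real.pi * I) := by
  rcases S.eq_empty_or_nonempty with rfl | ⟨x₀, hx₀⟩
  · exact ⟨0, by simp⟩
  have h2 : ∀ x ∈ S, ∃ n : ℤ, f x = g x + n * (2 * Real.pi * I) := fun x hx =>
    exp_eq_exp_iff_exists_int.1 (h x hx)
  obtain ⟨n, hn⟩ := h2 x₀ hx₀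
  refine ⟨n, fun x hx => ?_⟩
  have hm : MapsTo (fun x => (f x - g x) / (2 * Real.pi * I)) S (range ((↑) : ℤ → ℂ)) := by
    intro x hx
    obtain ⟨k, hk⟩ := h2 x hx
    exact ⟨k, by simp only; rw [hk]; field_simp [two_pi_I_ne_zero]; ring⟩
  have hd : DiscreteTopology (range ((↑) : ℤ → ℂ)) := by
    have : IsClosedEmbedding ((↑) : ℤ → ℂ) := Complex.isClosedEmbedding_intCast
    exact this.toIsEmbedding.toHomeomorph.symm.isEmbedding.discreteTopology
  have hc := hS.constant_of_mapsTo ⟨hd⟩ (f := fun x => (f x - g x) / (2 * Real.pi * I))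
    ((hf.sub hg).div_const _) hm hx hx₀
  have h3 := two_pi_I_ne_zero
  rw [div_left_inj' h3] at hc
  rw [hn] at hc
  linear_combination hc

theorem IsPreconnected.eq_of_exp_eq {X : Type*} [TopologicalSpace X] {S : Set X}
    (hS : IsPreconnected S) {f g : X → ℂ} (hf : ContinuousOn f S) (hg : ContinuousOn g S)
    (h : ∀ x ∈ S, exp (f x) = exp (g x)) {x₀ : X} (hx₀ : x₀ ∈ S) (h0 : f x₀ = g x₀) :
    EqOn f g S := by
  obtain ⟨n, hn⟩ := hS.exists_int_of_exp_eq hf hg h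
  have := hn x₀ hx₀
  rw [h0, left_eq_add] at this
  intro x hx
  rw [hn x hx, this, add_zero]

/-- Winding numbers in disguise. The substitution `z = x + exp w` turns the punctured ball into a
half plane, on which `g - ψ` must be `m * w` plus a constant; being a function of `exp w` it is also
`2πi`-periodic, so `m = 0`. -/
theorem zpow_eq_zero_of_log_punctured_ball {x : ℂ} {r : ℝ} (hr : 0 < r) {m : ℤ} {g ψ : ℂ → ℂ}
    (hg : ContinuousOn g (Metric.ball x r \ {x})) (hψ : ContinuousOn ψ (Metric.ball x r))
    (h : ∀ z ∈ Metric.ball x r \ {x}, exp (g z) = (z - x) ^ m * exp (ψ z)) : m = 0 := by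
  let S : Set ℂ := {w | w.re < Real.log r}
  have hS : IsPreconnected S := (convex_halfSpace_re_lt _).isPreconnected
  have hmap : MapsTo (fun w => x + exp w) S (Metric.ball x r \ {x}) := by
    intro w hw
    refine ⟨?_, by simp [exp_ne_zero]⟩
    simp only [Metric.mem_ball, dist_self_add_left, norm_exp]
    exact (Real.lt_log_iff_exp_lt hr).1 hw
  have hc : ContinuousOn (fun w => g (x + exp w) - ψ (x + exp w)) S := by
    have he : ContinuousOn (fun w => x + exp w) S := by fun_prop
    exact (hg.comp he hmap).sub (hψ.comp he fun w hw => (hmap hw).1)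
  obtain ⟨n, hn⟩ := hS.exists_int_of_exp_eq hc (g := fun w => m * w) (by fun_prop) (by
    intro w hw
    rw [exp_sub, h _ (hmap hw)]
    simp [exp_ne_zero, exp_int_mul])
  -- Two points of the half plane, one period apart, with the same image in the punctured ball.
  have h1 := hn (Real.log r - 1 : ℝ) (by simp [S])
  have h2 := hn ((Real.log r - 1 : ℝ) + 2 * Real.pi * I) (by simp [S])
  simp only [exp_periodic _] at h2
  rw [h1] at h2
  have h3 : (m : ℂ) * (2 * Real.pi * I) = 0 := by linear_combination -h2
  simpa [two_pi_I_ne_zero] using h3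

/-- A logarithm of a path in the punctured plane, with limits at both ends. -/
theorem exists_log_Ioo {φ : ℝ → ℂ} (hφ : ContinuousOn φ (Ioo 0 1)) (hne : ∀ s ∈ Ioo (0:ℝ) 1, φ s ≠ 0)
    {A B : ℂ} (hA : A ≠ 0) (hB : B ≠ 0) (h0 : Tendsto φ (𝓝[>] 0) (𝓝 A))
    (h1 : Tendsto φ (𝓝[<] 1) (𝓝 B)) :
    ∃ (l : ℝ → ℂ) (α β : ℂ), ContinuousOn l (Ioo 0 1) ∧ (∀ s ∈ Ioo (0:ℝ) 1, exp (l s) = φ s) ∧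
      exp α = A ∧ exp β = B ∧ Tendsto l (𝓝[>] 0) (𝓝 α) ∧ Tendsto l (𝓝[<] 1) (𝓝 β) := by
  have hc := continuousOn_Icc_extendFrom_Ioo hφ h0 h1
  have e0 := eq_lim_at_left_extendFrom_Ioo zero_lt_one h0
  have e1 := eq_lim_at_right_extendFrom_Ioo zero_lt_one h1
  have ei : ∀ s ∈ Ioo (0 : ℝ) 1, extendFrom (Ioo 0 1) φ s = φ s := fun s hs =>
    extendFrom_extends hφ s hs
  -- Over a one-point space, homotopy lifting is path lifting.
  obtain ⟨G, hG, hGe, -⟩ := exists_log_homotopy (X := Unit) (S := univ)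
    (H := fun t _ => extendFrom (Ioo 0 1) φ t) (g := fun _ => log A)
    (hc.comp (by fun_prop) (fun q hq => hq.1)) (by
      intro t ht _ _
      rcases eq_or_lt_of_le ht.1 with h | h
      · rw [← h, e0]; exact hA
      rcases eq_or_lt_of_le ht.2 with h' | h'
      · rw [h', e1]; exact hB
      · rw [ei t ⟨h, h'⟩]; exact hne t ⟨h, h'⟩) (by fun_prop)
    (by intro _ _; simp only [e0]; exact exp_log hA)
  have hl : ContinuousOn (fun t => G t ()) (Icc 0 1) :=
    hG.comp (f := fun t => (t, ())) (by fun_prop) (fun t ht => ⟨ht, mem_univ _⟩)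
  refine ⟨fun t => G t (), G 0 (), G 1 (), hl.mono Ioo_subset_Icc_self, ?_, ?_, ?_, ?_, ?_⟩
  · intro s hs
    rw [hGe s (Ioo_subset_Icc_self hs) () (mem_univ _), ei s hs]
  · rw [hGe 0 (by simp) () (mem_univ _), e0]
  · rw [hGe 1 (by simp) () (mem_univ _), e1]
  · refine (hl 0 (by simp)).mono_left ?_
    rw [← nhdsWithin_Ioo_eq_nhdsGT zero_lt_one]
    exact nhdsWithin_mono _ Ioo_subset_Icc_self
  · refine (hl 1 (by simp)).mono_left ?_
    rw [← nhdsWithin_Ioo_eq_nhdsLT zero_lt_one]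
    exact nhdsWithin_mono _ Ioo_subset_Icc_self

theorem exists_local_log {F : ℂ → ℂ} {x : ℂ} {U : Set ℂ} (hU : U ∈ 𝓝 x) (hF : ContinuousOn F U)
    (hx : F x ≠ 0) : ∃ r > 0, Metric.ball x r ⊆ U ∧ ∃ ψ : ℂ → ℂ, ContinuousOn ψ (Metric.ball x r) ∧
      ∀ z ∈ Metric.ball x r, F z = exp (ψ z) := by
  have hc : ContinuousAt (fun z => F z / F x) x := (hF.continuousAt hU).div_const _
  have h1 : ∀ᶠ z in 𝓝 x, F z / F x ∈ slitPlane := by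
    refine hc.eventually_mem (isOpen_slitPlane.mem_nhds ?_)
    rw [div_self hx]; exact one_mem_slitPlane
  obtain ⟨r, hr, hb⟩ := Metric.mem_nhds_iff.1 (inter_mem hU h1)
  refine ⟨r, hr, fun z hz => (hb hz).1, fun z => log (F z / F x) + log (F x), ?_, ?_⟩
  · refine ContinuousOn.add (ContinuousOn.clog ?_ fun z hz => (hb hz).2) continuousOn_const
    exact (hF.mono fun z hz => (hb hz).1).div_const _
  · intro z hz
    rw [exp_add, exp_log (slitPlane_ne_zero (hb hz).2), exp_log hx, div_mul_cancel₀ _ hx]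

/-- A continuous function without zeros on a punctured plane which is `1` outside a bounded set
has a continuous logarithm. -/
theorem exists_log_compl_singleton {h : ℂ → ℂ} {x : ℂ} (hc : ContinuousOn h {x}ᶜ)
    (hne : ∀ z ≠ x, h z ≠ 0) {R : ℝ} (hR : ∀ z, R ≤ ‖z‖ → h z = 1) :
    ∃ g : ℂ → ℂ, ContinuousOn g {x}ᶜ ∧ ∀ z ≠ x, exp (g z) = h z := by
  -- The map `p t` pushes points radially away from `x`: `p 1` is the identity, and `p 0` increases
  -- the distance from `x` by `M`, which brings every point to norm at least `R`, where `h = 1`.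
  -- Thus `h` is deformed from the constant `1`, whose logarithm is `0`.
  let M : ℝ := |R| + ‖x‖
  have hM : 0 ≤ M := by positivity
  let p : ℝ → ℂ → ℂ := fun t z => x + (z - x) * ((1 + (1 - t) * (M / ‖z - x‖) : ℝ) : ℂ)
  have hp : ContinuousOn (fun q : ℝ × ℂ => p q.1 q.2) (Icc 0 1 ×ˢ {x}ᶜ) := by
    have : ContinuousOn (fun q : ℝ × ℂ => (1 + (1 - q.1) * (M / ‖q.2 - x‖) : ℝ)) (Icc 0 1 ×ˢ {x}ᶜ) := by
      refine continuousOn_const.add (ContinuousOn.mul (by fun_prop)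
        (ContinuousOn.div continuousOn_const (by fun_prop) ?_))
      rintro q ⟨-, hq⟩
      exact norm_ne_zero_iff.2 (sub_ne_zero.2 hq)
    have h2 := Complex.continuous_ofReal.comp_continuousOn this
    exact continuousOn_const.add (ContinuousOn.mul (by fun_prop) h2)
  have hpx : ∀ t ∈ Icc (0 : ℝ) 1, ∀ z ∈ ({x}ᶜ : Set ℂ), p t z ≠ x := by
    intro t ht z hz h
    have h1 : (0 : ℝ) < 1 + (1 - t) * (M / ‖z - x‖) := by
      have := sub_nonneg.2 ht.2
      positivity
    have h2 : (z - x) * ((1 + (1 - t) * (M / ‖z - x‖) : ℝ) : ℂ) = 0 := by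
      simpa [p] using h
    rcases mul_eq_zero.1 h2 with h3 | h3
    · exact hz (sub_eq_zero.1 h3)
    · exact h1.ne' (by exact_mod_cast h3)
  obtain ⟨G, hG, hGe, -⟩ := exists_log_homotopy (S := ({x}ᶜ : Set ℂ)) (H := fun t z => h (p t z))
    (g := fun _ => 0) (hc.comp hp fun q hq => hpx _ hq.1 _ hq.2)
    (fun t ht z hz => hne _ (hpx t ht z hz)) continuousOn_const (by
      intro z hz
      rw [exp_zero, hR]
      have hz' : 0 < ‖z - x‖ := norm_pos_iff.2 (sub_ne_zero.2 hz)
      have h1 : ‖(z - x) * ((1 + (1 - (0:ℝ)) * (M / ‖z - x‖) : ℝ) : ℂ)‖ = ‖z - x‖ + M := by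
        rw [norm_mul, norm_real, Real.norm_of_nonneg (by positivity)]
        field_simp
        ring
      have h2 := norm_sub_norm_le ((z - x) * ((1 + (1 - (0:ℝ)) * (M / ‖z - x‖) : ℝ) : ℂ)) (-x)
      rw [h1, sub_neg_eq_add, norm_neg, add_comm _ x] at h2
      have h3 := le_abs_self R
      simp only [p]
      simp only [M] at h2 ⊢
      linarith)
  refine ⟨G 1, hG.comp (f := fun z => ((1 : ℝ), z)) (by fun_prop) fun z hz => ⟨by simp, hz⟩,
    fun z hz => ?_⟩
  rw [hGe 1 (by simp) z hz]
  simp [p]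

/-- If a logarithm on the closed set `K` exists for a product of powers of `(z - x) / (z - y)` and
`(z - y) / (z - w)`, then the total multiplicity in the component of `x` vanishes. -/
theorem winding_multiplicity_eq_zero {K : Set ℂ} (hK : IsClosed K) {x y w : ℂ} (hx : x ∉ K) (hy : y ∉ K)
    (hw : w ∉ K) {l m : ℤ} {ψ g : ℂ → ℂ} (hψ : Continuous ψ) (hg : ContinuousOn g K)
    (hgK : ∀ z ∈ K, exp (g z) = ((z - x) / (z - y)) ^ l * ((z - y) / (z - w)) ^ m * exp (ψ z))
    {R : ℝ} (hR : ∀ z, R ≤ ‖z‖ → ((z - x) / (z - y)) ^ l * ((z - y) / (z - w)) ^ m * exp (ψ z) = 1)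
    (hgR : ∀ z ∈ K, R ≤ ‖z‖ → g z = 0) (hyU : y ∉ connectedComponentIn Kᶜ x)
    (hwU : w ∉ connectedComponentIn Kᶜ x) : l = 0 := by
  classical
  set U := connectedComponentIn Kᶜ x with hUdef
  have hUo : IsOpen U := hK.isOpen_compl.connectedComponentIn
  have hxU : x ∈ U := mem_connectedComponentIn hx
  have hfr : frontier U ⊆ K := by
    intro z hz
    by_contra hzK
    have hV : IsOpen (connectedComponentIn Kᶜ z) := hK.isOpen_compl.connectedComponentIn
    have hzV : z ∈ connectedComponentIn Kᶜ z := mem_connectedComponentIn hzK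
    obtain ⟨v, hv, hvU⟩ := mem_closure_iff.1 hz.1 _ hV hzV
    have e1 := connectedComponentIn_eq hv
    have e2 := connectedComponentIn_eq hvU
    rw [← hUdef] at e2
    rw [e1, ← e2] at hzV
    rw [hUo.frontier_eq] at hz
    exact hz.2 hzV
  -- Tietze extends the logarithm from `K` to the plane. The cutoff `ρ` then makes it vanish far out
  -- without changing it on `K`, since `g` is already `0` there for large norms.
  obtain ⟨g₁, hg₁⟩ := ContinuousMap.exists_restrict_eq (Y := ℂ) hK ⟨K.domRestrict g, hg.domRestrict⟩
  have hg₁K : ∀ z ∈ K, g₁ z = g z := fun z hz => congrArg (fun f : C(K, ℂ) => f ⟨z, hz⟩) hg₁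
  let ρ : ℂ → ℝ := fun z => max 0 (min 1 (R + 1 - ‖z‖))
  have hρ : Continuous ρ := by fun_prop
  let g₂ : ℂ → ℂ := fun z => ρ z * g₁ z
  have hg₂ : Continuous g₂ := by fun_prop
  have hg₂K : ∀ z ∈ K, g₂ z = g z := by
    intro z hz
    simp only [g₂, hg₁K z hz]
    rcases le_total R ‖z‖ with h | h
    · rw [hgR z hz h, mul_zero]
    · have : ρ z = 1 := by
        simp only [ρ]
        rw [min_eq_left (by linarith), max_eq_right (by norm_num)]
      rw [this]; simp
  have hg₂R : ∀ z, R + 1 ≤ ‖z‖ → g₂ z = 0 := by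
    intro z hz
    have : ρ z = 0 := by
      simp only [ρ]
      rw [max_eq_left]
      exact (min_le_right _ _).trans (by linarith)
    simp [g₂, this]
  -- `(z - x) ^ l * Q z` is the given product divided by `exp (g₂ z)`; it equals `1` on `K`, and `Q`
  -- is continuous without zeros away from `y` and `w`.
  let Q : ℂ → ℂ := fun z => ((z - y)⁻¹) ^ l * ((z - y) / (z - w)) ^ m * exp (ψ z - g₂ z)
  have hQc : ∀ z, z ≠ y → z ≠ w → ContinuousAt Q z := by
    intro z h1 h2
    have h1' := sub_ne_zero.2 h1
    have h2' := sub_ne_zero.2 h2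
    have c1 : ContinuousAt (fun v => (v - y)⁻¹) z :=
      ContinuousAt.inv₀ (f := fun v => v - y) (by fun_prop) h1'
    have c2 : ContinuousAt (fun v => (v - y) / (v - w)) z :=
      ContinuousAt.div₀ (f := fun v => v - y) (by fun_prop) (by fun_prop) h2'
    exact ((c1.zpow₀ _ (Or.inl (inv_ne_zero h1'))).mul
      (c2.zpow₀ _ (Or.inl (div_ne_zero h1' h2')))).mul
      (f := fun v => ((v - y)⁻¹) ^ l * ((v - y) / (v - w)) ^ m) (by fun_prop)
  have hQ0 : ∀ z, z ≠ y → z ≠ w → Q z ≠ 0 := by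
    intro z h1 h2
    have h1' := sub_ne_zero.2 h1
    have h2' := sub_ne_zero.2 h2
    exact mul_ne_zero (mul_ne_zero (zpow_ne_zero _ (inv_ne_zero h1'))
      (zpow_ne_zero _ (div_ne_zero h1' h2'))) (exp_ne_zero _)
  have hPQ : ∀ z, (z - x) ^ l * Q z =
      ((z - x) / (z - y)) ^ l * ((z - y) / (z - w)) ^ m * exp (ψ z) * exp (-g₂ z) := by
    intro z
    simp only [Q]
    rw [sub_eq_add_neg (ψ z), exp_add, div_eq_mul_inv (z - x), mul_zpow]
    ring
  have hUne : ∀ z ∈ U, z ≠ y ∧ z ≠ w := fun z hz =>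
    ⟨fun h => hyU (h ▸ hz), fun h => hwU (h ▸ hz)⟩
  -- Since the quotient is `1` on `K`, which contains the frontier of `U`, it may be replaced by `1`
  -- outside `U`. This removes the singularities at `y` and `w` and leaves only the one of order `l`
  -- at `x`, which a logarithm on the punctured plane does not allow unless `l = 0`.
  let h : ℂ → ℂ := fun z => if z ∈ U then (z - x) ^ l * Q z else 1
  have hhc : ContinuousOn h {x}ᶜ := by
    intro z hz
    refine ContinuousAt.continuousWithinAt ?_
    have hP : z ≠ y → z ≠ w → ContinuousAt (fun z => (z - x) ^ l * Q z) z := fun h1 h2 =>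
      (ContinuousAt.zpow₀ (f := fun v => v - x) (by fun_prop) l (Or.inl (sub_ne_zero.2 hz))).mul
        (hQc z h1 h2)
    by_cases hzU : z ∈ U
    · refine (hP (hUne z hzU).1 (hUne z hzU).2).congr ?_
      filter_upwards [hUo.mem_nhds hzU] with v hv
      simp [h, hv]
    · by_cases hzc : z ∈ closure U
      · have hzK : z ∈ K := hfr ⟨hzc, by rwa [hUo.interior_eq]⟩
        have hc := hP (fun e => hy (e ▸ hzK)) (fun e => hw (e ▸ hzK))
        have h1 : (z - x) ^ l * Q z = 1 := by
          rw [hPQ, ← hgK z hzK, hg₂K z hzK, ← exp_add, add_neg_cancel, exp_zero]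
        have hz1 : h z = 1 := by simp [h, hzU]
        have hc' : Tendsto (fun z => (z - x) ^ l * Q z) (𝓝 z) (𝓝 1) := by
          have := hc.tendsto
          rwa [h1] at this
        have : Tendsto h (𝓝 z) (𝓝 1) := by
          rw [tendsto_def] at hc' ⊢
          intro s hs
          filter_upwards [hc' s hs] with v hv
          by_cases hvU : v ∈ U
          · simpa [h, hvU] using hv
          · simpa [h, hvU] using mem_of_mem_nhds hs
        rw [ContinuousAt, hz1]
        exact this
      · refine (continuousAt_const (y := (1 : ℂ))).congr ?_
        filter_upwards [isClosed_closure.isOpen_compl.mem_nhds hzc] with v hv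
        have : v ∉ U := fun h => hv (subset_closure h)
        simp [h, this]
  have hh0 : ∀ z ≠ x, h z ≠ 0 := by
    intro z hz
    by_cases hzU : z ∈ U
    · simp only [h, hzU, if_true]
      exact mul_ne_zero (zpow_ne_zero _ (sub_ne_zero.2 hz)) (hQ0 z (hUne z hzU).1 (hUne z hzU).2)
    · simp [h, hzU]
  obtain ⟨k, hk, hke⟩ := exists_log_compl_singleton hhc hh0 (R := R + 1) (by
    intro z hz
    by_cases hzU : z ∈ U
    · simp only [h, hzU, if_true]
      rw [hPQ, hR z (by linarith), hg₂R z hz]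
      simp
    · simp [h, hzU])
  obtain ⟨r, hr, hrU, χ, hχ, hχe⟩ := exists_local_log (F := Q) (hUo.mem_nhds hxU)
    (fun z hz => (hQc z (hUne z hz).1 (hUne z hz).2).continuousWithinAt)
    (hQ0 x (hUne x hxU).1 (hUne x hxU).2)
  refine zpow_eq_zero_of_log_punctured_ball hr (g := k) (hk.mono fun z hz => hz.2) hχ ?_
  intro z hz
  rw [hke z hz.2, ← hχe z hz.1]
  simp [h, hrU hz.1]

end Logarithms

/-! ### Functions that separate two points of a simply connected domain, and logarithms off a ray.
-/

section Separators

open Complex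

/-- Moving the zero along `γ`, starting at the pole `γ 0`, deforms the constant `1` through
functions that have no zero off the curve; the logarithm is lifted from `0`. -/
theorem exists_log_path {γ : ℝ → ℂ} (hγ : Continuous γ) :
    ∃ L : ℝ → ℂ → ℂ, ContinuousOn (fun q : ℝ × ℂ => L q.1 q.2) (Icc 0 1 ×ˢ (γ '' Icc 0 1)ᶜ) ∧
      (∀ t ∈ Icc (0 : ℝ) 1, ∀ z ∈ (γ '' Icc 0 1)ᶜ, exp (L t z) = (z - γ t) / (z - γ 0)) ∧
      ∀ z ∈ (γ '' Icc 0 1)ᶜ, L 0 z = 0 := by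
  have hne : ∀ t ∈ Icc (0 : ℝ) 1, ∀ z ∈ (γ '' Icc 0 1)ᶜ, z - γ t ≠ 0 := fun t ht z hz h =>
    hz ⟨t, ht, (sub_eq_zero.1 h).symm⟩
  have h0 : (0 : ℝ) ∈ Icc (0 : ℝ) 1 := by simp
  refine exists_log_homotopy (H := fun t z => (z - γ t) / (z - γ 0)) (g := fun _ => 0) ?_ ?_
    continuousOn_const ?_
  · exact ContinuousOn.div (by fun_prop) (by fun_prop) fun q hq => hne 0 h0 _ hq.2
  · exact fun t ht z hz => div_ne_zero (hne t ht z hz) (hne 0 h0 z hz)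
  · intro z hz
    rw [exp_zero, div_self (hne 0 h0 z hz)]

/-- The logarithm lifts over the whole square of the homotopy, and on the edge that corresponds to
the common end `x` it is constant because the lifted function is. So its final value depends only on
the homotopy class of the path in the complement of `z`. -/
theorem log_path_eq_of_homotopy {F : ℝ → ℝ → ℂ} (hF : Continuous fun q : ℝ × ℝ => F q.1 q.2)
    {x y z : ℂ} (h0 : ∀ u ∈ Icc (0 : ℝ) 1, F u 0 = y) (h1 : ∀ u ∈ Icc (0 : ℝ) 1, F u 1 = x)
    (hz : ∀ u ∈ Icc (0 : ℝ) 1, ∀ t ∈ Icc (0 : ℝ) 1, F u t ≠ z) {l₀ l₁ : ℝ → ℂ}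
    (hl₀ : ContinuousOn l₀ (Icc 0 1)) (hl₁ : ContinuousOn l₁ (Icc 0 1))
    (e₀ : ∀ t ∈ Icc (0 : ℝ) 1, exp (l₀ t) = (z - F 0 t) / (z - y))
    (e₁ : ∀ t ∈ Icc (0 : ℝ) 1, exp (l₁ t) = (z - F 1 t) / (z - y)) (z₀ : l₀ 0 = 0)
    (z₁ : l₁ 0 = 0) : l₀ 1 = l₁ 1 := by
  have m0 : (0 : ℝ) ∈ Icc (0 : ℝ) 1 := by simp
  have m1 : (1 : ℝ) ∈ Icc (0 : ℝ) 1 := by simp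
  have hzy : z - y ≠ 0 := fun h => hz 0 m0 0 m0 (by rw [h0 0 m0, sub_eq_zero.1 h])
  obtain ⟨G, hG, hGe, hG0⟩ := exists_log_homotopy (S := Icc (0 : ℝ) 1)
    (H := fun t u => (z - F u t) / (z - y)) (g := fun _ => 0) (by
      have : Continuous fun q : ℝ × ℝ => F q.2 q.1 := hF.comp (continuous_snd.prodMk continuous_fst)
      exact Continuous.continuousOn (by fun_prop))
    (fun t ht u hu => div_ne_zero (sub_ne_zero.2 (hz u hu t ht).symm) hzy) continuousOn_const
    (fun u hu => by rw [exp_zero, h0 u hu, div_self hzy])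
  have hcol : ∀ u ∈ Icc (0 : ℝ) 1, ContinuousOn (fun t => G t u) (Icc 0 1) := fun u hu =>
    hG.comp (f := fun t => (t, u)) (by fun_prop) fun t ht => ⟨ht, hu⟩
  have a0 := isPreconnected_Icc.eq_of_exp_eq hl₀ (hcol 0 m0)
    (fun t ht => by rw [e₀ t ht, hGe t ht 0 m0]) m0 (by rw [z₀, hG0 0 m0]) m1
  have a1 := isPreconnected_Icc.eq_of_exp_eq hl₁ (hcol 1 m1)
    (fun t ht => by rw [e₁ t ht, hGe t ht 1 m1]) m0 (by rw [z₁, hG0 1 m1]) m1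
  have hrow : ContinuousOn (fun u => G 1 u) (Icc 0 1) :=
    hG.comp (f := fun u => ((1 : ℝ), u)) (by fun_prop) fun u hu => ⟨m1, hu⟩
  have a2 := isPreconnected_Icc.eq_of_exp_eq hrow (continuousOn_const (c := G 1 0))
    (fun u hu => by rw [hGe 1 m1 u hu, hGe 1 m1 0 m0, h1 u hu, h1 0 m0]) m0 rfl m1
  rw [a0, a1]
  exact a2.symm

/-- The function `(z - x) / (z - y) * exp (-ℓ z)` has its zero at `x` and its pole at `y`, and is
equal to `1` outside the compact subset `C` of `Ω`.  Along subsets of `Ω` that do not separate `x`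
from `y` it has a logarithm with compact support in `Ω`. -/
structure IsSeparator (Ω : Set ℂ) (x y : ℂ) (ℓ : ℂ → ℂ) (C : Set ℂ) : Prop where
  continuous : Continuous ℓ
  isCompact : IsCompact C
  subset : C ⊆ Ω
  exp_eq : ∀ z ∉ C, exp (ℓ z) = (z - x) / (z - y)
  exists_log : ∀ γ : Path y x, (∀ t, γ t ∈ Ω) → ∃ (L : ℂ → ℂ) (C' : Set ℂ),
    ContinuousOn L (range γ)ᶜ ∧ (∀ z ∈ (range γ)ᶜ, exp (L z) = (z - x) / (z - y) * exp (-ℓ z)) ∧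
    IsCompact C' ∧ C' ⊆ Ω ∧ ∀ z ∉ C', L z = 0

/-- Cut off the logarithm given by one path `γ₀` in `Ω`: made `0` near `γ₀`, where it is not
defined, and left unchanged outside a compact subset of `Ω`. By simple connectivity any other path
`γ` in `Ω` is homotopic to `γ₀`, and away from the compact image of the homotopy both paths define
the same logarithm. -/
theorem exists_isSeparator {Ω : Set ℂ} (hΩ : IsOpen Ω) (hs : IsSimplyConnected Ω) {x y : ℂ}
    (hx : x ∈ Ω) (hy : y ∈ Ω) : ∃ ℓ C, IsSeparator Ω x y ℓ C := by
  classical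
  have hlog : ∀ γ : Path y x, ∃ L : ℝ → ℂ → ℂ,
      ContinuousOn (fun q : ℝ × ℂ => L q.1 q.2) (Icc 0 1 ×ˢ (range γ)ᶜ) ∧
      (∀ t ∈ Icc (0 : ℝ) 1, ∀ z ∈ (range γ)ᶜ, exp (L t z) = (z - γ.extend t) / (z - y)) ∧
      ∀ z ∈ (range γ)ᶜ, L 0 z = 0 := by
    intro γ
    have := exists_log_path γ.continuous_extend
    have e : (γ.extend '' Icc 0 1) = range γ := by
      rw [γ.image_extend_of_subset subset_rfl]
    rw [e] at this
    simpa using this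
  choose L hLc hLe hL0 using hlog
  have m1 : (1 : ℝ) ∈ Icc (0 : ℝ) 1 := by simp
  have hL1c : ∀ γ : Path y x, ContinuousOn (L γ 1) (range γ)ᶜ := fun γ =>
    (hLc γ).comp (f := fun z => ((1 : ℝ), z)) (by fun_prop) fun z hz => ⟨m1, hz⟩
  have hL1e : ∀ γ : Path y x, ∀ z ∈ (range γ)ᶜ, exp (L γ 1 z) = (z - x) / (z - y) := by
    intro γ z hz
    simpa using hLe γ 1 m1 z hz
  obtain ⟨γ₀, hγ₀⟩ := hs.isPathConnected.joinedIn y hy x hx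
  obtain ⟨C₁, hC₁, hγC₁, hC₁Ω⟩ := exists_compact_between (isCompact_range γ₀.continuous) hΩ
    (range_subset_iff.2 hγ₀)
  obtain ⟨C, hC, hC₁C, hCΩ⟩ := exists_compact_between hC₁ hΩ hC₁Ω
  -- `χ` is `0` on the neighbourhood `C₁` of `γ₀` and `1` off `interior C`.
  obtain ⟨χ, hχ0, hχ1, -⟩ := exists_continuous_zero_one_of_isClosed hC₁.isClosed
    (isOpen_interior (s := C)).isClosed_compl (disjoint_compl_right_iff_subset.2 hC₁C)
  have hχC : ∀ z ∉ C, χ z = 1 := fun z hz => hχ1 fun h => hz (interior_subset h)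
  have hγ₀C : ∀ z ∉ C, z ∈ (range γ₀)ᶜ := fun z hz h =>
    hz (interior_subset (hC₁C (interior_subset (hγC₁ h))))
  have hℓ : Continuous fun z => χ z * L γ₀ 1 z := by
    rw [continuous_iff_continuousAt]
    intro z
    by_cases hz : z ∈ interior C₁
    · refine (continuousAt_const (y := (0 : ℂ))).congr ?_
      filter_upwards [isOpen_interior.mem_nhds hz] with v hv
      simp [hχ0 (interior_subset hv)]
    · have hz' : z ∈ (range γ₀)ᶜ := fun h => hz (hγC₁ h)
      refine ContinuousAt.mul (by fun_prop) ((hL1c γ₀).continuousAt ?_)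
      exact (isCompact_range γ₀.continuous).isClosed.isOpen_compl.mem_nhds hz'
  refine ⟨fun z => χ z * L γ₀ 1 z, C, hℓ, hC, hCΩ, ?_, ?_⟩
  · intro z hz
    simp only [hχC z hz, ofReal_one, one_mul]
    exact hL1e γ₀ z (hγ₀C z hz)
  · intro γ hγ
    have hst := hs.simplyConnectedSpace
    let a : Ω := ⟨y, hy⟩
    let b : Ω := ⟨x, hx⟩
    let p₀ : Path a b := ⟨⟨fun t => ⟨γ₀ t, hγ₀ t⟩, by fun_prop⟩, by simp [a], by simp [b]⟩
    let p₁ : Path a b := ⟨⟨fun t => ⟨γ t, hγ t⟩, by fun_prop⟩, by simp [a], by simp [b]⟩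
    -- The image of this homotopy, joined to `C`, is the compact set off which the new logarithm
    -- vanishes.
    obtain ⟨F⟩ := SimplyConnectedSpace.paths_homotopic p₀ p₁
    let f : ℝ → ℝ → ℂ := fun u t => (F (projIcc 0 1 zero_le_one u, projIcc 0 1 zero_le_one t) : Ω)
    have hf : Continuous fun q : ℝ × ℝ => f q.1 q.2 := by
      refine continuous_subtype_val.comp (F.continuous.comp ?_)
      exact (continuous_projIcc.comp continuous_fst).prodMk (continuous_projIcc.comp continuous_snd)
    have hf0 : ∀ u, f u 0 = y := by intro u; simp [f, a, projIcc_left]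
    have hf1 : ∀ u, f u 1 = x := by intro u; simp [f, b, projIcc_right]
    have hfl : ∀ t, f 0 t = γ₀.extend t := by
      intro t; simp [f, projIcc_left, p₀, Path.extend, IccExtend]
    have hfr : ∀ t, f 1 t = γ.extend t := by
      intro t; simp [f, projIcc_right, p₁, Path.extend, IccExtend]
    let C' : Set ℂ := C ∪ (fun q : ℝ × ℝ => f q.1 q.2) '' (Icc 0 1 ×ˢ Icc 0 1)
    have hγC' : ∀ z ∉ C', z ∈ (range γ)ᶜ := by
      rintro z hz ⟨t, rfl⟩
      refine hz (Or.inr ⟨(1, t), ⟨m1, t.2⟩, ?_⟩)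
      simp only [hfr]
      exact γ.extend_apply t.2
    refine ⟨fun z => L γ 1 z - χ z * L γ₀ 1 z, C', ?_, ?_, ?_, ?_, ?_⟩
    · exact (hL1c γ).sub hℓ.continuousOn
    · intro z hz
      rw [← hL1e γ z hz, ← exp_add, ← sub_eq_add_neg]
    · exact hC.union ((isCompact_Icc.prod isCompact_Icc).image hf)
    · rintro z (hz | ⟨q, -, rfl⟩)
      · exact hCΩ hz
      · exact Subtype.coe_prop _
    · intro z hz
      have hzC : z ∉ C := fun h => hz (Or.inl h)
      have hcol : ∀ γ : Path y x, z ∈ (range γ)ᶜ → ContinuousOn (fun t => L γ t z) (Icc 0 1) :=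
        fun γ hγz => (hLc γ).comp (f := fun t => (t, z)) (by fun_prop) fun t ht => ⟨ht, hγz⟩
      have h := log_path_eq_of_homotopy hf (fun u _ => hf0 u) (fun u _ => hf1 u) (z := z)
        (fun u hu t ht h => hz (Or.inr ⟨(u, t), ⟨hu, ht⟩, h⟩))
        (hcol γ₀ (hγ₀C z hzC)) (hcol γ (hγC' z hz))
        (fun t ht => by rw [hfl, hLe γ₀ t ht z (hγ₀C z hzC)])
        (fun t ht => by rw [hfr, hLe γ t ht z (hγC' z hz)])
        (hL0 γ₀ z (hγ₀C z hzC)) (hL0 γ z (hγC' z hz))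
      simp [hχC z hzC, h]

/-- The logarithm of `z - ρ s₁` on the complement of a ray in `Ω` that begins at `ρ s₁` and leaves
`Ω` as its parameter tends to `0`. -/
theorem exists_log_sub_of_ray {Ω : Set ℂ} (hΩ : IsOpen Ω) (hs : IsSimplyConnected Ω) {ρ : ℝ → ℂ}
    (hρ : ContinuousOn ρ (Ioo 0 1)) (hρΩ : MapsTo ρ (Ioo 0 1) Ω)
    (hend : (∃ b ∉ Ω, Tendsto ρ (𝓝[>] 0) (𝓝 b)) ∨ Tendsto (fun s => ‖ρ s‖) (𝓝[>] 0) atTop)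
    {s₁ s₂ : ℝ} (hs₁ : s₁ ∈ Ioo (0 : ℝ) 1) (hs₂ : s₂ ∈ Ioo (0 : ℝ) 1)
    (hc : ρ s₂ ∉ ρ '' Ioc 0 s₁) :
    ∃ g : ℂ → ℂ, ContinuousOn g (Ω \ ρ '' Ioc 0 s₁) ∧
      ∀ z ∈ Ω \ ρ '' Ioc 0 s₁, exp (g z) = z - ρ s₁ := by
  set c := ρ s₂ with hcdef
  have hcne : ∀ t, 0 < t → t ≤ 1 → c - ρ (t * s₁) ≠ 0 := fun t h0 h1 h =>
    hc ⟨t * s₁, ⟨mul_pos h0 hs₁.1, by nlinarith [hs₁.1]⟩, (sub_eq_zero.1 h).symm⟩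
  have hmul : Tendsto (fun t : ℝ => t * s₁) (𝓝[>] 0) (𝓝[>] 0) := by
    refine tendsto_nhdsWithin_iff.2 ⟨?_, ?_⟩
    · have : Tendsto (fun t : ℝ => t * s₁) (𝓝 0) (𝓝 (0 * s₁)) := by
        exact (continuous_id.mul continuous_const).tendsto 0
      rw [zero_mul] at this
      exact this.mono_left nhdsWithin_le_nhds
    · filter_upwards [self_mem_nhdsWithin] with t ht
      exact mul_pos ht hs₁.1
  -- The zero of `z - ρ s₁` is moved out of `Ω` along the ray. Normalised to be `1` at `c`, the
  -- function with zero `ρ (t * s₁)` is `1 + (z - c) * κ t` with `κ t = (c - ρ (t * s₁))⁻¹`. This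
  -- form has a limit as `t → 0` both when the ray ends on the boundary and when it goes to
  -- infinity. The limit has no zero in `Ω`, so it has a logarithm on all of `Ω`, from which the
  -- lifting starts.
  obtain ⟨κ₀, hκ₀, hκne⟩ : ∃ κ₀ : ℂ, Tendsto (fun t => (c - ρ (t * s₁))⁻¹) (𝓝[>] 0) (𝓝 κ₀) ∧
      ∀ z ∈ Ω, 1 + (z - c) * κ₀ ≠ 0 := by
    rcases hend with ⟨b, hb, h⟩ | h
    · have hcb : c - b ≠ 0 := fun h => hb (sub_eq_zero.1 h ▸ hρΩ hs₂)
      refine ⟨(c - b)⁻¹, ((tendsto_const_nhds.sub (h.comp hmul)).inv₀ hcb), fun z hz e => hb ?_⟩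
      field_simp at e
      have : z = b := by linear_combination e
      exact this ▸ hz
    · refine ⟨0, ?_, by simp⟩
      rw [tendsto_zero_iff_norm_tendsto_zero]
      simp only [norm_inv]
      refine Tendsto.inv_tendsto_atTop ?_
      refine tendsto_atTop_mono (f := fun t => ‖ρ (t * s₁)‖ - ‖c‖) (fun t => ?_) ?_
      · rw [norm_sub_rev]; exact norm_sub_norm_le _ _
      · exact tendsto_atTop_add_const_right _ _ (h.comp hmul)
  let κ : ℝ → ℂ := fun t => if t = 0 then κ₀ else (c - ρ (t * s₁))⁻¹
  have hκ : ContinuousOn κ (Icc 0 1) := by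
    intro t ht
    rcases eq_or_lt_of_le ht.1 with h | h
    · subst h
      have h1 : Tendsto κ (𝓝[>] 0) (𝓝 κ₀) := by
        refine hκ₀.congr' ?_
        filter_upwards [self_mem_nhdsWithin] with t ht
        simp [κ, (mem_Ioi.1 ht).ne']
      have h2 : ContinuousWithinAt κ (Ioi 0) 0 := by
        simpa [ContinuousWithinAt, κ] using h1
      have h3 := continuousWithinAt_insert_self.2 h2
      refine h3.mono fun t ht => ?_
      rcases eq_or_lt_of_le ht.1 with h | h
      · exact Or.inl h.symm
      · exact Or.inr h
    · have hm : t * s₁ ∈ Ioo (0 : ℝ) 1 := ⟨mul_pos h hs₁.1, by nlinarith [hs₁.1, hs₁.2, ht.2]⟩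
      have h1 : ContinuousAt (fun t => ρ (t * s₁)) t :=
        ContinuousAt.comp (f := fun t => t * s₁) (hρ.continuousAt (isOpen_Ioo.mem_nhds hm))
          (by fun_prop)
      have h2 : ContinuousAt (fun t => (c - ρ (t * s₁))⁻¹) t :=
        (continuousAt_const.sub h1).inv₀ (hcne t h ht.2)
      refine (h2.congr ?_).continuousWithinAt
      filter_upwards [lt_mem_nhds h] with v hv
      simp [κ, ne_of_gt hv]
  have hform : ∀ t, 0 < t → t ≤ 1 → ∀ z,
      1 + (z - c) * κ t = (z - ρ (t * s₁)) * (c - ρ (t * s₁))⁻¹ := by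
    intro t h0 h1 z
    have := hcne t h0 h1
    simp only [κ, h0.ne', if_false]
    field_simp
    ring
  obtain ⟨g₀, hg₀, hg₀e⟩ := exists_continuousOn_eqOn_exp_comp hs hΩ
    (g := fun z => 1 + (z - c) * κ₀) (by fun_prop) (by rintro ⟨z, hz, h⟩; exact hκne z hz h)
  obtain ⟨G, hG, hGe, -⟩ := exists_log_homotopy (S := Ω \ ρ '' Ioc 0 s₁)
    (H := fun t z => 1 + (z - c) * κ t) (g := g₀) (by
      have : ContinuousOn (fun q : ℝ × ℂ => κ q.1) (Icc 0 1 ×ˢ (Ω \ ρ '' Ioc 0 s₁)) :=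
        hκ.comp (by fun_prop) fun q hq => hq.1
      exact continuousOn_const.add (ContinuousOn.mul (by fun_prop) this)) (by
      intro t ht z hz
      rcases eq_or_lt_of_le ht.1 with h | h
      · rw [← h]
        simpa [κ] using hκne z hz.1
      · rw [hform t h ht.2]
        refine mul_ne_zero (sub_ne_zero.2 fun e => hz.2 ⟨t * s₁, ⟨mul_pos h hs₁.1, ?_⟩, e.symm⟩)
          (inv_ne_zero (hcne t h ht.2))
        nlinarith [hs₁.1, ht.2])
    (hg₀.mono sdiff_subset) (fun z hz => by simpa [κ] using hg₀e hz.1)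
  have h1 := hcne 1 one_pos le_rfl
  rw [one_mul] at h1
  refine ⟨fun z => G 1 z + log (c - ρ s₁), ?_, fun z hz => ?_⟩
  · exact (hG.comp (f := fun z => ((1 : ℝ), z)) (by fun_prop) fun z hz => ⟨by simp, hz⟩).add
      continuousOn_const
  · rw [exp_add, exp_log h1, hGe 1 (by simp) z hz, hform 1 one_pos le_rfl, one_mul,
      inv_mul_cancel_right₀ h1]

end Separators

/-! ### Paths and branches in trees. -/

namespace SimpleGraph

variable {V : Type*} {G : SimpleGraph V}

/-- The edges of `G` whose removal disconnects `a` from `b`. -/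
def pathBetween (G : SimpleGraph V) (a b : V) : SimpleGraph V where
  Adj u v := G.Adj u v ∧ ¬ (G.deleteEdges {s(u, v)}).Reachable a b
  symm := ⟨fun u v h => ⟨h.1.symm, by rw [Sym2.eq_swap]; exact h.2⟩⟩
  loopless := ⟨fun u h => G.loopless.1 u h.1⟩

theorem pathBetween_le (a b : V) : G.pathBetween a b ≤ G := fun _ _ h => h.1

theorem pathBetween_comm (a b : V) : G.pathBetween a b = G.pathBetween b a := by
  ext u v
  simp only [pathBetween, reachable_comm]

/-- If `a` remained connected to both `b` and `c` after the removal of an edge, then so would `b` to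
`c`. -/
theorem pathBetween_le_sup (a b c : V) : G.pathBetween b c ≤ G.pathBetween a b ⊔ G.pathBetween a c := by
  intro u v h
  by_contra h'
  simp only [sup_adj, pathBetween, h.1, true_and, not_or, not_not] at h'
  exact h.2 (h'.1.symm.trans h'.2)

/-- The vertices on the far side of the edge `uv`, seen from `u`. -/
def branch (G : SimpleGraph V) (u v : V) : Set V :=
  {w | (G.deleteEdges {s(u, v)}).Reachable v w}

theorem mem_branch_self (u v : V) : v ∈ G.branch u v := Reachable.refl _

theorem IsAcyclic.notMem_branch (hG : G.IsAcyclic) {u v : V} (h : G.Adj u v) :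
    u ∉ G.branch u v := fun h' =>
  (isBridge_iff.1 (isAcyclic_iff_forall_adj_isBridge.1 hG h)) h'.symm

/-- A walk that avoids an edge of `p` would reduce to a second path with the same ends, but paths in
a forest are unique. -/
theorem mem_edges_iff_pathBetween_adj (hG : G.IsAcyclic) {a b : V} {p : G.Walk a b} (hp : p.IsPath)
    {u v : V} : s(u, v) ∈ p.edges ↔ (G.pathBetween a b).Adj u v := by
  classical
  constructor
  · intro h
    refine ⟨p.adj_of_mem_edges h, fun hr => ?_⟩
    obtain ⟨q, hq⟩ := reachable_deleteEdges_iff_exists_walk.1 hr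
    have h1 : (q.toPath : G.Walk a b) = p :=
      congrArg Subtype.val ((hG.subsingleton_path a b).elim q.toPath ⟨p, hp⟩)
    exact hq (q.edges_toPath_subset_edges (h1 ▸ h))
  · intro h
    by_contra h'
    exact h.2 (reachable_deleteEdges_iff_exists_walk.2 ⟨p, h'⟩)

theorem Connected.mem_branch_or (hG : G.Connected) {u v : V} (h : G.Adj u v) (w : V) :
    w ∈ G.branch u v ∨ w ∈ G.branch v u := by
  classical
  obtain ⟨p⟩ := hG v w
  have hp := p.toPath.2
  generalize (p.toPath : G.Walk v w) = q at hp
  cases q with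
  | nil => exact Or.inl (mem_branch_self _ _)
  | @cons _ x _ hx q =>
    by_cases hxu : x = u
    · subst hxu
      right
      refine reachable_deleteEdges_iff_exists_walk.2 ⟨q, fun hq => ?_⟩
      exact ((Walk.cons_isPath_iff _ _).1 hp).2 (q.fst_mem_support_of_mem_edges hq)
    · left
      refine reachable_deleteEdges_iff_exists_walk.2 ⟨Walk.cons hx q, fun hq => ?_⟩
      rw [Walk.edges_cons, List.mem_cons] at hq
      rcases hq with hq | hq
      · rcases Sym2.eq_iff.1 hq with h1 | h1
        · exact absurd h1.1 h.ne
        · exact hxu h1.1.symm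
      · exact ((Walk.cons_isPath_iff _ _).1 hp).2 (q.snd_mem_support_of_mem_edges hq)

/-- Reduces questions about paths to propositional logic on the branches that contain their ends. -/
theorem pathBetween_adj_iff_branch (hG : G.IsTree) {u v a b : V} (h : G.Adj u v) :
    (G.pathBetween a b).Adj u v ↔
      (a ∈ G.branch u v ∧ b ∉ G.branch u v) ∨ (a ∉ G.branch u v ∧ b ∈ G.branch u v) := by
  have hsw : ∀ w, w ∈ G.branch v u ↔ (G.deleteEdges {s(u, v)}).Reachable u w := by
    intro w; simp only [branch, mem_ofPred_eq, Sym2.eq_swap]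
  constructor
  · intro h1
    by_cases ha : a ∈ G.branch u v
    · exact Or.inl ⟨ha, fun hb => h1.2 (ha.symm.trans hb)⟩
    · refine Or.inr ⟨ha, by_contra fun hb => h1.2 ?_⟩
      have ha' := (hsw a).1 ((hG.1.mem_branch_or h a).resolve_left ha)
      have hb' := (hsw b).1 ((hG.1.mem_branch_or h b).resolve_left hb)
      exact ha'.symm.trans hb'
  · rintro (⟨ha, hb⟩ | ⟨ha, hb⟩)
    · exact ⟨h, fun hr => hb (ha.trans hr)⟩
    · exact ⟨h, fun hr => ha (hb.trans hr.symm)⟩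

theorem mem_branch_swap (hG : G.IsTree) {u v : V} (h : G.Adj u v) (w : V) :
    w ∈ G.branch v u ↔ w ∉ G.branch u v := by
  have hsw : ∀ w, w ∈ G.branch v u ↔ (G.deleteEdges {s(u, v)}).Reachable u w := by
    intro w; simp only [branch, mem_ofPred_eq, Sym2.eq_swap]
  constructor
  · intro h1 h2
    exact hG.2.notMem_branch h (h2.trans ((hsw w).1 h1).symm)
  · exact (hG.1.mem_branch_or h w).resolve_left

/-- A walk beyond `vw` that used the edge `uv` would pass through `v`, placing `v` in its own far
branch. -/
theorem branch_subset (hG : G.IsTree) {u v w : V} (huv : G.Adj u v) (hvw : G.Adj v w)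
    (hwu : w ≠ u) : G.branch v w ⊆ G.branch u v := by
  intro x hx
  have hne : s(u, v) ≠ s(v, w) := by
    intro h
    rcases Sym2.eq_iff.1 h with h1 | h1
    · exact huv.ne h1.1
    · exact hwu h1.1.symm
  have h1 : (G.deleteEdges {s(u, v)}).Adj v w := by
    rw [deleteEdges_adj]
    exact ⟨hvw, fun h => hne h.symm⟩
  obtain ⟨q, hq⟩ := reachable_deleteEdges_iff_exists_walk.1 hx
  refine h1.reachable.trans (reachable_deleteEdges_iff_exists_walk.2 ⟨q, fun h => ?_⟩)
  refine hG.2.notMem_branch hvw ?_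
  classical
  have hv : v ∈ q.support := q.snd_mem_support_of_mem_edges h
  refine reachable_deleteEdges_iff_exists_walk.2 ⟨q.takeUntil v hv, fun h' => hq ?_⟩
  exact q.edges_takeUntil_subset_edges hv h'

/-- A vertex different from `v` lies in exactly one of the branches at `v`. -/
theorem existsUnique_branch (hG : G.IsTree) {v a : V} (h : v ≠ a) :
    ∃! w, G.Adj v w ∧ a ∈ G.branch v w := by
  obtain ⟨p, hp, -⟩ := hG.existsUnique_path v a
  have key : ∀ w, G.Adj v w ∧ a ∈ G.branch v w ↔ (G.pathBetween v a).Adj v w := by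
    intro w
    constructor
    · rintro ⟨h1, h2⟩
      exact (pathBetween_adj_iff_branch hG h1).2 (Or.inr ⟨hG.2.notMem_branch h1, h2⟩)
    · intro h1
      refine ⟨h1.1, ?_⟩
      rcases (pathBetween_adj_iff_branch hG h1.1).1 h1 with h2 | h2
      · exact absurd h2.1 (hG.2.notMem_branch h1.1)
      · exact h2.2
  refine ⟨p.snd, ?_, fun w hw => ?_⟩
  · simp only [key]
    rw [← mem_edges_iff_pathBetween_adj hG.2 hp]
    exact p.mk_start_snd_mem_edges (Walk.not_nil_of_ne h)
  · simp only [key] at hw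
    refine hG.2.eq_snd_of_adj_start hp hw.1 ?_
    exact p.snd_mem_support_of_mem_edges ((mem_edges_iff_pathBetween_adj hG.2 hp).2 hw)

/-- The path between `a` and `b` runs through a vertex different from `a` and `b` along exactly two
edges. -/
theorem exists_other_pathBetween_adj (hG : G.IsTree) {a b v w : V}
    (h : (G.pathBetween a b).Adj v w) (hva : v ≠ a) (hvb : v ≠ b) :
    ∃ w', w' ≠ w ∧ (G.pathBetween a b).Adj v w' ∧
      ∀ x, (G.pathBetween a b).Adj v x → x = w ∨ x = w' := by
  obtain ⟨wa, ⟨ha, ha'⟩, hau⟩ := existsUnique_branch hG hva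
  obtain ⟨wb, ⟨hb, hb'⟩, hbu⟩ := existsUnique_branch hG hvb
  have hab : wa ≠ wb := by
    rintro rfl
    rcases (pathBetween_adj_iff_branch hG h.1).1 h with h1 | h1
    · exact h1.2 (hau w ⟨h.1, h1.1⟩ ▸ hb')
    · exact h1.1 (hbu w ⟨h.1, h1.2⟩ ▸ ha')
  have h1 : ∀ x, (G.pathBetween a b).Adj v x → x = wa ∨ x = wb := by
    intro x hx
    rcases (pathBetween_adj_iff_branch hG hx.1).1 hx with h1 | h1
    · exact Or.inl (hau x ⟨hx.1, h1.1⟩)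
    · exact Or.inr (hbu x ⟨hx.1, h1.2⟩)
  have h2 : (G.pathBetween a b).Adj v wa :=
    (pathBetween_adj_iff_branch hG ha).2 (Or.inl ⟨ha', fun h => hab (hbu _ ⟨ha, h⟩)⟩)
  have h3 : (G.pathBetween a b).Adj v wb :=
    (pathBetween_adj_iff_branch hG hb).2 (Or.inr ⟨fun h => hab (hau _ ⟨hb, h⟩).symm, hb'⟩)
  rcases h1 w h with rfl | rfl
  · exact ⟨wb, hab.symm, h3, h1⟩
  · exact ⟨wa, hab, h2, fun x hx => (h1 x hx).symm⟩

/-- A vertex with a single neighbour lies on the path between `a` and `b` only if it is one of its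
ends. -/
theorem eq_or_eq_of_pathBetween_adj (hG : G.IsTree) {a b c w : V}
    (hc : ∀ x y, G.Adj c x → G.Adj c y → x = y) (h : (G.pathBetween a b).Adj c w) :
    c = a ∨ c = b := by
  by_contra h'
  rw [not_or] at h'
  obtain ⟨w', h1, h2, -⟩ := exists_other_pathBetween_adj hG h h'.1 h'.2
  exact h1 (hc _ _ h2.1 h.1)

theorem pathBetween_adj_start (hG : G.IsTree) {a b w : V} (hab : a ≠ b)
    (ha : ∀ x y, G.Adj a x → G.Adj a y → x = y) (h : G.Adj a w) : (G.pathBetween a b).Adj a w := by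
  obtain ⟨w', h1, -⟩ := existsUnique_branch hG hab
  obtain rfl := ha _ _ h h1.1
  exact (pathBetween_adj_iff_branch hG h).2 (Or.inr ⟨hG.2.notMem_branch h, h1.2⟩)

theorem IsTree.exists_walk_pathBetween (hG : G.IsTree) (a b : V) :
    ∃ p : (G.pathBetween a b).Walk a b, ∀ u v, (G.pathBetween a b).Adj u v → u ∈ p.support := by
  obtain ⟨p, hp, -⟩ := hG.existsUnique_path a b
  have h : ∀ e ∈ p.edges, e ∈ (G.pathBetween a b).edgeSet := by
    intro e
    induction e with
    | _ u v => exact (mem_edges_iff_pathBetween_adj hG.2 hp).1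
  refine ⟨p.transfer _ h, fun u v huv => ?_⟩
  rw [Walk.support_transfer]
  exact p.fst_mem_support_of_mem_edges ((mem_edges_iff_pathBetween_adj hG.2 hp).2 huv)

theorem pathBetween_reachable (hG : G.IsTree) {a b u v u' v' : V}
    (h : (G.pathBetween a b).Adj u v) (h' : (G.pathBetween a b).Adj u' v') :
    (G.pathBetween a b).Reachable u u' := by
  classical
  obtain ⟨p, hp⟩ := hG.exists_walk_pathBetween a b
  exact (p.takeUntil u (hp u v h)).reachable.symm.trans (p.takeUntil u' (hp u' v' h')).reachable

/-- The edges beyond `uv` do not lie on paths whose ends are on the near side of `uv`. -/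
theorem not_pathBetween_adj_of_branch (hG : G.IsTree) {u v a b x y : V} (huv : G.Adj u v)
    (ha : a ∉ G.branch u v) (hb : b ∉ G.branch u v) (hx : x ∈ G.branch u v) :
    ¬ (G.pathBetween a b).Adj x y := by
  intro h
  by_cases hy : x = v ∧ y = u
  · obtain ⟨rfl, rfl⟩ := hy
    rcases (pathBetween_adj_iff_branch hG huv).1 h.symm with h1 | h1
    · exact ha h1.1
    · exact hb h1.2
  obtain ⟨p, hp⟩ := hG.exists_walk_pathBetween a b
  have hxp : x ∈ p.support := hp x y h
  have huvn : ¬ (G.pathBetween a b).Adj u v := fun h => by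
    rcases (pathBetween_adj_iff_branch hG huv).1 h with h1 | h1
    · exact ha h1.1
    · exact hb h1.2
  have hle : G.pathBetween a b ≤ G.deleteEdges {s(u, v)} := by
    intro z w hzw
    rw [deleteEdges_adj]
    refine ⟨hzw.1, fun e => huvn ?_⟩
    rcases Sym2.eq_iff.1 e with e | e
    · rw [← e.1, ← e.2]; exact hzw
    · rw [← e.1, ← e.2]; exact hzw.symm
  classical
  exact ha (hx.trans ((p.takeUntil x hxp).reachable.symm.mono hle))

/-- In a finite tree every branch contains a vertex that belongs to a set `P` of vertices, if all
vertices outside `P` have at least two neighbours. -/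
theorem exists_mem_branch (hG : G.IsTree) [Finite V] {P : V → Prop}
    (hP : ∀ v, ¬ P v → ∀ u, ∃ w, w ≠ u ∧ G.Adj v w) {u v : V} (huv : G.Adj u v) :
    ∃ c ∈ G.branch u v, P c := by
  -- Induction on the size of the branch: going one edge further away from `u` loses at least the
  -- vertex `v`.
  have main : ∀ n : ℕ, ∀ u v : V, G.Adj u v → (G.branch u v).ncard = n →
      ∃ c ∈ G.branch u v, P c := by
    intro n
    induction n using Nat.strong_induction_on with
    | _ n ih =>
      intro u v huv hn
      by_cases hv : P v
      · exact ⟨v, mem_branch_self _ _, hv⟩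
      obtain ⟨w, hwu, hvw⟩ := hP v hv u
      have hsub := branch_subset hG huv hvw hwu
      have hlt : (G.branch v w).ncard < n := by
        rw [← hn]
        refine Set.ncard_lt_ncard ⟨hsub, fun h => ?_⟩ (Set.toFinite _)
        exact hG.2.notMem_branch hvw (h (mem_branch_self u v))
      obtain ⟨c, hc, hPc⟩ := ih _ hlt v w hvw rfl
      exact ⟨c, hsub hc, hPc⟩
  exact main _ u v huv rfl

/-- On a tree every assignment of group elements to oriented edges is the difference of a function on
the vertices. -/
theorem IsTree.exists_potential (hG : G.IsTree) {A : Type*} [Group A] (d : V → V → A)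
    (hd : ∀ u v, G.Adj u v → d v u = (d u v)⁻¹) :
    ∃ ℓ : V → A, ∀ u v, G.Adj u v → ℓ v = d u v * ℓ u := by
  obtain ⟨r⟩ := hG.1.nonempty
  choose p hp using fun v => (hG.existsUnique_path r v).exists
  -- The group need not be commutative: the order is reversed so that the last edge multiplies on
  -- the left.
  let f : ∀ v, G.Walk r v → A := fun v q => ((q.darts.map fun e => d e.fst e.snd).reverse).prod
  have hf : ∀ u v (q : G.Walk r u) (h : G.Adj u v), f v (q.concat h) = d u v * f u q := by
    intro u v q h
    simp [f, Walk.darts_concat]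
  refine ⟨fun v => f v (p v), fun u v h => ?_⟩
  -- One of the paths from the root to `u` and to `v` is the other with the edge `uv` appended.
  by_cases hv : v ∈ (p u).support
  · have := hG.2.path_concat (hp v) (hp u) h.symm hv
    simp only
    rw [this, hf, hd u v h, mul_inv_cancel_left]
  · have h1 : u ∈ (p v).support :=
      hG.2.mem_support_of_ne_mem_support_of_adj_of_isPath (hp v) (hp u) h.symm hv
    have := hG.2.path_concat (hp u) (hp v) h h1
    simp only
    rw [this, hf]

end SimpleGraph

/-! ### Three-colorings of the faces of a trivalent tree, combinatorially. -/

namespace SimpleGraph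

variable {V F : Type*} {G : SimpleGraph V}

theorem fin_three_existsUnique_perm : ∀ a b c d : Fin 3, a ≠ b → c ≠ d →
    ∃ π : Equiv.Perm (Fin 3), (π a = c ∧ π b = d) ∧
      ∀ π' : Equiv.Perm (Fin 3), π' a = c → π' b = d → π' = π := by decide

theorem fin_three_perm_third : ∀ (π : Equiv.Perm (Fin 3)) (a b c d : Fin 3), a ≠ b → c ≠ a → c ≠ b →
    d ≠ π a → d ≠ π b → π c = d := by decide

/-- A combinatorial description of the regions cut out by a planar tree all of whose vertices have
one or three neighbours: every face borders the edges of a path between two vertices with a single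
neighbour, and every edge borders exactly two faces. -/
structure IsFaceSystem (G : SimpleGraph V) (B : F → V → V → Prop) : Prop where
  exists_two : ∀ u v, G.Adj u v → ∃ f g, f ≠ g ∧ ∀ k, B k u v ↔ k = f ∨ k = g
  exists_path : ∀ f, ∃ a b, a ≠ b ∧ (∀ x y, G.Adj a x → G.Adj a y → x = y) ∧
    (∀ x y, G.Adj b x → G.Adj b y → x = y) ∧
    ∀ u v, G.Adj u v → (B f u v ↔ (G.pathBetween a b).Adj u v)
  valence : ∀ v, (∃ w, ∀ x, G.Adj v x ↔ x = w) ∨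
    ∃ w : Fin 3 → V, w.Injective ∧ ∀ x, G.Adj v x ↔ ∃ i, w i = x

namespace IsFaceSystem

variable {B : F → V → V → Prop}

theorem symm (h : G.IsFaceSystem B) {f : F} {u v : V} (huv : G.Adj u v) (hf : B f u v) :
    B f v u := by
  obtain ⟨a, b, -, -, -, hB⟩ := h.exists_path f
  exact (hB v u huv.symm).2 ((hB u v huv).1 hf).symm

/-- At a trivalent vertex a face runs through `v` as a path that does not end there, so it borders
exactly two of the three edges and is named by the third. Different faces miss different edges,
hence share the edge that neither of them misses. At a vertex with a single neighbour the two faces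
of the edge are named `0` and `1`. -/
theorem exists_local (h : G.IsFaceSystem B) (hG : G.IsTree) (v : V) :
    ∃ β : F → Fin 3, ∀ f g, (∃ w, G.Adj v w ∧ B f v w) → (∃ w, G.Adj v w ∧ B g v w) → f ≠ g →
      β f ≠ β g ∧ ∃ w, G.Adj v w ∧ B f v w ∧ B g v w := by
  classical
  rcases h.valence v with ⟨w, hw⟩ | ⟨w, hwi, hw⟩
  · obtain ⟨f₀, g₀, hne, hfg⟩ := h.exists_two v w ((hw w).2 rfl)
    refine ⟨fun k => if k = f₀ then 0 else 1, ?_⟩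
    rintro f g ⟨x, hx, hf⟩ ⟨y, hy, hg⟩ hfg'
    rw [hw] at hx hy
    subst hx hy
    refine ⟨?_, y, (hw y).2 rfl, hf, hg⟩
    rcases (hfg f).1 hf with rfl | rfl <;> rcases (hfg g).1 hg with rfl | rfl
    · exact absurd rfl hfg'
    · simp [hfg'.symm]
    · simp [hfg']
    · exact absurd rfl hfg'
  · have hadj : ∀ i, G.Adj v (w i) := fun i => (hw _).2 ⟨i, rfl⟩
    have hmiss : ∀ f, (∃ i, B f v (w i)) → ∃ i, ∀ j, B f v (w j) ↔ j ≠ i := by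
      rintro f ⟨i, hi⟩
      obtain ⟨a, b, -, ha, hb, hB⟩ := h.exists_path f
      have hB' : ∀ j, B f v (w j) ↔ (G.pathBetween a b).Adj v (w j) := fun j => hB _ _ (hadj j)
      have hva : ∀ c, (∀ x y, G.Adj c x → G.Adj c y → x = y) → v ≠ c := by
        rintro c hc rfl
        exact absurd (hwi (hc _ _ (hadj 0) (hadj 1))) (by decide)
      obtain ⟨x, hx, hvx, hall⟩ := exists_other_pathBetween_adj hG ((hB' i).1 hi) (hva a ha) (hva b hb)
      obtain ⟨j, rfl⟩ := (hw x).1 hvx.1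
      have hij : j ≠ i := fun e => hx (e ▸ rfl)
      obtain ⟨k, hk⟩ : ∃ k : Fin 3, ∀ l, l ≠ k ↔ l = i ∨ l = j := by
        have : ∀ i j : Fin 3, j ≠ i → ∃ k : Fin 3, ∀ l, l ≠ k ↔ l = i ∨ l = j := by decide
        exact this _ _ hij
      refine ⟨k, fun l => ?_⟩
      rw [hk l, hB']
      constructor
      · intro hl
        exact (hall _ hl).imp (fun e => hwi e) (fun e => hwi e)
      · rintro (rfl | rfl)
        · exact (hB' _).1 hi
        · exact hvx
    -- Faces that do not touch `v` get the irrelevant value `0`.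
    let β : F → Fin 3 := fun f => if hf : ∃ i, B f v (w i) then (hmiss f hf).choose else 0
    have hβ : ∀ f, (∃ i, B f v (w i)) → ∀ j, B f v (w j) ↔ j ≠ β f := by
      intro f hf
      simp only [β, hf, dite_true]
      exact (hmiss f hf).choose_spec
    refine ⟨β, ?_⟩
    rintro f g ⟨x, hx, hf⟩ ⟨y, hy, hg⟩ hfg
    obtain ⟨i, rfl⟩ := (hw x).1 hx
    obtain ⟨j, rfl⟩ := (hw y).1 hy
    have hβf := hβ f ⟨i, hf⟩
    have hβg := hβ g ⟨j, hg⟩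
    -- If `f` and `g` missed the same edge, a face `m` bordering that edge would also border one of
    -- the two others, which would then bear three faces.
    have hne : β f ≠ β g := by
      intro e
      obtain ⟨m, m', -, hm⟩ := h.exists_two v (w (β f)) (hadj _)
      have hmB : B m v (w (β f)) := (hm m).2 (Or.inl rfl)
      have hβm := hβ m ⟨_, hmB⟩
      obtain ⟨l, hl1, hl2⟩ : ∃ l, l ≠ β m ∧ l ≠ β f := by
        have : ∀ i j : Fin 3, ∃ l, l ≠ i ∧ l ≠ j := by decide
        exact this _ _
      obtain ⟨p, q, -, hpq⟩ := h.exists_two v (w l) (hadj l)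
      have h1 := (hpq m).1 ((hβm l).2 hl1)
      have h2 := (hpq f).1 ((hβf l).2 hl2)
      have h3 := (hpq g).1 ((hβg l).2 (e ▸ hl2))
      have hmf : m ≠ f := by
        rintro rfl
        exact (hβf _).1 hmB rfl
      have hmg : m ≠ g := by
        rintro rfl
        exact (hβg _).1 hmB e
      rcases h1 with rfl | rfl <;> rcases h2 with rfl | rfl <;> rcases h3 with rfl | rfl <;>
        first | exact hfg rfl | exact hmf rfl | exact hmg rfl
    refine ⟨hne, ?_⟩
    obtain ⟨l, hl1, hl2⟩ : ∃ l, l ≠ β f ∧ l ≠ β g := by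
      have : ∀ i j : Fin 3, ∃ l, l ≠ i ∧ l ≠ j := by decide
      exact this _ _
    exact ⟨w l, hadj l, (hβf l).2 hl1, (hβg l).2 hl2⟩

/-- The local names at the two ends of an edge differ by a permutation, unique because two of its
values are prescribed. On a tree these transition permutations come from a potential `ℓ`; corrected
by `ℓ`, the names agree at both ends of each edge of a face and therefore along the whole face. -/
theorem exists_coloring (h : G.IsFaceSystem B) (hG : G.IsTree) :
    ∃ c : F → Fin 3, ∀ f g u v, f ≠ g → G.Adj u v → B f u v → B g u v → c f ≠ c g := by
  classical
  choose β hβ using h.exists_local hG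
  have hπ : ∀ u v, G.Adj u v → ∃ π : Equiv.Perm (Fin 3), (∀ f, B f u v → π (β u f) = β v f) ∧
      ∀ π' : Equiv.Perm (Fin 3), (∀ f, B f u v → π' (β u f) = β v f) → π' = π := by
    intro u v huv
    obtain ⟨f, g, hfg, hB⟩ := h.exists_two u v huv
    have hf := (hB f).2 (Or.inl rfl)
    have hg := (hB g).2 (Or.inr rfl)
    obtain ⟨π, ⟨h1, h2⟩, h3⟩ := fin_three_existsUnique_perm _ _ _ _
      (hβ u f g ⟨v, huv, hf⟩ ⟨v, huv, hg⟩ hfg).1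
      (hβ v f g ⟨u, huv.symm, h.symm huv hf⟩ ⟨u, huv.symm, h.symm huv hg⟩ hfg).1
    refine ⟨π, fun k hk => ?_, fun π' hπ' => h3 π' (hπ' f hf) (hπ' g hg)⟩
    rcases (hB k).1 hk with rfl | rfl
    · exact h1
    · exact h2
  let d : V → V → Equiv.Perm (Fin 3) := fun u v =>
    if huv : G.Adj u v then (hπ u v huv).choose else 1
  have hd : ∀ u v, G.Adj u v → (∀ f, B f u v → d u v (β u f) = β v f) ∧
      ∀ π' : Equiv.Perm (Fin 3), (∀ f, B f u v → π' (β u f) = β v f) → π' = d u v := by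
    intro u v huv
    simp only [d, huv, dite_true]
    exact (hπ u v huv).choose_spec
  -- The inverse of the transition along `uv` carries the names back, so by uniqueness it is the
  -- transition along `vu`.
  obtain ⟨ℓ, hℓ⟩ := hG.exists_potential d (by
    intro u v huv
    refine ((hd v u huv.symm).2 _ fun f hf => ?_).symm
    rw [Equiv.Perm.inv_eq_iff_eq]
    exact ((hd u v huv).1 f (h.symm huv.symm hf)).symm)
  have hstep : ∀ f u v, G.Adj u v → B f u v → (ℓ u)⁻¹ (β u f) = (ℓ v)⁻¹ (β v f) := by
    intro f u v huv hf
    rw [hℓ u v huv, ← (hd u v huv).1 f hf]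
    simp
  -- The edges of a face form a path, so any two vertices touched by the face are joined by steps
  -- that preserve the corrected name.
  have hcon : ∀ f u v u' v', G.Adj u v → G.Adj u' v' → B f u v → B f u' v' →
      (ℓ u)⁻¹ (β u f) = (ℓ u')⁻¹ (β u' f) := by
    intro f u v u' v' huv hu'v' hf hf'
    obtain ⟨a, b, -, -, -, hB⟩ := h.exists_path f
    obtain ⟨p⟩ := pathBetween_reachable hG ((hB u v huv).1 hf) ((hB u' v' hu'v').1 hf')
    clear hf hf' huv hu'v'
    induction p with
    | nil => rfl
    | cons e p ih => exact (hstep f _ _ e.1 ((hB _ _ e.1).2 e)).trans ih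
  have htouch : ∀ f, ∃ u v, G.Adj u v ∧ B f u v := by
    intro f
    obtain ⟨a, b, hab, ha, -, hB⟩ := h.exists_path f
    obtain ⟨w, ⟨hw, -⟩, -⟩ := existsUnique_branch hG hab
    exact ⟨a, w, hw, (hB a w hw).2 (pathBetween_adj_start hG hab ha hw)⟩
  choose p q hpq hBpq using htouch
  refine ⟨fun f => (ℓ (p f))⁻¹ (β (p f) f), fun f g u v hfg huv hf hg => ?_⟩
  simp only
  rw [hcon f _ _ u v (hpq f) huv (hBpq f) hf, hcon g _ _ u v (hpq g) huv (hBpq g) hg]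
  exact fun e => (hβ u f g ⟨v, huv, hf⟩ ⟨v, huv, hg⟩ hfg).1 ((ℓ u)⁻¹.injective e)

/-- The two faces of an edge determine the permutation. At each end of that edge any further face
has a common edge with both of them, so its color is forced in `c` and in `c'` alike; connectedness
carries the permutation to every vertex. -/
theorem coloring_unique (h : G.IsFaceSystem B) (hG : G.IsTree) {c c' : F → Fin 3}
    (hc : ∀ f g u v, f ≠ g → G.Adj u v → B f u v → B g u v → c f ≠ c g)
    (hc' : ∀ f g u v, f ≠ g → G.Adj u v → B f u v → B g u v → c' f ≠ c' g) :
    ∃ π : Equiv.Perm (Fin 3), c' = π ∘ c := by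
  have hloc : ∀ v f g, (∃ w, G.Adj v w ∧ B f v w) → (∃ w, G.Adj v w ∧ B g v w) → f ≠ g →
      ∃ w, G.Adj v w ∧ B f v w ∧ B g v w := by
    intro v f g hf hg hfg
    obtain ⟨β, hβ⟩ := h.exists_local hG v
    exact (hβ f g hf hg hfg).2
  let P : Equiv.Perm (Fin 3) → V → Prop := fun π v =>
    ∀ f, (∃ w, G.Adj v w ∧ B f v w) → π (c f) = c' f
  have hedge : ∀ v w (π : Equiv.Perm (Fin 3)), G.Adj v w → (∀ f, B f v w → π (c f) = c' f) →
      P π v := by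
    rintro v w π hvw hπ k hk
    obtain ⟨f, g, hfg, hB⟩ := h.exists_two v w hvw
    have hf := (hB f).2 (Or.inl rfl)
    have hg := (hB g).2 (Or.inr rfl)
    by_cases hkf : k = f
    · exact hkf ▸ hπ f hf
    by_cases hkg : k = g
    · exact hkg ▸ hπ g hg
    obtain ⟨x, hx, hx1, hx2⟩ := hloc v k f hk ⟨w, hvw, hf⟩ hkf
    obtain ⟨y, hy, hy1, hy2⟩ := hloc v k g hk ⟨w, hvw, hg⟩ hkg
    refine fin_three_perm_third π (c f) (c g) (c k) (c' k) (hc f g v w hfg hvw hf hg)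
      (hc k f v x hkf hx hx1 hx2) (hc k g v y hkg hy hy1 hy2) ?_ ?_
    · rw [hπ f hf]; exact hc' k f v x hkf hx hx1 hx2
    · rw [hπ g hg]; exact hc' k g v y hkg hy hy1 hy2
  have hstep : ∀ v w (π : Equiv.Perm (Fin 3)), G.Adj v w → P π v → P π w := by
    intro v w π hvw hπ
    refine hedge w v π hvw.symm fun f hf => hπ f ⟨w, hvw, h.symm hvw.symm hf⟩
  have hall : ∀ v w (π : Equiv.Perm (Fin 3)), P π v → P π w := by
    intro v w π hπ
    obtain ⟨p⟩ := hG.1 v w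
    induction p with
    | nil => exact hπ
    | cons e p ih => exact ih (hstep _ _ π e hπ)
  have htouch : ∀ f, ∃ u v, G.Adj u v ∧ B f u v := by
    intro f
    obtain ⟨a, b, hab, ha, -, hB⟩ := h.exists_path f
    obtain ⟨w, ⟨hw, -⟩, -⟩ := existsUnique_branch hG hab
    exact ⟨a, w, hw, (hB a w hw).2 (pathBetween_adj_start hG hab ha hw)⟩
  by_cases hE : ∃ u v, G.Adj u v
  · obtain ⟨u, v, huv⟩ := hE
    obtain ⟨f, g, hfg, hB⟩ := h.exists_two u v huv
    have hf := (hB f).2 (Or.inl rfl)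
    have hg := (hB g).2 (Or.inr rfl)
    obtain ⟨π, ⟨h1, h2⟩, -⟩ := fin_three_existsUnique_perm _ _ _ _
      (hc f g u v hfg huv hf hg) (hc' f g u v hfg huv hf hg)
    refine ⟨π, funext fun k => ?_⟩
    obtain ⟨x, y, hxy, hk⟩ := htouch k
    refine (hall u x π (hedge u v π huv fun m hm => ?_) k ⟨y, hxy, hk⟩).symm
    rcases (hB m).1 hm with rfl | rfl
    · exact h1
    · exact h2
  -- Without edges there are no faces, since every face touches an edge.
  · refine ⟨1, funext fun k => ?_⟩
    obtain ⟨x, y, hxy, -⟩ := htouch k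
    exact absurd ⟨x, y, hxy⟩ hE

end IsFaceSystem

end SimpleGraph

/-! ### Topology of a finite network as a subset of the domain. -/

namespace PlanarNetwork

variable {Ω : Set Plane} {V : Type*} (N : PlanarNetwork Ω V)

/-- The part of the network in `Ω` formed by the arcs of a subgraph. -/
def carrierOf (H : SimpleGraph V) : Set Plane :=
  {z | ∃ u v, H.Adj u v ∧ (z ∈ N.arc u v '' Ioo 0 1 ∨ N.site u = .inner z)}

theorem carrier_eq : N.carrier = N.carrierOf N.graph := by
  ext z
  constructor
  · rintro (⟨v, hv⟩ | ⟨u, v, huv, hz⟩)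
    · obtain ⟨u, hu, -⟩ := N.exists_adj v
      exact ⟨v, u, hu, Or.inr hv⟩
    · exact ⟨u, v, huv, Or.inl hz⟩
  · rintro ⟨u, v, huv, hz | hz⟩
    · exact Or.inr ⟨u, v, huv, hz⟩
    · exact Or.inl ⟨u, hz⟩

theorem carrierOf_mono {H H' : SimpleGraph V} (h : H ≤ H') : N.carrierOf H ⊆ N.carrierOf H' := by
  rintro z ⟨u, v, huv, hz⟩
  exact ⟨u, v, h huv, hz⟩

theorem carrierOf_sup (H H' : SimpleGraph V) :
    N.carrierOf (H ⊔ H') = N.carrierOf H ∪ N.carrierOf H' := by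
  ext z
  constructor
  · rintro ⟨u, v, huv | huv, hz⟩
    · exact Or.inl ⟨u, v, huv, hz⟩
    · exact Or.inr ⟨u, v, huv, hz⟩
  · rintro (⟨u, v, huv, hz⟩ | ⟨u, v, huv, hz⟩)
    · exact ⟨u, v, Or.inl huv, hz⟩
    · exact ⟨u, v, Or.inr huv, hz⟩

variable {N}

theorem inner_iff {v : V} : (N.site v).IsInner ↔ ∃ p, N.site v = .inner p := by
  cases h : N.site v <;> simp [VertexSite.IsInner]

theorem inner_mem {v : V} {p : Plane} (h : N.site v = .inner p) : p ∈ Ω := by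
  have := N.site_valid v
  rwa [h] at this

theorem arc_subset {u v : V} (h : N.graph.Adj u v) : N.arc u v '' Ioo 0 1 ⊆ Ω :=
  image_subset_iff.2 (N.arc_mem u v h)

theorem carrierOf_subset {H : SimpleGraph V} (hH : H ≤ N.graph) : N.carrierOf H ⊆ Ω := by
  rintro z ⟨u, v, huv, hz | hz⟩
  · exact arc_subset (hH huv) hz
  · exact inner_mem hz

theorem image_arc_symm {u v : V} (h : N.graph.Adj u v) :
    N.arc v u '' Ioo 0 1 = N.arc u v '' Ioo 0 1 := by
  ext z
  constructor
  · rintro ⟨s, hs, rfl⟩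
    exact ⟨1 - s, ⟨by linarith [hs.2], by linarith [hs.1]⟩, (N.arc_symm u v h s hs).symm⟩
  · rintro ⟨s, hs, rfl⟩
    have hs' : 1 - s ∈ Ioo (0 : ℝ) 1 := ⟨by linarith [hs.2], by linarith [hs.1]⟩
    refine ⟨1 - s, hs', ?_⟩
    rw [N.arc_symm u v h _ hs', sub_sub_cancel]

theorem arc_tendsto_inner {u v : V} (h : N.graph.Adj u v) {p : Plane} (hp : N.site u = .inner p) :
    Tendsto (N.arc u v) (𝓝[>] 0) (𝓝 p) := by
  have := N.arc_end u v h
  rw [hp] at this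
  exact tendsto_iff_dist_tendsto_zero.2 this

theorem arc_exterior_end (hΩ : IsOpen Ω) {u v : V} (h : N.graph.Adj u v)
    (hu : ¬ (N.site u).IsInner) :
    (∃ b ∉ Ω, Tendsto (N.arc u v) (𝓝[>] 0) (𝓝 b)) ∨
      Tendsto (fun s => ‖N.arc u v s‖) (𝓝[>] 0) atTop := by
  have he := N.arc_end u v h
  have hv := N.site_valid u
  cases hs : N.site u with
  | inner p => rw [hs] at hu; exact absurd trivial hu
  | boundary p =>
    rw [hs] at he hv
    left
    refine ⟨p, fun hp => ?_, tendsto_iff_dist_tendsto_zero.2 he⟩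
    have hv' : p ∈ frontier Ω := hv
    rw [hΩ.frontier_eq] at hv'
    exact hv'.2 hp
  | infinity σ =>
    rw [hs] at he hv
    right
    have h1 : ∀ᶠ s in 𝓝[>] (0 : ℝ), dist (N.arc u v s) (σ s) < 1 :=
      he.eventually (gt_mem_nhds one_pos)
    have h2 := tendsto_atTop_add_const_right (𝓝[>] (0 : ℝ)) (-1 : ℝ) hv.2
    refine tendsto_atTop_mono' _ ?_ h2
    filter_upwards [h1] with s hs
    rw [dist_eq_norm] at hs
    have := norm_sub_norm_le (σ s) (N.arc u v s)
    rw [norm_sub_rev] at this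
    linarith

/-- Lets boundary points and vertices at infinity be treated alike: a function equal to `1` off a
compact subset of `Ω` is eventually `1` along the arc. -/
theorem arc_eventually_notMem (hΩ : IsOpen Ω) {u v : V} (h : N.graph.Adj u v)
    (hu : ¬ (N.site u).IsInner) {C : Set Plane} (hC : IsCompact C) (hCΩ : C ⊆ Ω) :
    ∀ᶠ s in 𝓝[>] 0, N.arc u v s ∉ C := by
  rcases arc_exterior_end hΩ h hu with ⟨b, hb, ht⟩ | ht
  · exact ht.eventually (hC.isClosed.isOpen_compl.mem_nhds fun h => hb (hCΩ h))
  · obtain ⟨R, hR⟩ := hC.isBounded.exists_norm_le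
    filter_upwards [ht.eventually_gt_atTop R] with s hs hsC
    exact absurd (hR _ hsC) (not_le.2 hs)

/-- An ultrafilter on (a part of) a finite network comes from an ultrafilter on the parameter
interval of an arc, or is concentrated in a vertex. -/
theorem ultrafilter_cases [Finite V] {H : SimpleGraph V} (hH : H ≤ N.graph) {𝒰 : Ultrafilter ℂ}
    (h : N.carrierOf H ∈ 𝒰) :
    (∃ u v, H.Adj u v ∧ ∃ s ∈ Ioo (0 : ℝ) 1, ∃ 𝒱 : Ultrafilter ℝ, (𝒱 : Filter ℝ) ≤ 𝓝 s ∧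
      𝒱.map (N.arc u v) = 𝒰) ∨
    (∃ u v, H.Adj u v ∧ ∃ 𝒱 : Ultrafilter ℝ, (𝒱 : Filter ℝ) ≤ 𝓝[>] 0 ∧
      𝒱.map (N.arc u v) = 𝒰) ∨
    ∃ u v p, H.Adj u v ∧ N.site u = .inner p ∧ (𝒰 : Filter ℂ) = pure p := by
  have hU : N.carrierOf H = ⋃ q ∈ {q : V × V | H.Adj q.1 q.2},
      (N.arc q.1 q.2 '' Ioo 0 1 ∪ {z | N.site q.1 = .inner z}) := by
    ext z
    simp [carrierOf]
  rw [hU, Ultrafilter.finite_biUnion_mem_iff (Set.toFinite _)] at h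
  obtain ⟨⟨u, v⟩, huv, h⟩ := h
  change H.Adj u v at huv
  rcases Ultrafilter.union_mem_iff.1 h with h | h
  · have hm := Ultrafilter.ofComapInfPrincipal_mem h
    have he := Ultrafilter.ofComapInfPrincipal_eq_of_map h
    set 𝒱 := Ultrafilter.ofComapInfPrincipal h
    -- The parameters converge in `[0, 1]`; the limit `1` is reduced to `0` by running the arc
    -- backwards.
    obtain ⟨s, hs, hle⟩ := isCompact_Icc.ultrafilter_le_nhds 𝒱
      (le_principal_iff.2 (mem_of_superset hm Ioo_subset_Icc_self))
    rcases eq_or_lt_of_le hs.1 with h0 | h0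
    · subst h0
      refine Or.inr (Or.inl ⟨u, v, huv, 𝒱, ?_, he⟩)
      exact le_inf hle (le_principal_iff.2 (mem_of_superset hm fun s hs => hs.1))
    rcases eq_or_lt_of_le hs.2 with h1 | h1
    · subst h1
      refine Or.inr (Or.inl ⟨v, u, huv.symm, 𝒱.map (fun s => 1 - s), ?_, ?_⟩)
      · refine tendsto_nhdsWithin_iff.2 ⟨?_, ?_⟩
        · have : Tendsto (fun s : ℝ => 1 - s) (𝓝 1) (𝓝 (1 - 1)) :=
            (continuous_const.sub continuous_id).tendsto 1
          rw [sub_self] at this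
          exact this.mono_left hle
        · filter_upwards [hm] with s hs
          exact sub_pos.2 hs.2
      · rw [← he, Ultrafilter.map_map]
        refine Ultrafilter.coe_injective ?_
        simp only [Ultrafilter.coe_map]
        refine Filter.map_congr ?_
        filter_upwards [hm] with s hs
        have hs' : 1 - s ∈ Ioo (0 : ℝ) 1 := ⟨by linarith [hs.2], by linarith [hs.1]⟩
        simp only [Function.comp]
        rw [N.arc_symm u v (hH huv) _ hs', sub_sub_cancel]
    · exact Or.inl ⟨u, v, huv, s, ⟨h0, h1⟩, 𝒱, hle, he⟩
  · have hne : (𝒰 : Filter ℂ).NeBot := inferInstance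
    obtain ⟨p, hp⟩ := hne.nonempty_of_mem h
    refine Or.inr (Or.inr ⟨u, v, p, huv, hp, ?_⟩)
    have hs : {z | N.site u = .inner z} = {p} := by
      ext z
      have hp' : N.site u = .inner p := hp
      simp only [mem_ofPred_eq, mem_singleton_iff, hp', VertexSite.inner.injEq, eq_comm]
    have hsp : ({p} : Set ℂ) ∈ (𝒰 : Filter ℂ) := hs ▸ h
    exact (pure p : Ultrafilter ℂ).unique (le_pure_iff.2 hsp)

theorem tendsto_arc {u v : V} (h : N.graph.Adj u v) {s : ℝ} (hs : s ∈ Ioo (0 : ℝ) 1) :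
    Tendsto (N.arc u v) (𝓝 s) (𝓝 (N.arc u v s)) :=
  (N.arc_continuous u v h).continuousAt (isOpen_Ioo.mem_nhds hs)

theorem notMem_of_ultrafilter_exterior (hΩ : IsOpen Ω) {u v : V} (h : N.graph.Adj u v)
    (hu : ¬ (N.site u).IsInner) {𝒱 : Ultrafilter ℝ} (h𝒱 : (𝒱 : Filter ℝ) ≤ 𝓝[>] 0) {z : ℂ}
    (hz : (𝒱.map (N.arc u v) : Filter ℂ) ≤ 𝓝 z) : z ∉ Ω := by
  intro hzΩ
  obtain ⟨C, hC, hzC, hCΩ⟩ := exists_compact_subset hΩ hzΩ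
  have h1 := (arc_eventually_notMem hΩ h hu hC hCΩ).filter_mono h𝒱
  have h2 : ∀ᶠ s in (𝒱 : Filter ℝ), N.arc u v s ∈ C :=
    hz (mem_of_superset (isOpen_interior.mem_nhds hzC) interior_subset)
  obtain ⟨s, hs1, hs2⟩ := (h1.and h2).exists
  exact hs1 hs2

/-- By finiteness an ultrafilter on the network follows a single arc or sits at a vertex. Its limit
is then on the arc, at an interior vertex, or, when it runs into an exterior vertex, outside `Ω`. -/
theorem isClosed_carrierOf_union [Finite V] (hΩ : IsOpen Ω) {H : SimpleGraph V} (hH : H ≤ N.graph) :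
    IsClosed (N.carrierOf H ∪ Ωᶜ) := by
  rw [isClosed_iff_ultrafilter]
  intro z 𝒰 hz h𝒰
  rcases Ultrafilter.union_mem_iff.1 h𝒰 with h | h
  · rcases ultrafilter_cases hH h with ⟨u, v, huv, s, hs, 𝒱, h𝒱, rfl⟩ | ⟨u, v, huv, 𝒱, h𝒱, rfl⟩ |
      ⟨u, v, p, huv, hp, h𝒱⟩
    · have := tendsto_nhds_unique ((tendsto_arc (hH huv) hs).mono_left h𝒱) hz
      exact Or.inl ⟨u, v, huv, Or.inl ⟨s, hs, this⟩⟩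
    · by_cases hu : (N.site u).IsInner
      · obtain ⟨p, hp⟩ := inner_iff.1 hu
        have := tendsto_nhds_unique ((arc_tendsto_inner (hH huv) hp).mono_left h𝒱) hz
        exact Or.inl ⟨u, v, huv, Or.inr (this ▸ hp)⟩
      · exact Or.inr (notMem_of_ultrafilter_exterior hΩ (hH huv) hu h𝒱 hz)
    · rw [h𝒱] at hz
      have : p = z := by simpa using pure_le_nhds_iff.1 hz
      exact Or.inl ⟨u, v, huv, Or.inr (this ▸ hp)⟩
  · exact Or.inr (isClosed_iff_ultrafilter.1 hΩ.isClosed_compl z 𝒰 hz h)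

/-- `f` has a logarithm on `F` that vanishes near the boundary of `Ω` and near infinity. -/
def HasCompactLog (Ω F : Set ℂ) (f : ℂ → ℂ) : Prop :=
  ∃ g : ℂ → ℂ, ContinuousOn g (F ∪ Ωᶜ) ∧ (∀ z ∈ F, Complex.exp (g z) = f z) ∧ (∀ z ∉ Ω, g z = 0) ∧
    ∃ R : ℝ, ∀ z ∈ F, R ≤ ‖z‖ → g z = 0

/-- Continuity for the topology of the plane is tested on ultrafilters, and each of these follows
one arc or sits at an interior vertex. So continuity along the arcs, the right limits at interior
vertices and vanishing near exterior ones suffice. Continuity is asked only relative to `F`, which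
allows jumps at points of the arcs off `F`. -/
theorem hasCompactLog_of_arcs [Finite V] (hΩ : IsOpen Ω) {H : SimpleGraph V} (hH : H ≤ N.graph)
    {F : Set ℂ} (hF : F ⊆ N.carrierOf H) {f g : ℂ → ℂ} (hfg : ∀ z ∈ F, Complex.exp (g z) = f z)
    (harc : ∀ u v, H.Adj u v → ∀ s ∈ Ioo (0 : ℝ) 1, N.arc u v s ∈ F →
      ContinuousWithinAt (fun s => g (N.arc u v s)) (N.arc u v ⁻¹' F) s)
    (hinner : ∀ u v p, H.Adj u v → N.site u = .inner p →
      Tendsto (fun s => g (N.arc u v s)) (𝓝[>] 0) (𝓝 (g p)))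
    (hext : ∀ u v, H.Adj u v → ¬ (N.site u).IsInner → ∀ᶠ s in 𝓝[>] 0, g (N.arc u v s) = 0) :
    HasCompactLog Ω F f := by
  classical
  have hFΩ : F ⊆ Ω := hF.trans (carrierOf_subset hH)
  let g' : ℂ → ℂ := fun z => if z ∈ Ω then g z else 0
  have hg' : ∀ z ∈ Ω, g' z = g z := fun z hz => by simp [g', hz]
  have hg'0 : ∀ z ∉ Ω, g' z = 0 := fun z hz => by simp [g', hz]
  refine ⟨g', ?_, fun z hz => by rw [hg' z (hFΩ hz), hfg z hz], hg'0, ?_⟩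
  · intro z hz
    refine tendsto_iff_ultrafilter _ _ _ |>.2 fun 𝒰 h𝒰 => ?_
    have hz𝒰 : (𝒰 : Filter ℂ) ≤ 𝓝 z := h𝒰.trans nhdsWithin_le_nhds
    have hF𝒰 : F ∪ Ωᶜ ∈ 𝒰 := le_principal_iff.1 (h𝒰.trans inf_le_right)
    rcases Ultrafilter.union_mem_iff.1 hF𝒰 with h | h
    · have hev : g' =ᶠ[(𝒰 : Filter ℂ)] g := by
        filter_upwards [h] with v hv
        exact hg' v (hFΩ hv)
      refine Tendsto.congr' hev.symm ?_
      rcases ultrafilter_cases hH (mem_of_superset h hF) with ⟨u, v, huv, s, hs, 𝒱, h𝒱, rfl⟩ |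
        ⟨u, v, huv, 𝒱, h𝒱, rfl⟩ | ⟨u, v, p, huv, hp, h𝒱⟩
      · have hzs := tendsto_nhds_unique ((tendsto_arc (hH huv) hs).mono_left h𝒱) hz𝒰
        have hzΩ : z ∈ Ω := hzs ▸ N.arc_mem u v (hH huv) hs
        have hzF : z ∈ F := hz.resolve_right fun h => h hzΩ
        have := harc u v huv s hs (hzs.symm ▸ hzF)
        rw [hg' z hzΩ, ← hzs]
        exact (this.mono_left (le_inf h𝒱 (le_principal_iff.2 h)) :)
      · by_cases hu : (N.site u).IsInner
        · obtain ⟨p, hp⟩ := inner_iff.1 hu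
          have hzs := tendsto_nhds_unique ((arc_tendsto_inner (hH huv) hp).mono_left h𝒱) hz𝒰
          rw [hg' z (hzs ▸ inner_mem hp), ← hzs]
          exact ((hinner u v p huv hp).mono_left h𝒱 :)
        · rw [hg'0 z (notMem_of_ultrafilter_exterior hΩ (hH huv) hu h𝒱 hz𝒰)]
          have : Tendsto (fun s => g (N.arc u v s)) 𝒱 (𝓝 0) :=
            tendsto_const_nhds.congr' (((hext u v huv hu).filter_mono h𝒱).mono fun s hs => hs.symm)
          exact (this :)
      · rw [h𝒱] at hz𝒰 ⊢
        have : p = z := by simpa using pure_le_nhds_iff.1 hz𝒰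
        rw [← this, hg' p (inner_mem hp)]
        exact tendsto_pure_nhds g p
    · have hzΩ : z ∉ Ω := isClosed_iff_ultrafilter.1 hΩ.isClosed_compl z 𝒰 hz𝒰 h
      rw [hg'0 z hzΩ]
      refine tendsto_const_nhds.congr' ?_
      filter_upwards [h] with v hv
      exact (hg'0 v hv).symm
  -- Otherwise an ultrafilter on `F` tends to infinity with `g'` nonzero; it can only run into an
  -- exterior vertex, where `g` vanishes eventually.
  · by_contra hcon
    push Not at hcon
    have hne : (Bornology.cobounded ℂ ⊓ 𝓟 {z | z ∈ F ∧ g' z ≠ 0}).NeBot := by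
      rw [inf_principal_neBot_iff]
      intro U hU
      obtain ⟨R, -, hR⟩ := (hasBasis_cobounded_norm (E := ℂ)).mem_iff.1 hU
      obtain ⟨z, hzF, hzR, hz0⟩ := hcon R
      exact ⟨z, hR hzR, hzF, hz0⟩
    obtain ⟨𝒰, h𝒰⟩ := Ultrafilter.exists_le (Bornology.cobounded ℂ ⊓ 𝓟 {z | z ∈ F ∧ g' z ≠ 0})
    have hcob : (𝒰 : Filter ℂ) ≤ Bornology.cobounded ℂ := h𝒰.trans inf_le_left
    have hset : {z | z ∈ F ∧ g' z ≠ 0} ∈ 𝒰 := le_principal_iff.1 (h𝒰.trans inf_le_right)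
    have hnot : ∀ z, ¬ (𝒰 : Filter ℂ) ≤ 𝓝 z := by
      intro z hz
      have := Metric.disjoint_nhds_cobounded z
      exact 𝒰.neBot.ne (le_bot_iff.1 (this hz hcob))
    rcases ultrafilter_cases hH (mem_of_superset hset fun z hz => hF hz.1) with
      ⟨u, v, huv, s, hs, 𝒱, h𝒱, rfl⟩ | ⟨u, v, huv, 𝒱, h𝒱, rfl⟩ | ⟨u, v, p, huv, hp, h𝒱⟩
    · exact hnot _ ((tendsto_arc (hH huv) hs).mono_left h𝒱)
    · by_cases hu : (N.site u).IsInner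
      · obtain ⟨p, hp⟩ := inner_iff.1 hu
        exact hnot _ ((arc_tendsto_inner (hH huv) hp).mono_left h𝒱)
      · have h2 : ∀ᶠ s in (𝒱 : Filter ℝ), N.arc u v s ∈ F ∧ g' (N.arc u v s) ≠ 0 := hset
        obtain ⟨s, hs1, hs2, hs3⟩ := (((hext u v huv hu).filter_mono h𝒱).and h2).exists
        exact hs3 (by rw [hg' _ (hFΩ hs2), hs1])
    · exact hnot p (h𝒱 ▸ pure_le_nhds p)

end PlanarNetwork

/-! ### Logarithms along arcs and along whole trees. -/

/-- `l` is a continuous logarithm of `φ` on `(0, 1)` with limits `α` and `β` at the ends. -/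
structure IsLogLift (φ l : ℝ → ℂ) (α β : ℂ) : Prop where
  continuousOn : ContinuousOn l (Ioo 0 1)
  exp_eq : ∀ s ∈ Ioo (0 : ℝ) 1, Complex.exp (l s) = φ s
  tendsto_zero : Tendsto l (𝓝[>] 0) (𝓝 α)
  tendsto_one : Tendsto l (𝓝[<] 1) (𝓝 β)

theorem Ioo_mem_nhdsGT_zero : Ioo (0 : ℝ) 1 ∈ 𝓝[>] (0 : ℝ) := Ioo_mem_nhdsGT one_pos

theorem Ioo_mem_nhdsLT_one : Ioo (0 : ℝ) 1 ∈ 𝓝[<] (1 : ℝ) := Ioo_mem_nhdsLT one_pos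

theorem one_sub_mem_Ioo {s : ℝ} (hs : s ∈ Ioo (0 : ℝ) 1) : 1 - s ∈ Ioo (0 : ℝ) 1 :=
  ⟨by linarith [hs.2], by linarith [hs.1]⟩

theorem tendsto_one_sub_nhdsGT : Tendsto (fun s : ℝ => 1 - s) (𝓝[>] 0) (𝓝[<] 1) := by
  refine tendsto_nhdsWithin_iff.2 ⟨?_, ?_⟩
  · have : Tendsto (fun s : ℝ => 1 - s) (𝓝 0) (𝓝 (1 - 0)) :=
      (continuous_const.sub continuous_id).tendsto 0
    rw [sub_zero] at this
    exact this.mono_left nhdsWithin_le_nhds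
  · filter_upwards [self_mem_nhdsWithin] with s hs
    exact sub_lt_self _ (mem_Ioi.1 hs)

theorem tendsto_one_sub_nhdsLT : Tendsto (fun s : ℝ => 1 - s) (𝓝[<] 1) (𝓝[>] 0) := by
  refine tendsto_nhdsWithin_iff.2 ⟨?_, ?_⟩
  · have : Tendsto (fun s : ℝ => 1 - s) (𝓝 1) (𝓝 (1 - 1)) :=
      (continuous_const.sub continuous_id).tendsto 1
    rw [sub_self] at this
    exact this.mono_left nhdsWithin_le_nhds
  · filter_upwards [self_mem_nhdsWithin] with s hs
    exact sub_pos.2 (mem_Iio.1 hs)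

namespace IsLogLift

variable {φ φ' l l' : ℝ → ℂ} {α β α' β' : ℂ}

theorem congr (h : IsLogLift φ l α β) (e : ∀ s ∈ Ioo (0 : ℝ) 1, φ s = φ' s) :
    IsLogLift φ' l α β :=
  ⟨h.continuousOn, fun s hs => (h.exp_eq s hs).trans (e s hs), h.tendsto_zero, h.tendsto_one⟩

theorem reverse (h : IsLogLift φ l α β) :
    IsLogLift (fun s => φ (1 - s)) (fun s => l (1 - s)) β α where
  continuousOn := h.continuousOn.comp (by fun_prop) fun _ hs => one_sub_mem_Ioo hs
  exp_eq s hs := h.exp_eq _ (one_sub_mem_Ioo hs)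
  tendsto_zero := h.tendsto_one.comp tendsto_one_sub_nhdsGT
  tendsto_one := h.tendsto_zero.comp tendsto_one_sub_nhdsLT

theorem unique (h : IsLogLift φ l α β) (h' : IsLogLift φ l' α' β') :
    (∀ s ∈ Ioo (0 : ℝ) 1, l s = l' s + (α - α')) ∧ β - α = β' - α' := by
  obtain ⟨n, hn⟩ := isPreconnected_Ioo.exists_int_of_exp_eq h.continuousOn h'.continuousOn
    fun s hs => (h.exp_eq s hs).trans (h'.exp_eq s hs).symm
  have h0 : α = α' + n * (2 * Real.pi * Complex.I) := by
    refine tendsto_nhds_unique h.tendsto_zero ((h'.tendsto_zero.add_const _).congr' ?_)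
    filter_upwards [Ioo_mem_nhdsGT_zero] with s hs using (hn s hs).symm
  have h1 : β = β' + n * (2 * Real.pi * Complex.I) := by
    refine tendsto_nhds_unique h.tendsto_one ((h'.tendsto_one.add_const _).congr' ?_)
    filter_upwards [Ioo_mem_nhdsLT_one] with s hs using (hn s hs).symm
  refine ⟨fun s hs => ?_, ?_⟩
  · rw [hn s hs, h0]; ring
  · rw [h0, h1]; ring

end IsLogLift

open Classical in
/-- The total change of a continuous logarithm of `φ` along `(0, 1)`. -/
noncomputable def logChange (φ : ℝ → ℂ) : ℂ :=
  if h : ∃ q : (ℝ → ℂ) × ℂ × ℂ, IsLogLift φ q.1 q.2.1 q.2.2 then h.choose.2.2 - h.choose.2.1 else 0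

theorem IsLogLift.logChange_eq {φ l : ℝ → ℂ} {α β : ℂ} (h : IsLogLift φ l α β) :
    logChange φ = β - α := by
  have hex : ∃ q : (ℝ → ℂ) × ℂ × ℂ, IsLogLift φ q.1 q.2.1 q.2.2 := ⟨(l, α, β), h⟩
  rw [logChange, dif_pos hex]
  exact (hex.choose_spec.unique h).2

theorem logChange_congr {φ φ' : ℝ → ℂ} (e : ∀ s ∈ Ioo (0 : ℝ) 1, φ s = φ' s) :
    logChange φ = logChange φ' := by
  by_cases h : ∃ q : (ℝ → ℂ) × ℂ × ℂ, IsLogLift φ q.1 q.2.1 q.2.2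
  · obtain ⟨q, hq⟩ := h
    rw [hq.logChange_eq, (hq.congr e).logChange_eq]
  · have h' : ¬ ∃ q : (ℝ → ℂ) × ℂ × ℂ, IsLogLift φ' q.1 q.2.1 q.2.2 := fun ⟨q, hq⟩ =>
      h ⟨q, hq.congr fun s hs => (e s hs).symm⟩
    rw [logChange, dif_neg h, logChange, dif_neg h']

namespace PlanarNetwork

variable {Ω : Set Plane} {V : Type*} {N : PlanarNetwork Ω V}

theorem eq_of_site_eq {u v : V} {p : Plane} (hu : N.site u = .inner p) (hv : N.site v = .inner p) :
    u = v := by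
  by_contra h
  obtain ⟨δ, hδ, hd⟩ := N.site_separated u v h
  have := hd (δ / 2) ⟨by linarith, by linarith⟩ (δ / 2) ⟨by linarith, by linarith⟩
  rw [hu, hv] at this
  simp only [VertexSite.track, dist_self] at this
  linarith

theorem sym2_eq_of_arc_eq {u v u' v' : V} (h : N.graph.Adj u v) (h' : N.graph.Adj u' v') {s s' : ℝ}
    (hs : s ∈ Ioo (0 : ℝ) 1) (hs' : s' ∈ Ioo (0 : ℝ) 1) (e : N.arc u v s = N.arc u' v' s') :
    s(u, v) = s(u', v') := by
  by_contra hne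
  exact disjoint_left.1 (N.arc_disjoint u v u' v' h h' hne) ⟨s, hs, rfl⟩ ⟨s', hs', e.symm⟩

theorem inner_ne_arc {u v w : V} (h : N.graph.Adj u v) {p : Plane} (hp : N.site w = .inner p)
    {s : ℝ} (hs : s ∈ Ioo (0 : ℝ) 1) : N.arc u v s ≠ p := fun e =>
  N.arc_avoids u v h w p hp ⟨s, hs, e⟩

/-- Functions on the network can be prescribed on its vertices and arcs. -/
theorem exists_extension {E : Type*} [Inhabited E] (k : V → E) (l : V → V → ℝ → E)
    (hl : ∀ u v, N.graph.Adj u v → ∀ s ∈ Ioo (0 : ℝ) 1, l v u s = l u v (1 - s)) :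
    ∃ g : Plane → E, (∀ u p, N.site u = .inner p → g p = k u) ∧
      ∀ u v, N.graph.Adj u v → ∀ s ∈ Ioo (0 : ℝ) 1, g (N.arc u v s) = l u v s := by
  classical
  let A : Plane → Prop := fun z => ∃ q : V × V × ℝ, N.graph.Adj q.1 q.2.1 ∧
    q.2.2 ∈ Ioo (0 : ℝ) 1 ∧ N.arc q.1 q.2.1 q.2.2 = z
  refine ⟨fun z => if h : ∃ u, N.site u = .inner z then k h.choose else
    if h : A z then l h.choose.1 h.choose.2.1 h.choose.2.2 else default, ?_, ?_⟩
  · intro u p hp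
    have h : ∃ u, N.site u = .inner p := ⟨u, hp⟩
    simp only [h, dite_true]
    rw [eq_of_site_eq h.choose_spec hp]
  · intro u v huv s hs
    have h1 : ¬ ∃ w, N.site w = .inner (N.arc u v s) := fun ⟨w, hw⟩ => inner_ne_arc huv hw hs rfl
    have h2 : A (N.arc u v s) := ⟨(u, v, s), huv, hs, rfl⟩
    simp only [h1, h2, dite_true, dite_false]
    obtain ⟨ha, hb, hc⟩ := h2.choose_spec
    revert ha hb hc
    generalize h2.choose = q
    obtain ⟨u', v', s'⟩ := q
    intro ha hb hc
    simp only at ha hb hc ⊢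
    -- The chosen representation of the point may use the reversed arc; `hl` says that both give the
    -- same value.
    rcases Sym2.eq_iff.1 (sym2_eq_of_arc_eq ha huv hb hs hc) with ⟨rfl, rfl⟩ | ⟨rfl, rfl⟩
    · rw [N.arc_injective _ _ ha hb hs hc]
    · rw [N.arc_symm _ _ huv _ hb] at hc
      have := N.arc_injective _ _ huv (one_sub_mem_Ioo hb) hs hc
      rw [hl _ _ huv s' hb, this]

/-- Data of a continuous logarithm `g` of `f` along the arcs of `H`, with value or limit `k v` at
the vertex `v`. -/
structure IsArcLog (N : PlanarNetwork Ω V) (H : SimpleGraph V) (f g : ℂ → ℂ) (k : V → ℂ) : Prop where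
  exp_eq : ∀ z ∈ N.carrierOf H, Complex.exp (g z) = f z
  inner_eq : ∀ u p, N.site u = .inner p → g p = k u
  isLogLift : ∀ u v, H.Adj u v →
    IsLogLift (fun s => f (N.arc u v s)) (fun s => g (N.arc u v s)) (k u) (k v)

theorem tendsto_nhdsLT_one_of_symm {u v : V} (h : N.graph.Adj u v) {E : Type*} {g : ℂ → E}
    {F : Filter E} (hg : Tendsto (fun s => g (N.arc v u s)) (𝓝[>] 0) F) :
    Tendsto (fun s => g (N.arc u v s)) (𝓝[<] 1) F := by
  refine (hg.comp tendsto_one_sub_nhdsLT).congr' ?_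
  filter_upwards [Ioo_mem_nhdsLT_one] with s hs
  simp only [Function.comp]
  rw [N.arc_symm u v h _ (one_sub_mem_Ioo hs), sub_sub_cancel]

/-- Logarithms are lifted arc by arc, and their increments form an additive cocycle. On a tree it is
the difference of vertex values `k`, and adding a constant on each arc makes the lifts agree with
`k` at all ends. At an exterior vertex `f` tends to `1`, so `k` is there a multiple of `2πi`. -/
theorem exists_isArcLog (hΩ : IsOpen Ω) (hG : N.graph.IsTree) {H : SimpleGraph V}
    (hH : H ≤ N.graph) {f : ℂ → ℂ} (hfc : ∀ z ∈ N.carrierOf H, ContinuousAt f z)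
    (hf0 : ∀ z ∈ N.carrierOf H, f z ≠ 0) {C : Set ℂ} (hC : IsCompact C) (hCΩ : C ⊆ Ω)
    (hfC : ∀ z ∉ C, f z = 1) :
    ∃ g k, N.IsArcLog H f g k ∧ ∀ u v, H.Adj u v → ¬ (N.site u).IsInner → Complex.exp (k u) = 1 := by
  classical
  -- The limit of `f` at each vertex. The default `1` is the true limit at exterior vertices and a
  -- harmless nonzero value at interior vertices off the subgraph.
  let A : V → ℂ := fun u =>
    if h : ∃ p, N.site u = .inner p ∧ p ∈ N.carrierOf H then f h.choose else 1
  have hAi : ∀ u p, N.site u = .inner p → p ∈ N.carrierOf H → A u = f p := by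
    intro u p hp hpH
    have h : ∃ p, N.site u = .inner p ∧ p ∈ N.carrierOf H := ⟨p, hp, hpH⟩
    have : h.choose = p := VertexSite.inner.inj (h.choose_spec.1.symm.trans hp)
    simp only [A, h, dite_true, this]
  have hAe : ∀ u, ¬ (N.site u).IsInner → A u = 1 := by
    intro u hu
    refine dif_neg ?_
    rintro ⟨p, hp, -⟩
    exact hu (inner_iff.2 ⟨p, hp⟩)
  have hA0 : ∀ u, A u ≠ 0 := by
    intro u
    by_cases h : ∃ p, N.site u = .inner p ∧ p ∈ N.carrierOf H
    · simp only [A, h, dite_true]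
      exact hf0 _ h.choose_spec.2
    · simp [A, h]
  have hmem : ∀ u v, H.Adj u v → ∀ s ∈ Ioo (0 : ℝ) 1, N.arc u v s ∈ N.carrierOf H :=
    fun u v huv s hs => ⟨u, v, huv, Or.inl ⟨s, hs, rfl⟩⟩
  have hAlim : ∀ u v, H.Adj u v → Tendsto (fun s => f (N.arc u v s)) (𝓝[>] 0) (𝓝 (A u)) := by
    intro u v huv
    by_cases hu : (N.site u).IsInner
    · obtain ⟨p, hp⟩ := inner_iff.1 hu
      have hpH : p ∈ N.carrierOf H := ⟨u, v, huv, Or.inr hp⟩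
      rw [hAi u p hp hpH]
      exact (hfc p hpH).tendsto.comp (arc_tendsto_inner (hH huv) hp)
    · rw [hAe u hu]
      refine tendsto_const_nhds.congr' ?_
      filter_upwards [arc_eventually_notMem hΩ (hH huv) hu hC hCΩ] with s hs
      exact (hfC _ hs).symm
  have hlift : ∀ u v, H.Adj u v → ∃ q : (ℝ → ℂ) × ℂ × ℂ,
      IsLogLift (fun s => f (N.arc u v s)) q.1 q.2.1 q.2.2 ∧ Complex.exp q.2.1 = A u ∧
      Complex.exp q.2.2 = A v := by
    intro u v huv
    have hc : ContinuousOn (fun s => f (N.arc u v s)) (Ioo 0 1) := fun s hs =>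
      (ContinuousAt.comp (f := N.arc u v) (hfc _ (hmem u v huv s hs))
        (tendsto_arc (hH huv) hs)).continuousWithinAt
    obtain ⟨l, α, β, h1, h2, h3, h4, h5, h6⟩ := exists_log_Ioo hc
      (fun s hs => hf0 _ (hmem u v huv s hs)) (hA0 u) (hA0 v) (hAlim u v huv)
      (tendsto_nhdsLT_one_of_symm (hH huv) (hAlim v u huv.symm))
    exact ⟨(l, α, β), ⟨h1, h2, h5, h6⟩, h3, h4⟩
  choose! q hq hqα hqβ using hlift
  have hrev : ∀ u v, H.Adj u v → (q v u).2.2 - (q v u).2.1 = (q u v).2.1 - (q u v).2.2 := by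
    intro u v huv
    have h1 := (hq u v huv).reverse.congr (φ' := fun s => f (N.arc v u s))
      fun s hs => by rw [N.arc_symm u v (hH huv) s hs]
    exact ((hq v u huv.symm).unique h1).2
  -- The increments, in multiplicative notation to match `exists_potential`. Edges outside `H` get
  -- differences of principal logarithms, so that `exp d = A v / A u` holds on every edge of the
  -- tree and `exp k = A` propagates from the root.
  let d : V → V → Multiplicative ℂ := fun u v => Multiplicative.ofAdd
    (if H.Adj u v then (q u v).2.2 - (q u v).2.1 else Complex.log (A v) - Complex.log (A u))
  have hdexp : ∀ u v, Complex.exp (d u v).toAdd = A v / A u := by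
    intro u v
    by_cases huv : H.Adj u v
    · simp only [d, huv, if_true, toAdd_ofAdd, Complex.exp_sub, hqα u v huv, hqβ u v huv]
    · simp only [d, huv, if_false, toAdd_ofAdd, Complex.exp_sub, Complex.exp_log (hA0 _)]
  obtain ⟨ℓ, hℓ⟩ := hG.exists_potential d (by
    intro u v _
    simp only [d, ← ofAdd_neg]
    congr 1
    by_cases huv : H.Adj u v
    · simp only [huv, huv.symm, if_true, hrev u v huv, neg_sub]
    · have hvu : ¬ H.Adj v u := fun h => huv h.symm
      simp only [huv, hvu, if_false, neg_sub])
  obtain ⟨r⟩ := hG.1.nonempty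
  let k : V → ℂ := fun v => (ℓ v).toAdd - (ℓ r).toAdd + Complex.log (A r)
  have hkstep : ∀ u v, N.graph.Adj u v → k v = (d u v).toAdd + k u := by
    intro u v huv
    simp only [k]
    rw [hℓ u v huv, toAdd_mul]
    ring
  have hkexp : ∀ v, Complex.exp (k v) = A v := by
    intro v
    have hr : Complex.exp (k r) = A r := by simp [k, Complex.exp_log (hA0 r)]
    obtain ⟨p⟩ := hG.1 r v
    have key : ∀ x y (p : N.graph.Walk x y), Complex.exp (k x) = A x → Complex.exp (k y) = A y := by
      intro x y p
      induction p with
      | nil => exact id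
      | cons e p ih =>
        intro h
        refine ih ?_
        rw [hkstep _ _ e, Complex.exp_add, hdexp, h, div_mul_cancel₀ _ (hA0 _)]
    exact key r v p hr
  let l : V → V → ℝ → ℂ := fun u v s =>
    if H.Adj u v then (q u v).1 s - (q u v).2.1 + k u else 0
  have hl : ∀ u v, H.Adj u v → IsLogLift (fun s => f (N.arc u v s)) (l u v) (k u) (k v) := by
    intro u v huv
    have h := hq u v huv
    have he : l u v = fun s => (q u v).1 s + (k u - (q u v).2.1) := by
      funext s
      simp only [l, huv, if_true]
      ring
    rw [he]
    refine ⟨h.continuousOn.add continuousOn_const, fun s hs => ?_, ?_, ?_⟩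
    · rw [Complex.exp_add, Complex.exp_sub, hkexp, hqα u v huv, h.exp_eq s hs, div_self (hA0 u),
        mul_one]
    · simpa using h.tendsto_zero.add_const (k u - (q u v).2.1)
    · have h1 := h.tendsto_one.add_const (k u - (q u v).2.1)
      have h2 : (q u v).2.2 + (k u - (q u v).2.1) = k v := by
        rw [hkstep u v (hH huv)]
        simp only [d, huv, if_true, toAdd_ofAdd]
        ring
      rwa [h2] at h1
  obtain ⟨g, hg1, hg2⟩ := N.exists_extension k l (by
    intro u v _ s hs
    by_cases huv : H.Adj u v
    · have h1 := (hl u v huv).reverse.congr (φ' := fun s => f (N.arc v u s))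
        fun s hs => by rw [N.arc_symm u v (hH huv) s hs]
      have := ((hl v u huv.symm).unique h1).1 s hs
      simpa using this
    · have hvu : ¬ H.Adj v u := fun h => huv h.symm
      simp [l, huv, hvu])
  refine ⟨g, k, ⟨?_, hg1, ?_⟩, fun u v _ hu => by rw [hkexp, hAe u hu]⟩
  · rintro z ⟨u, v, huv, ⟨s, hs, rfl⟩ | hz⟩
    · rw [hg2 u v (hH huv) s hs, (hl u v huv).exp_eq s hs]
    · rw [hg1 u z hz, hkexp, hAi u z hz ⟨u, v, huv, Or.inr hz⟩]
  · intro u v huv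
    have h := hl u v huv
    have he : ∀ s ∈ Ioo (0 : ℝ) 1, l u v s = g (N.arc u v s) := fun s hs =>
      (hg2 u v (hH huv) s hs).symm
    refine ⟨h.continuousOn.congr fun s hs => (he s hs).symm, fun s hs => ?_,
      h.tendsto_zero.congr' ?_, h.tendsto_one.congr' ?_⟩
    · rw [← he s hs, h.exp_eq s hs]
    · filter_upwards [Ioo_mem_nhdsGT_zero] with s hs using he s hs
    · filter_upwards [Ioo_mem_nhdsLT_one] with s hs using he s hs

end PlanarNetwork

/-! ### Logarithms of separators decide which points lie in the same component. -/

/-- A function with a zero at `x` and a pole at `y` which is used with `IsSeparator`. -/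
noncomputable def sepFun (x y : ℂ) (ℓ : ℂ → ℂ) (z : ℂ) : ℂ :=
  (z - x) / (z - y) * Complex.exp (-ℓ z)

namespace IsSeparator

variable {Ω : Set ℂ} {x y w : ℂ} {ℓ ℓ' : ℂ → ℂ} {C C' : Set ℂ}

theorem continuousAt (h : IsSeparator Ω x y ℓ C) {z : ℂ} (hy : z ≠ y) :
    ContinuousAt (sepFun x y ℓ) z := by
  have h1 : ContinuousAt (fun z => (z - x) / (z - y)) z :=
    ContinuousAt.div₀ (f := fun z => z - x) (by fun_prop) (by fun_prop) (sub_ne_zero.2 hy)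
  have h2 := h.continuous
  exact h1.mul (f := fun z => (z - x) / (z - y)) (by fun_prop)

theorem ne_zero {z : ℂ} (hx : z ≠ x) (hy : z ≠ y) : sepFun x y ℓ z ≠ 0 :=
  mul_ne_zero (div_ne_zero (sub_ne_zero.2 hx) (sub_ne_zero.2 hy)) (Complex.exp_ne_zero _)

theorem eq_one (h : IsSeparator Ω x y ℓ C) {z : ℂ} (hz : z ∉ C) : sepFun x y ℓ z = 1 := by
  rw [sepFun, ← h.exp_eq z hz, ← Complex.exp_add, add_neg_cancel, Complex.exp_zero]

/-- If a product of powers of separators has a compactly supported logarithm along `F`, then its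
multiplicity in each region of `Ω \ F` vanishes. -/
theorem multiplicity_eq_zero (h : IsSeparator Ω x y ℓ C) (h' : IsSeparator Ω y w ℓ' C')
    {F : Set ℂ} (hF : IsClosed (F ∪ Ωᶜ)) (hx : x ∈ Ω \ F) (hy : y ∈ Ω \ F) (hw : w ∈ Ω \ F)
    {l m : ℤ} (hlog : PlanarNetwork.HasCompactLog Ω F fun z => sepFun x y ℓ z ^ l * sepFun y w ℓ' z ^ m)
    (hyU : y ∉ connectedComponentIn (Ω \ F) x) (hwU : w ∉ connectedComponentIn (Ω \ F) x) :
    l = 0 := by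
  obtain ⟨g, hg, hge, hg0, R, hR⟩ := hlog
  obtain ⟨R₁, hR₁⟩ := h.isCompact.isBounded.exists_norm_le
  obtain ⟨R₂, hR₂⟩ := h'.isCompact.isBounded.exists_norm_le
  have hK : (F ∪ Ωᶜ)ᶜ = Ω \ F := by
    ext z; simp [and_comm]
  have hform : ∀ z, ((z - x) / (z - y)) ^ l * ((z - y) / (z - w)) ^ m *
      Complex.exp (-(l * ℓ z + m * ℓ' z)) = sepFun x y ℓ z ^ l * sepFun y w ℓ' z ^ m := by
    intro z
    have e : Complex.exp (-(l * ℓ z + m * ℓ' z)) =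
        Complex.exp (-ℓ z) ^ l * Complex.exp (-ℓ' z) ^ m := by
      rw [← Complex.exp_int_mul, ← Complex.exp_int_mul, ← Complex.exp_add]
      ring_nf
    rw [e, sepFun, sepFun, mul_zpow, mul_zpow]
    ring
  have hone : ∀ z, z ∉ C → z ∉ C' → sepFun x y ℓ z ^ l * sepFun y w ℓ' z ^ m = 1 := by
    intro z h1 h2
    rw [h.eq_one h1, h'.eq_one h2, one_zpow, one_zpow, one_mul]
  have hc1 := h.continuous
  have hc2 := h'.continuous
  refine winding_multiplicity_eq_zero hF (x := x) (y := y) (w := w) (l := l) (m := m) (g := g)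
    (ψ := fun z => -(l * ℓ z + m * ℓ' z)) (R := max (R) (max R₁ R₂ + 1))
    ?_ ?_ ?_ (by fun_prop) hg ?_ ?_ ?_ (by rwa [hK]) (by rwa [hK])
  · rintro (h1 | h1)
    exacts [hx.2 h1, h1 hx.1]
  · rintro (h1 | h1)
    exacts [hy.2 h1, h1 hy.1]
  · rintro (h1 | h1)
    exacts [hw.2 h1, h1 hw.1]
  · intro z hz
    rw [hform]
    by_cases hzΩ : z ∈ Ω
    · exact hge z (hz.resolve_right fun h => h hzΩ)
    · rw [hg0 z hzΩ, hone z (fun h1 => hzΩ (h.subset h1)) (fun h1 => hzΩ (h'.subset h1)),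
        Complex.exp_zero]
  · intro z hz
    rw [hform]
    have h3 := (le_max_right _ _).trans hz
    have h4 := le_max_left R₁ R₂
    have h5 := le_max_right R₁ R₂
    exact hone z (fun h1 => by linarith [hR₁ z h1]) (fun h1 => by linarith [hR₂ z h1])
  · intro z hz hzR
    by_cases hzΩ : z ∈ Ω
    · exact hR z (hz.resolve_right fun h => h hzΩ) ((le_max_left _ _).trans hzR)
    · exact hg0 z hzΩ

/-- The case `l = 1`, `m = 0` of `multiplicity_eq_zero`, with the trivial separator of `y` from
itself in the second place. -/
theorem mem_component (h : IsSeparator Ω x y ℓ C) {F : Set ℂ} (hF : IsClosed (F ∪ Ωᶜ))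
    (hx : x ∈ Ω \ F) (hy : y ∈ Ω \ F) (hlog : PlanarNetwork.HasCompactLog Ω F (sepFun x y ℓ)) :
    y ∈ connectedComponentIn (Ω \ F) x := by
  by_contra hyU
  have hyy : IsSeparator Ω y y 0 {y} := by
    refine ⟨continuous_const, isCompact_singleton, by simpa using hy.1, ?_, ?_⟩
    · intro z hz
      rw [div_self (sub_ne_zero.2 hz)]
      simp
    · intro γ hγ
      refine ⟨0, {y}, continuousOn_const, ?_, isCompact_singleton, by simpa using hy.1, fun _ _ => rfl⟩
      intro z hz
      rw [div_self (sub_ne_zero.2 fun e => hz ⟨0, by simp [e]⟩)]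
      simp
  have := h.multiplicity_eq_zero hyy hF hx hy hy (l := 1) (m := 0) (by simpa using hlog) hyU hyU
  exact one_ne_zero this

end IsSeparator

/-- A frontier point in `Ω \ F` would have an open component that meets the given one and thus
equals it. -/
theorem frontier_connectedComponentIn_inter_subset {Ω F : Set ℂ} (hF : IsClosed (F ∪ Ωᶜ)) (x : ℂ) :
    frontier (connectedComponentIn (Ω \ F) x) ∩ Ω ⊆ F := by
  have hK : (F ∪ Ωᶜ)ᶜ = Ω \ F := by
    ext z; simp [and_comm]
  have ho : IsOpen (Ω \ F) := hK ▸ hF.isOpen_compl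
  rintro z ⟨hz, hzΩ⟩
  by_contra hzF
  have hzV := mem_connectedComponentIn (show z ∈ Ω \ F from ⟨hzΩ, hzF⟩)
  obtain ⟨v, hv, hvU⟩ := mem_closure_iff.1 hz.1 _ ho.connectedComponentIn hzV
  rw [connectedComponentIn_eq hv, ← connectedComponentIn_eq hvU] at hzV
  rw [ho.connectedComponentIn.frontier_eq] at hz
  exact hz.2 hzV

/-- The values lie in `2πiℤ`, whose points are more than `1` apart, so a convergent family is
eventually constant. -/
theorem eventually_eq_of_exp_eq_one {α : Type*} {l : Filter α} {h : α → ℂ} {κ : ℂ}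
    (ht : Tendsto h l (𝓝 κ)) (he : ∀ᶠ s in l, Complex.exp (h s) = 1) (hκ : Complex.exp κ = 1) :
    ∀ᶠ s in l, h s = κ := by
  filter_upwards [he, Metric.tendsto_nhds.1 ht 1 one_pos] with s h1 h2
  rw [← hκ, Complex.exp_eq_exp_iff_exists_int] at h1
  obtain ⟨n, hn⟩ := h1
  have h3 : ‖(n : ℂ) * (2 * Real.pi * Complex.I)‖ < 1 := by
    rw [dist_eq_norm, hn, add_sub_cancel_left] at h2
    exact h2
  have h4 : n = 0 := by
    by_contra hn0
    have h5 : (1 : ℝ) ≤ |(n : ℝ)| := by exact_mod_cast Int.one_le_abs hn0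
    simp only [norm_mul, Complex.norm_intCast, Complex.norm_I, mul_one, Complex.norm_real,
      Complex.norm_ofNat, Real.norm_eq_abs, abs_of_pos Real.pi_pos] at h3
    nlinarith [Real.pi_gt_three]
  rw [hn, h4]
  simp

namespace PlanarNetwork

variable {Ω : Set Plane} {V : Type*} {N : PlanarNetwork Ω V} {H : SimpleGraph V}
  {x y w : ℂ} {ℓ ℓ' : ℂ → ℂ} {C C' : Set ℂ}

/-- The increment over an arc is the same for every lift. This compares a logarithm built on the
tree with one obtained from a path in the complement of the network. -/
theorem IsArcLog.sub_eq {f g g' : ℂ → ℂ} {k k' : V → ℂ} (h : N.IsArcLog H f g k)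
    (h' : N.IsArcLog H f g' k') {u v : V} (p : H.Walk u v) : k v - k u = k' v - k' u := by
  induction p with
  | nil => simp
  | cons e p ih =>
    have := ((h.isLogLift _ _ e).unique (h'.isLogLift _ _ e)).2
    linear_combination ih + this

theorem exists_isArcLog_sepFun (hΩ : IsOpen Ω) (hG : N.graph.IsTree) (hH : H ≤ N.graph)
    (h : IsSeparator Ω x y ℓ C) (hx : x ∉ N.carrierOf H) (hy : y ∉ N.carrierOf H) :
    ∃ g k, N.IsArcLog H (sepFun x y ℓ) g k ∧
      ∀ u v, H.Adj u v → ¬ (N.site u).IsInner → Complex.exp (k u) = 1 :=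
  exists_isArcLog hΩ hG hH (fun _ hz => h.continuousAt fun e => hy (e ▸ hz))
    (fun _ hz => IsSeparator.ne_zero (fun e => hx (e ▸ hz)) fun e => hy (e ▸ hz))
    h.isCompact h.subset fun _ hz => h.eq_one hz

/-- A logarithm along the arcs is eventually constant at exterior vertices. -/
theorem IsArcLog.eventually_eq (hΩ : IsOpen Ω) (hH : H ≤ N.graph) (h : IsSeparator Ω x y ℓ C)
    {g : ℂ → ℂ} {k : V → ℂ} (hg : N.IsArcLog H (sepFun x y ℓ) g k) {u v : V} (huv : H.Adj u v)
    (hu : ¬ (N.site u).IsInner) (hk : Complex.exp (k u) = 1) :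
    ∀ᶠ s in 𝓝[>] 0, g (N.arc u v s) = k u := by
  refine eventually_eq_of_exp_eq_one (hg.isLogLift u v huv).tendsto_zero ?_ hk
  filter_upwards [arc_eventually_notMem hΩ (hH huv) hu h.isCompact h.subset, Ioo_mem_nhdsGT_zero]
    with s h1 h2
  rw [(hg.isLogLift u v huv).exp_eq s h2, h.eq_one h1]

theorem hasCompactLog_of_isArcLog [Finite V] (hΩ : IsOpen Ω) (hH : H ≤ N.graph) {f g : ℂ → ℂ}
    (hfg : ∀ z ∈ N.carrierOf H, Complex.exp (g z) = f z)
    (hcont : ∀ u v, H.Adj u v → ContinuousOn (fun s => g (N.arc u v s)) (Ioo 0 1))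
    (hinner : ∀ u v p, H.Adj u v → N.site u = .inner p →
      Tendsto (fun s => g (N.arc u v s)) (𝓝[>] 0) (𝓝 (g p)))
    (hext : ∀ u v, H.Adj u v → ¬ (N.site u).IsInner → ∀ᶠ s in 𝓝[>] 0, g (N.arc u v s) = 0) :
    HasCompactLog Ω (N.carrierOf H) f :=
  hasCompactLog_of_arcs hΩ hH Subset.rfl hfg
    (fun u v huv _ hs _ => ((hcont u v huv).continuousAt (isOpen_Ioo.mem_nhds hs)).continuousWithinAt)
    hinner hext

/-- If the logarithm of a separator takes the same value at all exterior vertices, then the two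
points lie in the same region. -/
theorem IsArcLog.mem_component [Finite V] (hΩ : IsOpen Ω) (hH : H ≤ N.graph)
    (h : IsSeparator Ω x y ℓ C) (hx : x ∈ Ω \ N.carrierOf H) (hy : y ∈ Ω \ N.carrierOf H)
    {g : ℂ → ℂ} {k : V → ℂ} (hg : N.IsArcLog H (sepFun x y ℓ) g k) {κ : ℂ}
    (hκ : Complex.exp κ = 1) (hk : ∀ u v, H.Adj u v → ¬ (N.site u).IsInner → k u = κ) :
    y ∈ connectedComponentIn (Ω \ N.carrierOf H) x := by
  refine h.mem_component (isClosed_carrierOf_union hΩ hH) hx hy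
    (hasCompactLog_of_isArcLog hΩ hH (g := fun z => g z - κ) ?_ ?_ ?_ ?_)
  · intro z hz
    rw [Complex.exp_sub, hκ, div_one, hg.exp_eq z hz]
  · intro u v huv
    exact (hg.isLogLift u v huv).continuousOn.sub continuousOn_const
  · intro u v p huv hp
    rw [hg.inner_eq u p hp]
    exact (hg.isLogLift u v huv).tendsto_zero.sub_const κ
  · intro u v huv hu
    have hku := hk u v huv hu
    filter_upwards [hg.eventually_eq hΩ hH h huv hu (hku ▸ hκ)] with s hs
    rw [hs, hku, sub_self]

/-- The logarithm of a separator of two points in the same region takes the same value at all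
exterior vertices. -/
theorem IsArcLog.eq_of_mem_component [Finite V] (hΩ : IsOpen Ω) (hH : H ≤ N.graph)
    (h : IsSeparator Ω x y ℓ C) (hx : x ∈ Ω \ N.carrierOf H)
    (hxy : y ∈ connectedComponentIn (Ω \ N.carrierOf H) x)
    {g : ℂ → ℂ} {k : V → ℂ} (hg : N.IsArcLog H (sepFun x y ℓ) g k) {a b : V}
    (ha : ¬ (N.site a).IsInner) (hb : ¬ (N.site b).IsInner) (p : H.Walk a b) : k a = k b := by
  classical
  have hcl := isClosed_carrierOf_union hΩ hH
  have hK : (N.carrierOf H ∪ Ωᶜ)ᶜ = Ω \ N.carrierOf H := by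
    ext z; simp [and_comm]
  have ho : IsOpen (Ω \ N.carrierOf H) := hK ▸ hcl.isOpen_compl
  have hpc : IsPathConnected (connectedComponentIn (Ω \ N.carrierOf H) x) :=
    ho.connectedComponentIn.isConnected_iff_isPathConnected.1
      (isConnected_connectedComponentIn_iff.2 hx)
  -- A path in the component avoids the network, so its logarithm from `exists_log` restricts to the
  -- arcs. Being compactly supported in `Ω` it has value `0` at all exterior vertices, and
  -- increments do not depend on the logarithm.
  obtain ⟨γ, hγ⟩ := hpc.joinedIn y hxy x (mem_connectedComponentIn hx)
  have hγ' : ∀ t, γ t ∈ Ω \ N.carrierOf H := fun t => connectedComponentIn_subset _ _ (hγ t)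
  obtain ⟨L, C', hL, hLe, hC', hC'Ω, hL0⟩ := h.exists_log γ fun t => (hγ' t).1
  have hmem : ∀ z ∈ N.carrierOf H, z ∈ (range γ)ᶜ := by
    rintro z hz ⟨t, rfl⟩
    exact (hγ' t).2 hz
  have hLat : ∀ z ∈ N.carrierOf H, ContinuousAt L z := fun z hz =>
    hL.continuousAt ((isCompact_range γ.continuous).isClosed.isOpen_compl.mem_nhds (hmem z hz))
  let k' : V → ℂ := fun u => if h : ∃ p, N.site u = .inner p then L h.choose else 0
  have hk'i : ∀ u p, N.site u = .inner p → L p = k' u := by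
    intro u p hp
    have h : ∃ p, N.site u = .inner p := ⟨p, hp⟩
    have : h.choose = p := VertexSite.inner.inj (h.choose_spec.symm.trans hp)
    simp only [k', h, dite_true, this]
  have hk'e : ∀ u, ¬ (N.site u).IsInner → k' u = 0 := fun u hu =>
    dif_neg fun h => hu (inner_iff.2 h)
  have hlim : ∀ u v, H.Adj u v → Tendsto (fun s => L (N.arc u v s)) (𝓝[>] 0) (𝓝 (k' u)) := by
    intro u v huv
    by_cases hu : (N.site u).IsInner
    · obtain ⟨p, hp⟩ := inner_iff.1 hu
      rw [← hk'i u p hp]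
      exact (hLat p ⟨u, v, huv, Or.inr hp⟩).tendsto.comp (arc_tendsto_inner (hH huv) hp)
    · rw [hk'e u hu]
      refine tendsto_const_nhds.congr' ?_
      filter_upwards [arc_eventually_notMem hΩ (hH huv) hu hC' hC'Ω] with s hs
      exact (hL0 _ hs).symm
  have hL' : N.IsArcLog H (sepFun x y ℓ) L k' := by
    refine ⟨fun z hz => hLe z (hmem z hz), hk'i, fun u v huv => ⟨?_, ?_, hlim u v huv, ?_⟩⟩
    · intro s hs
      exact (ContinuousAt.comp (f := N.arc u v) (hLat _ ⟨u, v, huv, Or.inl ⟨s, hs, rfl⟩⟩)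
        (tendsto_arc (hH huv) hs)).continuousWithinAt
    · intro s hs
      exact hLe _ (hmem _ ⟨u, v, huv, Or.inl ⟨s, hs, rfl⟩⟩)
    · exact tendsto_nhdsLT_one_of_symm (hH huv) (hlim v u huv.symm)
  have := hg.sub_eq hL' p
  rw [hk'e a ha, hk'e b hb, sub_zero, sub_eq_zero] at this
  exact this.symm

end PlanarNetwork

/-! ### Paths between exterior vertices: at most two sides, and logarithms off half paths. -/

namespace PlanarNetwork

open SimpleGraph

variable {Ω : Set Plane} {V : Type*} {N : PlanarNetwork Ω V}

/-- The standing hypotheses: a trivalent tree with simple exterior vertices in a simply connected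
domain. -/
structure IsTrivalentTree (N : PlanarNetwork Ω V) : Prop where
  isOpen : IsOpen Ω
  isSimplyConnected : IsSimplyConnected Ω
  isTree : N.graph.IsTree
  trivalent : N.HasTrivalentInterior
  simple : N.HasSimpleBoundary

/-- The part in `Ω` of the path between two vertices. -/
def pathSet (N : PlanarNetwork Ω V) (a b : V) : Set Plane := N.carrierOf (N.graph.pathBetween a b)

theorem pathSet_comm (a b : V) : N.pathSet a b = N.pathSet b a := by
  rw [pathSet, pathBetween_comm, pathSet]

namespace IsTrivalentTree

theorem eq_of_adj (h : N.IsTrivalentTree) {c : V} (hc : ¬ (N.site c).IsInner) (x y : V)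
    (hx : N.graph.Adj c x) (hy : N.graph.Adj c y) : x = y := by
  obtain ⟨w, hw⟩ := Set.ncard_eq_one.1 (h.simple c hc)
  have h1 : x ∈ N.graph.neighborSet c := hx
  have h2 : y ∈ N.graph.neighborSet c := hy
  rw [hw, mem_singleton_iff] at h1 h2
  rw [h1, h2]

theorem exists_ne_adj {v : V} (hv : (N.site v).IsInner) (u : V) : ∃ w, w ≠ u ∧ N.graph.Adj v w := by
  obtain ⟨x, hx, hxy⟩ := N.exists_adj v
  obtain ⟨y, hyx, hy⟩ := hxy hv
  by_cases hxu : x = u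
  · exact ⟨y, fun e => hyx (e.trans hxu.symm), hy⟩
  · exact ⟨x, hxu, hx⟩

theorem exists_mem_branch [Finite V] {u v : V} (huv : N.graph.Adj u v) (h : N.IsTrivalentTree) :
    ∃ c ∈ N.graph.branch u v, ¬ (N.site c).IsInner :=
  SimpleGraph.exists_mem_branch h.isTree (P := fun c => ¬ (N.site c).IsInner)
    (fun _ hv u => exists_ne_adj (not_not.1 hv) u) huv

theorem exterior_on_path (h : N.IsTrivalentTree) {a b u v : V} (huv : (N.graph.pathBetween a b).Adj u v)
    (hu : ¬ (N.site u).IsInner) : u = a ∨ u = b :=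
  eq_or_eq_of_pathBetween_adj h.isTree (h.eq_of_adj hu) huv

/-- The only exterior vertices on the path are `a` and `b`, so both directions of the logarithm
criterion reduce to comparing `k a` with `k b`. -/
theorem side_iff [Finite V] (h : N.IsTrivalentTree) {a b : V} (ha : ¬ (N.site a).IsInner)
    (hb : ¬ (N.site b).IsInner) {x y : ℂ} {ℓ : ℂ → ℂ} {C : Set ℂ} (hs : IsSeparator Ω x y ℓ C)
    (hx : x ∈ Ω \ N.pathSet a b) (hy : y ∈ Ω \ N.pathSet a b) {g : ℂ → ℂ} {k : V → ℂ}
    (hg : N.IsArcLog (N.graph.pathBetween a b) (sepFun x y ℓ) g k)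
    (hk : ∀ u v, (N.graph.pathBetween a b).Adj u v → ¬ (N.site u).IsInner → Complex.exp (k u) = 1) :
    y ∈ connectedComponentIn (Ω \ N.pathSet a b) x ↔ k a = k b := by
  obtain ⟨p, hp⟩ := h.isTree.exists_walk_pathBetween a b
  constructor
  · intro hxy
    exact hg.eq_of_mem_component h.isOpen (pathBetween_le a b) hs hx hxy ha hb p
  · intro hab
    by_cases hE : ∃ v, (N.graph.pathBetween a b).Adj a v
    · obtain ⟨v, hv⟩ := hE
      refine hg.mem_component h.isOpen (pathBetween_le a b) hs hx hy (hk a v hv ha) ?_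
      intro u w huw hu
      rcases h.exterior_on_path huw hu with rfl | rfl
      · rfl
      · exact hab.symm
    -- Without a first edge the path is a single vertex and its carrier is empty.
    · have h1 : ∀ u v, ¬ (N.graph.pathBetween a b).Adj u v := by
        intro u v huv
        cases p with
        | nil =>
          have := hp u v huv
          simp only [Walk.support_nil, List.mem_singleton] at this
          exact hE ⟨v, this ▸ huv⟩
        | cons e p => exact hE ⟨_, e⟩
      exact hg.mem_component h.isOpen (pathBetween_le a b) hs hx hy Complex.exp_zero
        fun u v huv => absurd huv (h1 u v)

/-- A path between exterior vertices has at most two sides. -/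
theorem side_or [Finite V] (h : N.IsTrivalentTree) {a b : V} (ha : ¬ (N.site a).IsInner)
    (hb : ¬ (N.site b).IsInner) {x y w : ℂ} (hab : a ≠ b) (hx : x ∈ Ω \ N.pathSet a b)
    (hy : y ∈ Ω \ N.pathSet a b) (hw : w ∈ Ω \ N.pathSet a b) :
    y ∈ connectedComponentIn (Ω \ N.pathSet a b) x ∨
      w ∈ connectedComponentIn (Ω \ N.pathSet a b) x ∨
      w ∈ connectedComponentIn (Ω \ N.pathSet a b) y := by
  by_contra hcon
  rw [not_or, not_or] at hcon
  obtain ⟨hxy, hxw, hyw⟩ := hcon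
  have hle := pathBetween_le (G := N.graph) a b
  obtain ⟨ℓ, C, hs⟩ := exists_isSeparator h.isOpen h.isSimplyConnected hx.1 hy.1
  obtain ⟨ℓ', C', hs'⟩ := exists_isSeparator h.isOpen h.isSimplyConnected hy.1 hw.1
  obtain ⟨g, k, hg, hk⟩ := exists_isArcLog_sepFun h.isOpen h.isTree hle hs hx.2 hy.2
  obtain ⟨g', k', hg', hk'⟩ := exists_isArcLog_sepFun h.isOpen h.isTree hle hs' hy.2 hw.2
  obtain ⟨va, hva⟩ : ∃ v, (N.graph.pathBetween a b).Adj a v := by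
    obtain ⟨v, hv, -⟩ := N.exists_adj a
    exact ⟨v, pathBetween_adj_start h.isTree hab (h.eq_of_adj ha) hv⟩
  obtain ⟨vb, hvb⟩ : ∃ v, (N.graph.pathBetween a b).Adj b v := by
    obtain ⟨v, hv, -⟩ := N.exists_adj b
    rw [pathBetween_comm]
    exact ⟨v, pathBetween_adj_start h.isTree hab.symm (h.eq_of_adj hb) hv⟩
  have hint : ∀ {k : V → ℂ}, (∀ u v, (N.graph.pathBetween a b).Adj u v → ¬ (N.site u).IsInner →
      Complex.exp (k u) = 1) → ∃ n : ℤ, k b = k a + n * (2 * Real.pi * Complex.I) := fun hk =>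
    Complex.exp_eq_exp_iff_exists_int.1 ((hk b vb hvb hb).trans (hk a va hva ha).symm)
  obtain ⟨n, hn⟩ := hint hk
  obtain ⟨n', hn'⟩ := hint hk'
  have hκ : Complex.exp (n' * k a + (-n : ℤ) * k' a) = 1 := by
    rw [Complex.exp_add, Complex.exp_int_mul, Complex.exp_int_mul, hk a va hva ha, hk' a va hva ha]
    simp
  -- From `a` to `b` the two logarithms grow by `n` and `n'` times `2πi`. The combination with
  -- coefficients `n'` and `-n` has no increment, hence is compactly supported after subtraction of
  -- a constant, and the multiplicity `n'` at `x` must vanish. Then `y` and `w` are not separated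
  -- after all.
  have hzero := hs.multiplicity_eq_zero hs' (isClosed_carrierOf_union h.isOpen hle) hx hy hw
    (l := n') (m := -n) (by
      refine hasCompactLog_of_isArcLog h.isOpen hle
        (g := fun z => n' * g z + (-n : ℤ) * g' z - (n' * k a + (-n : ℤ) * k' a)) ?_ ?_ ?_ ?_
      · intro z hz
        rw [Complex.exp_sub, hκ, div_one, Complex.exp_add, Complex.exp_int_mul,
          Complex.exp_int_mul, hg.exp_eq z hz, hg'.exp_eq z hz]
      · intro u v huv
        exact ((continuousOn_const.mul (hg.isLogLift u v huv).continuousOn).add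
          (continuousOn_const.mul (hg'.isLogLift u v huv).continuousOn)).sub continuousOn_const
      · intro u v p huv hp
        rw [hg.inner_eq u p hp, hg'.inner_eq u p hp]
        exact (((hg.isLogLift u v huv).tendsto_zero.const_mul _).add
          ((hg'.isLogLift u v huv).tendsto_zero.const_mul _)).sub_const _
      · intro u v huv hu
        filter_upwards [hg.eventually_eq h.isOpen hle hs huv hu (hk u v huv hu),
          hg'.eventually_eq h.isOpen hle hs' huv hu (hk' u v huv hu)] with s h1 h2
        rw [h1, h2]
        rcases h.exterior_on_path huv hu with rfl | rfl
        · ring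
        · rw [hn, hn']
          push_cast
          ring) hxy hxw
  rw [hzero] at hn'
  refine hyw ((h.side_iff ha hb hs' hy hw hg' hk').2 ?_)
  rw [hn']
  simp

end IsTrivalentTree

/-- A parametrisation of the first part of an arc beginning at an interior vertex. -/
theorem exists_continuous_arc {u v : V} (huv : N.graph.Adj u v) {p : Plane}
    (hp : N.site u = .inner p) {s : ℝ} (hs : s ∈ Ioo (0 : ℝ) 1) :
    ∃ γ : ℝ → ℂ, Continuous γ ∧ γ 0 = p ∧ γ 1 = N.arc u v s ∧
      γ '' Icc 0 1 ⊆ {p} ∪ N.arc u v '' Ioc 0 s := by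
  let e : ℝ → ℂ := fun t => if t ≤ 0 then p else N.arc u v (min t s)
  have he : Continuous e := by
    rw [continuous_iff_continuousAt]
    intro t
    rcases lt_trichotomy t 0 with ht | rfl | ht
    · refine (continuousAt_const (y := p)).congr ?_
      filter_upwards [gt_mem_nhds ht] with r hr
      simp [e, le_of_lt hr]
    · have h0 : e 0 = p := by simp [e]
      rw [ContinuousAt, h0, ← nhdsLE_sup_nhdsGT, tendsto_sup]
      constructor
      · refine tendsto_const_nhds.congr' ?_
        filter_upwards [self_mem_nhdsWithin] with r hr
        have hr' : r ≤ 0 := hr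
        simp [e, hr']
      · refine (arc_tendsto_inner huv hp).congr' ?_
        filter_upwards [Ioo_mem_nhdsGT hs.1] with r hr
        simp [e, not_le.2 hr.1, min_eq_left hr.2.le]
    · have hm : min t s ∈ Ioo (0 : ℝ) 1 := ⟨lt_min ht hs.1, (min_le_right _ _).trans_lt hs.2⟩
      have : ContinuousAt (fun t => N.arc u v (min t s)) t :=
        ContinuousAt.comp (f := fun t => min t s) (tendsto_arc huv hm) (by fun_prop)
      refine this.congr ?_
      filter_upwards [lt_mem_nhds ht] with r hr
      simp [e, not_le.2 hr]
  refine ⟨fun t => e (t * s), he.comp (by fun_prop), by simp [e], ?_, ?_⟩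
  · simp [e, not_le.2 hs.1]
  · rintro _ ⟨t, ht, rfl⟩
    rcases eq_or_lt_of_le ht.1 with h0 | h0
    · left
      simp [e, ← h0]
    · right
      have h1 : 0 < t * s := mul_pos h0 hs.1
      have h2 : t * s ≤ s := by nlinarith [ht.2, hs.1]
      exact ⟨t * s, ⟨h1, h2⟩, by simp [e, not_le.2 h1, min_eq_left h2]⟩

theorem exists_log_arc {u v : V} (huv : N.graph.Adj u v) {p : Plane}
    (hp : N.site u = .inner p) {s : ℝ} (hs : s ∈ Ioo (0 : ℝ) 1) :
    ∃ g : ℂ → ℂ, ContinuousOn g ({p} ∪ N.arc u v '' Ioc 0 s)ᶜ ∧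
      ∀ z ∈ ({p} ∪ N.arc u v '' Ioc 0 s)ᶜ, Complex.exp (g z) = (z - N.arc u v s) / (z - p) := by
  obtain ⟨γ, hγ, h0, h1, hsub⟩ := exists_continuous_arc huv hp hs
  obtain ⟨L, hL, hLe, -⟩ := exists_log_path hγ
  have hsub' := compl_subset_compl.2 hsub
  have m1 : (1 : ℝ) ∈ Icc (0 : ℝ) 1 := by simp
  refine ⟨L 1, ?_, fun z hz => ?_⟩
  · exact (hL.comp (f := fun z => ((1 : ℝ), z)) (by fun_prop) fun z hz => ⟨m1, hz⟩).mono hsub'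
  · rw [hLe 1 m1 z (hsub' hz), h0, h1]

/-- A logarithm of `z - p` on the complement of the half line which runs along a path from a point
`p` on an arc to an exterior vertex. -/
theorem exists_log_half_path (hΩ : IsOpen Ω) (hs : IsSimplyConnected Ω) {H : SimpleGraph V}
    (hH : H ≤ N.graph) {v b : V} (p : H.Walk v b) (hp : p.IsPath) (hb : ¬ (N.site b).IsInner)
    (hin : ∀ x ∈ p.support, x ≠ b → (N.site x).IsInner) {u : V} (huv : N.graph.Adj v u)
    {s : ℝ} (hsm : s ∈ Ioo (0 : ℝ) 1) :
    ∃ g : ℂ → ℂ, ContinuousOn g (Ω \ (N.carrierOf H ∪ N.arc v u '' Ioc 0 s)) ∧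
      ∀ z ∈ Ω \ (N.carrierOf H ∪ N.arc v u '' Ioc 0 s), Complex.exp (g z) = z - N.arc v u s := by
  induction p generalizing u s with
  | @nil w =>
    have hs₂ : (s + 1) / 2 ∈ Ioo (0 : ℝ) 1 := ⟨by linarith [hsm.1], by linarith [hsm.2]⟩
    obtain ⟨g, hg, hge⟩ := exists_log_sub_of_ray hΩ hs (N.arc_continuous _ _ huv)
      (N.arc_mem _ _ huv) (arc_exterior_end hΩ huv hb) hsm hs₂ (by
        rintro ⟨r, hr, e⟩
        have := N.arc_injective _ _ huv ⟨hr.1, hr.2.trans_lt hsm.2⟩ hs₂ e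
        linarith [hr.2, hsm.2])
    have hsub : Ω \ (N.carrierOf H ∪ N.arc w u '' Ioc 0 s) ⊆ Ω \ N.arc w u '' Ioc 0 s :=
      sdiff_subset_sdiff_right subset_union_right
    exact ⟨g, hg.mono hsub, fun z hz => hge z (hsub hz)⟩
  | @cons v w b e p ih =>
    rw [Walk.cons_isPath_iff] at hp
    have hvb : v ≠ b := fun h => hp.2 (h ▸ p.end_mem_support)
    obtain ⟨q, hq⟩ := inner_iff.1 (hin v (by simp) hvb)
    have h2 : (1 / 2 : ℝ) ∈ Ioo (0 : ℝ) 1 := by norm_num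
    obtain ⟨g₁, hg₁, hge₁⟩ := ih hp.1 hb (fun x hx => hin x (by simp [hx])) (hH e).symm h2
    obtain ⟨g₂, hg₂, hge₂⟩ := exists_log_arc huv hq hsm
    obtain ⟨g₃, hg₃, hge₃⟩ := exists_log_arc (hH e) hq h2
    have hwv : N.arc w v (1 / 2) = N.arc v w (1 / 2) := by
      rw [N.arc_symm v w (hH e) _ h2]
      norm_num
    have hqH : q ∈ N.carrierOf H := ⟨v, w, e, Or.inr hq⟩
    have hsub₁ : Ω \ (N.carrierOf H ∪ N.arc v u '' Ioc 0 s) ⊆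
        Ω \ (N.carrierOf H ∪ N.arc w v '' Ioc 0 (1 / 2)) := by
      rintro z ⟨hz, hz'⟩
      refine ⟨hz, ?_⟩
      rintro (h1 | ⟨r, hr, rfl⟩)
      · exact hz' (Or.inl h1)
      · exact hz' (Or.inl ⟨w, v, e.symm, Or.inl ⟨r, ⟨hr.1, hr.2.trans_lt h2.2⟩, rfl⟩⟩)
    have hsub₂ : Ω \ (N.carrierOf H ∪ N.arc v u '' Ioc 0 s) ⊆ ({q} ∪ N.arc v u '' Ioc 0 s)ᶜ := by
      rintro z ⟨hz, hz'⟩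
      rintro (h1 | h1)
      · exact hz' (Or.inl (h1 ▸ hqH))
      · exact hz' (Or.inr h1)
    have hsub₃ : Ω \ (N.carrierOf H ∪ N.arc v u '' Ioc 0 s) ⊆
        ({q} ∪ N.arc v w '' Ioc 0 (1 / 2))ᶜ := by
      rintro z ⟨hz, hz'⟩
      rintro (h1 | ⟨r, hr, rfl⟩)
      · exact hz' (Or.inl (h1 ▸ hqH))
      · exact hz' (Or.inl ⟨v, w, e, Or.inl ⟨r, ⟨hr.1, hr.2.trans_lt h2.2⟩, rfl⟩⟩)
    -- The zero travels from the middle of the arc `vw` back to `q`, and from `q` to the point on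
    -- the arc `vu`; the factors `z - q` cancel.
    refine ⟨fun z => g₁ z + g₂ z - g₃ z,
      ((hg₁.mono hsub₁).add (hg₂.mono hsub₂)).sub (hg₃.mono hsub₃), fun z hz => ?_⟩
    have n1 : z - q ≠ 0 := sub_ne_zero.2 fun e => hsub₂ hz (Or.inl e)
    have n2 : z - N.arc v w (1 / 2) ≠ 0 := sub_ne_zero.2 fun e =>
      hsub₃ hz (Or.inr ⟨1 / 2, by norm_num, e.symm⟩)
    rw [Complex.exp_sub, Complex.exp_add, hge₁ z (hsub₁ hz), hge₂ z (hsub₂ hz), hge₃ z (hsub₃ hz), hwv]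
    field_simp

end PlanarNetwork

/-! ### A path between exterior vertices separates, and each side reaches every arc of it. -/

theorem mem_connectedComponentIn_symm {X : Type*} [TopologicalSpace X] {F : Set X} {x y : X}
    (h : y ∈ connectedComponentIn F x) : x ∈ connectedComponentIn F y := by
  rw [← connectedComponentIn_eq h]
  refine mem_connectedComponentIn ?_
  by_contra hx
  rw [connectedComponentIn_eq_empty hx] at h
  exact h

theorem mem_connectedComponentIn_trans {X : Type*} [TopologicalSpace X] {F : Set X} {x y z : X}
    (h : y ∈ connectedComponentIn F x) (h' : z ∈ connectedComponentIn F y) :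
    z ∈ connectedComponentIn F x := by
  rwa [connectedComponentIn_eq h]

namespace PlanarNetwork

open SimpleGraph

variable {Ω : Set Plane} {V : Type*} {N : PlanarNetwork Ω V}

theorem isOpen_diff_carrierOf [Finite V] (hΩ : IsOpen Ω) {H : SimpleGraph V} (hH : H ≤ N.graph) :
    IsOpen (Ω \ N.carrierOf H) := by
  have : (N.carrierOf H ∪ Ωᶜ)ᶜ = Ω \ N.carrierOf H := by
    ext z; simp [and_comm]
  exact this ▸ (isClosed_carrierOf_union hΩ hH).isOpen_compl

theorem arc_half {u v : V} (huv : N.graph.Adj u v) : N.arc v u (1 / 2) = N.arc u v (1 / 2) := by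
  rw [N.arc_symm u v huv _ (by norm_num)]
  norm_num

/-- Limits of points on the initial piece of an arc lie on the piece, at the interior vertex where
it starts, or outside `Ω`. -/
theorem notMem_closure_arc (hΩ : IsOpen Ω) {u v : V} (huv : N.graph.Adj u v) {s : ℝ}
    (hs : s ∈ Ioo (0 : ℝ) 1) {z : ℂ} (hz : z ∈ Ω) (hzs : z ∉ N.arc u v '' Ioc 0 s)
    (hzu : N.site u ≠ .inner z) : z ∉ closure (N.arc u v '' Ioc 0 s) := by
  rw [mem_closure_iff_ultrafilter]
  rintro ⟨𝒰, hU, hle⟩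
  have hm := Ultrafilter.ofComapInfPrincipal_mem hU
  have he := Ultrafilter.ofComapInfPrincipal_eq_of_map hU
  set 𝒱 := Ultrafilter.ofComapInfPrincipal hU
  obtain ⟨r, hr, hr'⟩ := isCompact_Icc.ultrafilter_le_nhds 𝒱
    (le_principal_iff.2 (mem_of_superset hm Ioc_subset_Icc_self))
  have hle' : Tendsto (N.arc u v) 𝒱 (𝓝 z) := by
    rw [← he] at hle
    exact hle
  rcases eq_or_lt_of_le hr.1 with h0 | h0
  · subst h0
    have h𝒱 : (𝒱 : Filter ℝ) ≤ 𝓝[>] 0 :=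
      le_inf hr' (le_principal_iff.2 (mem_of_superset hm fun s hs => hs.1))
    by_cases hu : (N.site u).IsInner
    · obtain ⟨p, hp⟩ := inner_iff.1 hu
      exact hzu (tendsto_nhds_unique hle' ((arc_tendsto_inner huv hp).mono_left h𝒱) ▸ hp)
    · exact notMem_of_ultrafilter_exterior hΩ huv hu h𝒱 hle' hz
  · have hr1 : r ∈ Ioo (0 : ℝ) 1 := ⟨h0, hr.2.trans_lt hs.2⟩
    exact hzs ⟨r, ⟨h0, hr.2⟩, tendsto_nhds_unique ((tendsto_arc huv hr1).mono_left hr') hle'⟩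

namespace IsTrivalentTree

variable [Finite V] {a b : V}

/-- A path between exterior vertices separates the domain. -/
theorem not_isPreconnected_diff_pathSet (h : N.IsTrivalentTree) (ha : ¬ (N.site a).IsInner)
    (hb : ¬ (N.site b).IsInner) (hab : a ≠ b) : ¬ IsPreconnected (Ω \ N.pathSet a b) := by
  classical
  intro hpre
  obtain ⟨a', haa, -⟩ := N.exists_adj a
  set H := N.graph.pathBetween a b with hH
  have hHG : H ≤ N.graph := pathBetween_le a b
  have hHa : H.Adj a a' := pathBetween_adj_start h.isTree hab (h.eq_of_adj ha) haa
  set H' := H.deleteEdges {s(a, a')} with hH'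
  have hH'H : H' ≤ H := deleteEdges_le _
  obtain ⟨q, hq, haq⟩ : ∃ q : H.Walk a' b, q.IsPath ∧ a ∉ q.support := by
    obtain ⟨p, -⟩ := h.isTree.exists_walk_pathBetween a b
    obtain ⟨p, hp⟩ : ∃ p : H.Walk a b, p.IsPath := ⟨p.toPath.1, p.toPath.2⟩
    cases p with
    | nil => exact absurd rfl hab
    | cons e p =>
      rw [Walk.cons_isPath_iff] at hp
      obtain rfl := h.eq_of_adj ha _ _ (hHG e) haa
      exact ⟨p, hp⟩
  have hin : ∀ x ∈ q.support, x ≠ b → (N.site x).IsInner := by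
    intro x hx hxb
    by_contra hxi
    have : ∃ y, H.Adj x y := by
      have := q.dropUntil x hx
      cases this with
      | nil => exact absurd rfl hxb
      | cons e _ => exact ⟨_, e⟩
    obtain ⟨y, hy⟩ := this
    rcases h.exterior_on_path hy hxi with rfl | rfl
    exacts [haq hx, hxb rfl]
  have hqe : ∀ e ∈ q.edges, e ∈ H'.edgeSet := by
    intro e he
    rw [hH', edgeSet_deleteEdges]
    refine ⟨q.edges_subset_edgeSet he, ?_⟩
    rintro rfl
    exact haq (q.fst_mem_support_of_mem_edges he)
  have h2 : (1 / 2 : ℝ) ∈ Ioo (0 : ℝ) 1 := by norm_num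
  -- The point at `3 / 4` is on the same arc but beyond the ray that stops at `1 / 2`; it serves as
  -- base point in `exists_log_sub_of_ray`.
  have h3 : (3 / 4 : ℝ) ∈ Ioo (0 : ℝ) 1 := by norm_num
  obtain ⟨g₁, hg₁, hge₁⟩ := exists_log_sub_of_ray h.isOpen h.isSimplyConnected
    (N.arc_continuous _ _ haa) (N.arc_mem _ _ haa) (arc_exterior_end h.isOpen haa ha) h2 h3 (by
      rintro ⟨r, hr, e⟩
      have := N.arc_injective _ _ haa ⟨hr.1, hr.2.trans_lt h2.2⟩ h3 e
      linarith [hr.2])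
  obtain ⟨g₂, hg₂, hge₂⟩ := exists_log_half_path h.isOpen h.isSimplyConnected (hH'H.trans hHG)
    (q.transfer H' hqe) (hq.transfer hqe) hb (by simpa using hin) haa.symm h2
  set pt := N.arc a a' (1 / 2) with hpt
  rw [arc_half haa] at hge₂
  set U := Ω \ N.arc a a' '' Ioc 0 (1 / 2) with hU
  set W := Ω \ (N.carrierOf H' ∪ N.arc a' a '' Ioc 0 (1 / 2)) with hW
  -- The point `pt` cuts the path into two halves, and `z - pt` has a logarithm off each of them.
  -- The complement of the whole path, if connected, allows only one constant `2πi * n` between the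
  -- two logarithms.
  have hUW : U ∩ W ⊆ Ω \ N.pathSet a b := by
    rintro z ⟨⟨hz, hz1⟩, -, hz2⟩
    refine ⟨hz, ?_⟩
    rintro ⟨u, v, huv, hz3⟩
    have huv' : H.Adj u v := huv
    by_cases hE : s(u, v) = s(a, a')
    · rcases hz3 with hz3 | hz3
      · have : z ∈ N.arc a a' '' Ioo 0 1 := by
          rcases Sym2.eq_iff.1 hE with ⟨rfl, rfl⟩ | ⟨rfl, rfl⟩
          · exact hz3
          · rwa [image_arc_symm haa] at hz3
        obtain ⟨r, hr, rfl⟩ := this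
        rcases le_or_gt r (1 / 2) with h5 | h5
        · exact hz1 ⟨r, ⟨hr.1, h5⟩, rfl⟩
        · refine hz2 (Or.inr ⟨1 - r, ⟨by linarith [hr.2], by linarith⟩, ?_⟩)
          rw [N.arc_symm a a' haa _ (one_sub_mem_Ioo hr), sub_sub_cancel]
      · have hui : (N.site u).IsInner := inner_iff.2 ⟨z, hz3⟩
        rcases Sym2.eq_iff.1 hE with ⟨rfl, rfl⟩ | ⟨rfl, rfl⟩
        · exact ha hui
        · obtain ⟨w', hw', hw'', -⟩ := exists_other_pathBetween_adj h.isTree huv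
            (fun e => ha (e ▸ hui)) (fun e => hb (e ▸ hui))
          refine hz2 (Or.inl ⟨u, w', ?_, Or.inr hz3⟩)
          rw [hH', deleteEdges_adj]
          refine ⟨hw'', fun e => ?_⟩
          rcases Sym2.eq_iff.1 e with ⟨e1, -⟩ | ⟨-, e1⟩
          · exact haa.ne e1.symm
          · exact hw' e1
    · refine hz2 (Or.inl ⟨u, v, ?_, hz3⟩)
      rw [hH', deleteEdges_adj]
      exact ⟨huv, hE⟩
  have hsub₁ : Ω \ N.pathSet a b ⊆ U := by
    rintro z ⟨hz, hz'⟩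
    refine ⟨hz, ?_⟩
    rintro ⟨r, hr, rfl⟩
    exact hz' ⟨a, a', hHa, Or.inl ⟨r, ⟨hr.1, hr.2.trans_lt h2.2⟩, rfl⟩⟩
  have hsub₂ : Ω \ N.pathSet a b ⊆ W := by
    rintro z ⟨hz, hz'⟩
    refine ⟨hz, ?_⟩
    rintro (h1 | ⟨r, hr, rfl⟩)
    · exact hz' (carrierOf_mono N hH'H h1)
    · exact hz' ⟨a', a, hHa.symm, Or.inl ⟨r, ⟨hr.1, hr.2.trans_lt h2.2⟩, rfl⟩⟩
  obtain ⟨n, hn⟩ := hpre.exists_int_of_exp_eq (hg₁.mono hsub₁) (hg₂.mono hsub₂)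
    fun z hz => (hge₁ z (hsub₁ hz)).trans (hge₂ z (hsub₂ hz)).symm
  have hcover : ∀ z ∈ Ω, z ≠ pt → z ∉ U → z ∈ W := by
    intro z hz hzp hzU
    have : z ∈ N.arc a a' '' Ioc 0 (1 / 2) := by
      by_contra h5
      exact hzU ⟨hz, h5⟩
    obtain ⟨r, hr, rfl⟩ := this
    have hr1 : r ∈ Ioo (0 : ℝ) 1 := ⟨hr.1, hr.2.trans_lt h2.2⟩
    refine ⟨hz, ?_⟩
    rintro (⟨u, v, huv, ⟨r', hr', e⟩ | h5⟩ | ⟨r', hr', e⟩)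
    · rw [hH', deleteEdges_adj] at huv
      exact huv.2 (sym2_eq_of_arc_eq (hHG huv.1) haa hr' hr1 e)
    · exact inner_ne_arc haa h5 hr1 rfl
    · have hr1' : r' ∈ Ioo (0 : ℝ) 1 := ⟨hr'.1, hr'.2.trans_lt h2.2⟩
      rw [N.arc_symm a a' haa _ hr1'] at e
      have := N.arc_injective _ _ haa (one_sub_mem_Ioo hr1') hr1 e
      have h6 : r = 1 / 2 := by linarith [hr.2, hr'.2]
      exact hzp (by rw [h6])
  have hUo : ∀ z ∈ U, U ∈ 𝓝 z := by
    rintro z ⟨hz, hz1⟩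
    have := notMem_closure_arc h.isOpen haa h2 hz hz1 fun e => ha (inner_iff.2 ⟨z, e⟩)
    filter_upwards [h.isOpen.mem_nhds hz, isClosed_closure.isOpen_compl.mem_nhds this] with y h1 h3
    exact ⟨h1, fun h4 => h3 (subset_closure h4)⟩
  have hWo : ∀ z ∈ W, z ∉ U → W ∈ 𝓝 z := by
    rintro z ⟨hz, hz1⟩ hzU
    have hzu : N.site a' ≠ .inner z := by
      intro e
      refine hzU ⟨hz, ?_⟩
      rintro ⟨r, hr, rfl⟩
      exact inner_ne_arc haa e ⟨hr.1, hr.2.trans_lt h2.2⟩ rfl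
    have h4 := notMem_closure_arc h.isOpen haa.symm h2 hz (fun h5 => hz1 (Or.inr h5)) hzu
    filter_upwards [(isOpen_diff_carrierOf h.isOpen (hH'H.trans hHG)).mem_nhds
      ⟨hz, fun h5 => hz1 (Or.inl h5)⟩, isClosed_closure.isOpen_compl.mem_nhds h4] with y h1 h3
    exact ⟨h1.1, fun h5 => h5.elim h1.2 fun h6 => h3 (subset_closure h6)⟩
  have hptΩ : pt ∈ Ω := N.arc_mem _ _ haa h2
  obtain ⟨r, hr, hrΩ⟩ := Metric.isOpen_iff.1 h.isOpen pt hptΩ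
  -- `U` and `W` cover `Ω` except `pt`, so the adjusted logarithms glue to a logarithm of `z - pt`
  -- around `pt`, which is impossible.
  let g : ℂ → ℂ := fun z => if z ∈ U then g₁ z else g₂ z + n * (2 * Real.pi * Complex.I)
  have hgW : ∀ z ∈ W, g z = g₂ z + n * (2 * Real.pi * Complex.I) := by
    intro z hz
    by_cases hzU : z ∈ U
    · simp only [g, hzU, if_true]
      exact hn z (hUW ⟨hzU, hz⟩)
    · simp only [g, hzU, if_false]
  have := zpow_eq_zero_of_log_punctured_ball hr (m := 1) (g := g) (ψ := fun _ => 0) (x := pt) ?_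
    continuousOn_const ?_
  · exact one_ne_zero this
  · rintro z ⟨hz, hzp⟩
    by_cases hzU : z ∈ U
    · refine ((hg₁.continuousAt (hUo z hzU)).congr ?_).continuousWithinAt
      filter_upwards [hUo z hzU] with y hy
      simp only [g, hy, if_true]
    · have hzW := hcover z (hrΩ hz) hzp hzU
      have := hWo z hzW hzU
      refine (((hg₂.continuousAt this).add (continuousAt_const
        (y := n * (2 * Real.pi * Complex.I)))).congr ?_).continuousWithinAt
      filter_upwards [this] with y hy
      exact (hgW y hy).symm
  · rintro z ⟨hz, hzp⟩
    rw [zpow_one, Complex.exp_zero, mul_one]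
    by_cases hzU : z ∈ U
    · simp only [g, hzU, if_true]
      exact hge₁ z hzU
    · have hzW := hcover z (hrΩ hz) hzp hzU
      rw [hgW z hzW, Complex.exp_add, hge₂ z hzW, Complex.exp_int_mul_two_pi_mul_I, mul_one]

theorem exists_notMem_side (h : N.IsTrivalentTree) (ha : ¬ (N.site a).IsInner)
    (hb : ¬ (N.site b).IsInner) (hab : a ≠ b) (x : ℂ) :
    ∃ y ∈ Ω \ N.pathSet a b, y ∉ connectedComponentIn (Ω \ N.pathSet a b) x := by
  by_contra! hcon
  refine h.not_isPreconnected_diff_pathSet ha hb hab (isPreconnected_of_forall_pair ?_)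
  exact fun y hy z hz => ⟨connectedComponentIn (Ω \ N.pathSet a b) x,
    connectedComponentIn_subset _ _, hcon y hy, hcon z hz, isPreconnected_connectedComponentIn⟩

end IsTrivalentTree

end PlanarNetwork

theorem continuousAt_ite_lt {E : Type*} [TopologicalSpace E] (A B : E) {r s : ℝ} (h : r ≠ s) :
    ContinuousAt (fun r => if r < s then A else B) r := by
  rcases lt_or_gt_of_ne h with h | h
  · refine (continuousAt_const (y := A)).congr ?_
    filter_upwards [gt_mem_nhds h] with t ht
    rw [if_pos ht]
  · refine (continuousAt_const (y := B)).congr ?_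
    filter_upwards [lt_mem_nhds h] with t ht
    rw [if_neg ht.not_gt]

namespace PlanarNetwork

open SimpleGraph

variable {Ω : Set Plane} {V : Type*} {N : PlanarNetwork Ω V}

namespace IsTrivalentTree

variable [Finite V] {a b : V}

/-- Suppose a point of the arc stays away from the closure of the side `S`. The part of the path in
`closure S` is then broken at this point, and a logarithm may be corrected by different constants
before and after it so as to vanish at both ends. Hence this part does not separate `x` from a point
`y` of the other side, although it contains the frontier of `S` in `Ω`. -/
theorem mem_closure_side_of_notMem_branch (h : N.IsTrivalentTree) (ha : ¬ (N.site a).IsInner)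
    (hb : ¬ (N.site b).IsInner) {u v : V} (huv : (N.graph.pathBetween a b).Adj u v)
    (hau : a ∉ N.graph.branch u v) {s : ℝ} (hs : s ∈ Ioo (0 : ℝ) 1) {x : ℂ}
    (hx : x ∈ Ω \ N.pathSet a b) :
    N.arc u v s ∈ closure (connectedComponentIn (Ω \ N.pathSet a b) x) := by
  classical
  by_contra hcl
  have hG := h.isTree
  have hle := pathBetween_le (G := N.graph) a b
  have hbu : b ∈ N.graph.branch u v := by
    rcases (pathBetween_adj_iff_branch hG huv.1).1 huv with h1 | h1
    exacts [absurd h1.1 hau, h1.2]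
  have hab : a ≠ b := fun e => hau (e ▸ hbu)
  set S := connectedComponentIn (Ω \ N.pathSet a b) x with hS
  obtain ⟨y, hy, hyS⟩ := h.exists_notMem_side ha hb hab x
  obtain ⟨ℓ, C, hsep⟩ := exists_isSeparator h.isOpen h.isSimplyConnected hx.1 hy.1
  obtain ⟨g, k, hg, hk⟩ := exists_isArcLog_sepFun h.isOpen h.isTree hle hsep hx.2 hy.2
  obtain ⟨va, hva, -⟩ := N.exists_adj a
  have hka := hk a va (pathBetween_adj_start h.isTree hab (h.eq_of_adj ha) hva) ha
  obtain ⟨vb, hvb, -⟩ := N.exists_adj b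
  have hkb := hk b vb (by
    rw [pathBetween_comm]
    exact pathBetween_adj_start h.isTree hab.symm (h.eq_of_adj hb) hvb) hb
  -- The correction `c` takes the value `k a` up to the point `N.arc u v s` and `k b` beyond it,
  -- with its only jump at that point; `l` gives it on both orientations of the broken arc.
  let cv : V → ℂ := fun w => if w ∈ N.graph.branch u v then k b else k a
  let l : V → V → ℝ → ℂ := fun u' v' r =>
    if u' = u ∧ v' = v then (if r < s then k a else k b)
    else if u' = v ∧ v' = u then (if 1 - r < s then k a else k b) else cv u'
  have hne := huv.1.ne
  have hcvu : cv u = k a := if_neg (IsAcyclic.notMem_branch hG.2 huv.1)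
  have hcvv : cv v = k b := if_pos (mem_branch_self u v)
  have hl : ∀ u' v', N.graph.Adj u' v' → ∀ r ∈ Ioo (0 : ℝ) 1, l v' u' r = l u' v' (1 - r) := by
    intro u' v' h' r hr
    by_cases h1 : u' = u ∧ v' = v
    · obtain ⟨rfl, rfl⟩ := h1
      simp [l, hne, hne.symm]
    by_cases h2 : u' = v ∧ v' = u
    · obtain ⟨rfl, rfl⟩ := h2
      simp [l, hne, hne.symm]
    · have h3 : ¬ (v' = u ∧ u' = v) := fun e => h2 e.symm
      have h4 : ¬ (v' = v ∧ u' = u) := fun e => h1 e.symm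
      simp only [l, h1, h2, h3, h4, if_false, cv]
      have hadj : (N.graph.deleteEdges {s(u, v)}).Adj u' v' := by
        rw [deleteEdges_adj]
        refine ⟨h', fun e => ?_⟩
        rcases Sym2.eq_iff.1 e with e | e
        exacts [h1 e, h2 e]
      have : v' ∈ N.graph.branch u v ↔ u' ∈ N.graph.branch u v :=
        ⟨fun e => Reachable.trans e hadj.symm.reachable, fun e => Reachable.trans e hadj.reachable⟩
      simp only [this]
  obtain ⟨c, hci, hca⟩ := N.exists_extension cv l hl
  have hcv1 : ∀ w, Complex.exp (cv w) = 1 := by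
    intro w
    simp only [cv]
    split_ifs <;> assumption
  have hl1 : ∀ u' v' r, Complex.exp (l u' v' r) = 1 := by
    intro u' v' r
    simp only [l]
    split_ifs <;> first | assumption | exact hcv1 _
  have hl0 : ∀ u' v', N.graph.Adj u' v' → ∀ᶠ r in 𝓝[>] 0, c (N.arc u' v' r) = cv u' := by
    intro u' v' h'
    have h01 : 0 < min s (1 - s) := lt_min hs.1 (sub_pos.2 hs.2)
    filter_upwards [Ioo_mem_nhdsGT_zero, Ioo_mem_nhdsGT h01] with r hr hr'
    rw [hca u' v' h' r hr]
    have h3 : r < s := hr'.2.trans_le (min_le_left _ _)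
    have h4 : ¬ 1 - r < s := by
      have := hr'.2.trans_le (min_le_right _ _)
      linarith
    by_cases h1 : u' = u ∧ v' = v
    · simp only [l, h1.1, h1.2, h3, hcvu, and_self, if_true]
    by_cases h2 : u' = v ∧ v' = u
    · simp only [l, h2.1, h2.2, hne, hne.symm, h4, hcvv, and_self, if_true, if_false]
    · simp only [l, h1, h2, if_false]
  have hcc : ∀ u' v', N.graph.Adj u' v' → ∀ r ∈ Ioo (0 : ℝ) 1, N.arc u' v' r ≠ N.arc u v s →
      ContinuousAt (fun r => c (N.arc u' v' r)) r := by
    intro u' v' h' r hr hrs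
    have key : ContinuousAt (l u' v') r := by
      by_cases h1 : u' = u ∧ v' = v
      · obtain ⟨rfl, rfl⟩ := h1
        simp only [l, and_self, if_true]
        exact continuousAt_ite_lt _ _ fun e => hrs (by rw [e])
      by_cases h2 : u' = v ∧ v' = u
      · obtain ⟨rfl, rfl⟩ := h2
        simp only [l, hne, hne.symm, and_self, if_true, if_false]
        have : 1 - r ≠ s := fun e => hrs (by rw [N.arc_symm _ _ huv.1 _ hr, e])
        exact ContinuousAt.comp (f := fun r : ℝ => 1 - r) (continuousAt_ite_lt (k a) (k b) this)
          (by fun_prop)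
      · simp only [l, h1, h2, if_false]
        exact continuousAt_const
    refine key.congr ?_
    filter_upwards [isOpen_Ioo.mem_nhds hr] with t ht
    exact (hca u' v' h' t ht).symm
  have hcl' := isClosed_carrierOf_union h.isOpen hle
  have hso : IsOpen (Ω \ N.pathSet a b) := isOpen_diff_carrierOf h.isOpen hle
  have hxS : x ∈ S := mem_connectedComponentIn hx
  have hmem := hsep.mem_component (F := N.pathSet a b ∩ closure S) (by
      rw [inter_union_distrib_right]
      exact hcl'.inter (isClosed_closure.union h.isOpen.isClosed_compl))
    ⟨hx.1, fun e => hx.2 e.1⟩ ⟨hy.1, fun e => hy.2 e.1⟩ (by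
      refine hasCompactLog_of_arcs h.isOpen hle inter_subset_left (g := fun z => g z - c z)
        ?_ ?_ ?_ ?_
      · rintro z ⟨hz, -⟩
        have : Complex.exp (c z) = 1 := by
          obtain ⟨u', v', h', ⟨r, hr, rfl⟩ | hz'⟩ := hz
          · rw [hca u' v' (hle h') r hr, hl1]
          · rw [hci u' z hz', hcv1]
        rw [Complex.exp_sub, this, div_one, hg.exp_eq z hz]
      · intro u' v' h' r hr hz
        refine (ContinuousAt.sub ((hg.isLogLift u' v' h').continuousOn.continuousAt
          (isOpen_Ioo.mem_nhds hr)) (hcc u' v' (hle h') r hr ?_)).continuousWithinAt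
        exact fun e => hcl (e ▸ hz.2)
      · intro u' v' p h' hp
        rw [hg.inner_eq u' p hp, hci u' p hp]
        exact (hg.isLogLift u' v' h').tendsto_zero.sub
          (tendsto_const_nhds.congr' ((hl0 u' v' (hle h')).mono fun _ e => e.symm))
      · intro u' v' h' hu'
        filter_upwards [hl0 u' v' (hle h'),
          hg.eventually_eq h.isOpen hle hsep h' hu' (hk u' v' h' hu')] with r h1 h2
        rw [h1, h2, sub_eq_zero]
        rcases h.exterior_on_path h' hu' with rfl | rfl
        · exact (if_neg hau).symm
        · exact (if_pos hbu).symm)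
  have hpre := isPreconnected_connectedComponentIn (F := Ω \ (N.pathSet a b ∩ closure S)) (x := x)
  have hSo : IsOpen S := hso.connectedComponentIn
  -- `S` and the complement of its closure split the component that was found to contain both `x`
  -- and `y`.
  exact (isPreconnected_iff_subset_of_disjoint.1 hpre S (closure S)ᶜ hSo
    isClosed_closure.isOpen_compl (by
      intro z hz
      by_cases hzc : z ∈ closure S
      · left
        by_contra hzS
        have hzΩ := connectedComponentIn_subset _ _ hz
        have hfr : z ∈ frontier S := hSo.frontier_eq ▸ ⟨hzc, hzS⟩
        exact hzΩ.2 ⟨frontier_connectedComponentIn_inter_subset hcl' x ⟨hfr, hzΩ.1⟩, hzc⟩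
      · exact Or.inr hzc) (by
      rw [← subset_empty_iff]
      rintro z ⟨-, hz, hz'⟩
      exact hz' (subset_closure hz))).elim (fun h1 => absurd (h1 hmem) hyS)
      (fun h1 => absurd (subset_closure hxS) (h1 (mem_connectedComponentIn ⟨hx.1, fun e => hx.2 e.1⟩)))

theorem arc_mem_closure_side (h : N.IsTrivalentTree) (ha : ¬ (N.site a).IsInner)
    (hb : ¬ (N.site b).IsInner) {u v : V} (huv : (N.graph.pathBetween a b).Adj u v) {s : ℝ}
    (hs : s ∈ Ioo (0 : ℝ) 1) {x : ℂ} (hx : x ∈ Ω \ N.pathSet a b) :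
    N.arc u v s ∈ closure (connectedComponentIn (Ω \ N.pathSet a b) x) := by
  by_cases hau : a ∈ N.graph.branch u v
  · have hbu : b ∉ N.graph.branch u v := by
      rcases (pathBetween_adj_iff_branch h.isTree huv.1).1 huv with h1 | h1
      exacts [h1.2, absurd hau h1.1]
    rw [pathSet_comm] at hx ⊢
    rw [pathBetween_comm] at huv
    exact h.mem_closure_side_of_notMem_branch hb ha huv hbu hs hx
  · exact h.mem_closure_side_of_notMem_branch ha hb huv hau hs hx

/-- Every arc of a path between exterior vertices lies in the frontier of both sides. -/
theorem arc_subset_frontier_side (h : N.IsTrivalentTree) (ha : ¬ (N.site a).IsInner)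
    (hb : ¬ (N.site b).IsInner) {u v : V} (huv : (N.graph.pathBetween a b).Adj u v) {x : ℂ}
    (hx : x ∈ Ω \ N.pathSet a b) :
    N.arc u v '' Ioo 0 1 ⊆ frontier (connectedComponentIn (Ω \ N.pathSet a b) x) := by
  rintro _ ⟨s, hs, rfl⟩
  have hso : IsOpen (Ω \ N.pathSet a b) := isOpen_diff_carrierOf h.isOpen (pathBetween_le a b)
  rw [hso.connectedComponentIn.frontier_eq]
  refine ⟨h.arc_mem_closure_side ha hb huv hs hx, fun e => ?_⟩
  exact (connectedComponentIn_subset _ _ e).2 ⟨u, v, huv, Or.inl ⟨s, hs, rfl⟩⟩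

end IsTrivalentTree

theorem isPreconnected_arc {u v : V} (huv : N.graph.Adj u v) :
    IsPreconnected (N.arc u v '' Ioo 0 1) :=
  isPreconnected_Ioo.image _ (N.arc_continuous u v huv)

theorem arc_adj_of_mem_carrierOf {H : SimpleGraph V} (hH : H ≤ N.graph) {u v : V}
    (huv : N.graph.Adj u v) {s : ℝ} (hs : s ∈ Ioo (0 : ℝ) 1) (h : N.arc u v s ∈ N.carrierOf H) :
    H.Adj u v := by
  obtain ⟨u', v', h', ⟨r, hr, e⟩ | h'⟩ := h
  · rcases Sym2.eq_iff.1 (sym2_eq_of_arc_eq (hH h') huv hr hs e) with ⟨rfl, rfl⟩ | ⟨rfl, rfl⟩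
    exacts [h', h'.symm]
  · exact absurd rfl (inner_ne_arc huv h' hs)

theorem inner_adj_of_mem_carrierOf {H : SimpleGraph V} (hH : H ≤ N.graph) {u : V} {p : Plane}
    (hu : N.site u = .inner p) (h : p ∈ N.carrierOf H) : ∃ v, H.Adj u v := by
  obtain ⟨u', v', h', ⟨r, hr, e⟩ | hu'⟩ := h
  · exact absurd e (inner_ne_arc (hH h') hu hr)
  · exact ⟨v', eq_of_site_eq hu' hu ▸ h'⟩

/-- Two arcs with a common interior end which does not lie on a part of the network are not separated
by that part. -/
theorem exists_isPreconnected_of_adj {H : SimpleGraph V} (hH : H ≤ N.graph) {v u w : V}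
    (hu : N.graph.Adj v u) (hw : N.graph.Adj v w) (hv : (N.site v).IsInner)
    (hnot : ∀ x, ¬ H.Adj v x) :
    ∃ T : Set ℂ, IsPreconnected T ∧ T ⊆ Ω \ N.carrierOf H ∧ N.arc v u '' Ioo 0 1 ⊆ T ∧
      N.arc v w '' Ioo 0 1 ⊆ T ∧ ∀ p, N.site v = .inner p → p ∈ T := by
  obtain ⟨p, hp⟩ := inner_iff.1 hv
  have hcl : ∀ {u}, N.graph.Adj v u → p ∈ closure (N.arc v u '' Ioo 0 1) := by
    intro u hu
    refine mem_closure_of_tendsto (arc_tendsto_inner hu hp) ?_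
    filter_upwards [Ioo_mem_nhdsGT_zero] with s hs
    exact ⟨s, hs, rfl⟩
  have hcon : ∀ {u}, N.graph.Adj v u → IsPreconnected (insert p (N.arc v u '' Ioo 0 1)) :=
    fun {u} hu => (isPreconnected_arc hu).subset_closure (subset_insert _ _)
      (insert_subset (hcl hu) subset_closure)
  have hsub : ∀ {u}, N.graph.Adj v u → insert p (N.arc v u '' Ioo 0 1) ⊆ Ω \ N.carrierOf H := by
    intro u hu
    refine insert_subset ⟨inner_mem hp, fun e => ?_⟩ ?_
    · obtain ⟨x, hx⟩ := inner_adj_of_mem_carrierOf hH hp e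
      exact hnot x hx
    · rintro _ ⟨s, hs, rfl⟩
      exact ⟨N.arc_mem _ _ hu hs, fun e => hnot u (arc_adj_of_mem_carrierOf hH hu hs e)⟩
  refine ⟨insert p (N.arc v u '' Ioo 0 1) ∪ insert p (N.arc v w '' Ioo 0 1),
    (hcon hu).union p (mem_insert _ _) (mem_insert _ _) (hcon hw), union_subset (hsub hu) (hsub hw),
    (subset_insert _ _).trans subset_union_left, (subset_insert _ _).trans subset_union_right, ?_⟩
  intro q hq
  rw [hp] at hq
  injection hq with hq
  exact hq ▸ Or.inl (mem_insert _ _)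

end PlanarNetwork

/-! ### Every region is one side of a path between exterior vertices. -/

namespace PlanarNetwork

open SimpleGraph

variable {Ω : Set Plane} {V : Type*} {N : PlanarNetwork Ω V}

/-- The union of the arcs that end at a vertex. -/
def leafArc (N : PlanarNetwork Ω V) (c : V) : Set Plane :=
  {z | ∃ v, N.graph.Adj c v ∧ z ∈ N.arc c v '' Ioo 0 1}

namespace IsTrivalentTree

variable {a b c : V}

theorem leafArc_eq (h : N.IsTrivalentTree) (hc : ¬ (N.site c).IsInner) {v : V}
    (hv : N.graph.Adj c v) : N.leafArc c = N.arc c v '' Ioo 0 1 := by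
  ext z
  constructor
  · rintro ⟨w, hw, hz⟩
    rwa [h.eq_of_adj hc v w hv hw]
  · exact fun hz => ⟨v, hv, hz⟩

theorem isPreconnected_leafArc (h : N.IsTrivalentTree) (hc : ¬ (N.site c).IsInner) :
    IsPreconnected (N.leafArc c) := by
  obtain ⟨v, hv, -⟩ := N.exists_adj c
  rw [h.leafArc_eq hc hv]
  exact isPreconnected_arc hv

theorem leafArc_nonempty (c : V) : (N.leafArc c).Nonempty := by
  obtain ⟨v, hv, -⟩ := N.exists_adj c
  exact ⟨N.arc c v (1 / 2), v, hv, 1 / 2, by norm_num, rfl⟩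

theorem leafArc_subset_domain : N.leafArc c ⊆ Ω := by
  rintro z ⟨v, hv, hz⟩
  exact arc_subset hv hz

theorem leafArc_subset_carrier : N.leafArc c ⊆ N.carrier := by
  rintro z ⟨v, hv, hz⟩
  exact Or.inr ⟨c, v, hv, hz⟩

theorem leafArc_subset_pathSet (h : N.IsTrivalentTree) (hc : ¬ (N.site c).IsInner) (hca : c ≠ a) :
    N.leafArc c ⊆ N.pathSet c a := by
  rintro z ⟨v, hv, hz⟩
  exact ⟨c, v, pathBetween_adj_start h.isTree hca (h.eq_of_adj hc) hv, Or.inl hz⟩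

theorem disjoint_leafArc_pathSet (h : N.IsTrivalentTree) (hc : ¬ (N.site c).IsInner) (hca : c ≠ a)
    (hcb : c ≠ b) : Disjoint (N.leafArc c) (N.pathSet a b) := by
  rw [Set.disjoint_left]
  rintro z ⟨v, hv, s, hs, rfl⟩ hz
  rcases h.exterior_on_path (arc_adj_of_mem_carrierOf (pathBetween_le a b) hv hs hz) hc with e | e
  exacts [hca e, hcb e]

theorem leafArc_subset_side (h : N.IsTrivalentTree) (hc : ¬ (N.site c).IsInner) (hca : c ≠ a)
    (hcb : c ≠ b) {z : ℂ} (hz : z ∈ N.leafArc c) :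
    N.leafArc c ⊆ connectedComponentIn (Ω \ N.pathSet a b) z :=
  (h.isPreconnected_leafArc hc).subset_connectedComponentIn hz fun _ hw =>
    ⟨leafArc_subset_domain hw, (h.disjoint_leafArc_pathSet hc hca hcb).notMem_of_mem_left hw⟩

/-- Beyond `uv` the tree no longer meets the path from `a` to `b`, so consecutive arcs of the walk
are joined through their common interior vertex without crossing it. -/
theorem leafArc_subset_of_walk (h : N.IsTrivalentTree) (hc : ¬ (N.site c).IsInner) {v : V}
    (p : N.graph.Walk v c) (hp : p.IsPath) {u : V} (hu : u ∉ p.support) (huv : N.graph.Adj u v)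
    (ha : a ∉ N.graph.branch u v) (hb : b ∉ N.graph.branch u v) {z : ℂ}
    (hz : z ∈ N.arc u v '' Ioo 0 1) :
    N.leafArc c ⊆ connectedComponentIn (Ω \ N.pathSet a b) z := by
  have hle := pathBetween_le (G := N.graph) a b
  induction p generalizing u z with
  | @nil c =>
    have hca : c ≠ a := fun e => ha (e ▸ mem_branch_self _ _)
    have hcb : c ≠ b := fun e => hb (e ▸ mem_branch_self _ _)
    refine h.leafArc_subset_side hc hca hcb ?_
    rw [h.leafArc_eq hc huv.symm, image_arc_symm huv]
    exact hz
  | @cons v w c e p ih =>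
    rw [Walk.cons_isPath_iff] at hp
    have hwu : w ≠ u := by
      rintro rfl
      simp at hu
    have hv : (N.site v).IsInner := by
      by_contra hv
      exact hwu (h.eq_of_adj hv _ _ e huv.symm)
    have hnot : ∀ x, ¬ (N.graph.pathBetween a b).Adj v x := fun x =>
      not_pathBetween_adj_of_branch h.isTree huv ha hb (mem_branch_self u v)
    have hbr := branch_subset h.isTree huv e hwu
    obtain ⟨T, hT, hTs, hT1, hT2, -⟩ := exists_isPreconnected_of_adj hle huv.symm e hv hnot
    change T ⊆ Ω \ N.pathSet a b at hTs
    have hw : N.arc v w (1 / 2) ∈ N.arc v w '' Ioo 0 1 := ⟨1 / 2, by norm_num, rfl⟩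
    rw [connectedComponentIn_eq (hT.subset_connectedComponentIn (hT1 (by rwa [image_arc_symm huv]))
      hTs (hT2 hw))]
    exact ih hc hp.1 hp.2 e (fun h1 => ha (hbr h1)) (fun h1 => hb (hbr h1)) hw

theorem leafArc_subset_of_mem_branch (h : N.IsTrivalentTree) (hc : ¬ (N.site c).IsInner) {u v : V}
    (huv : N.graph.Adj u v) (hcu : c ∈ N.graph.branch u v) (ha : a ∉ N.graph.branch u v)
    (hb : b ∉ N.graph.branch u v) {z : ℂ} (hz : z ∈ N.arc u v '' Ioo 0 1) :
    N.leafArc c ⊆ connectedComponentIn (Ω \ N.pathSet a b) z := by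
  classical
  obtain ⟨p, hp⟩ := Reachable.exists_isPath hcu
  refine h.leafArc_subset_of_walk hc (p.mapLe (deleteEdges_le _)) (hp.mapLe _) ?_ huv ha hb hz
  rw [Walk.support_mapLe_eq_support]
  intro hu
  exact IsAcyclic.notMem_branch h.isTree.2 huv ⟨p.takeUntil u hu⟩

/-- The part of the path from `a` to `c` off the path from `a` to `b` lies on the same side as the
last arc of the path. -/
theorem leafArc_subset_of_mem_pathSet (h : N.IsTrivalentTree) (ha : ¬ (N.site a).IsInner)
    (hc : ¬ (N.site c).IsInner) {z : ℂ} (hz : z ∈ N.pathSet a c) (hz' : z ∉ N.pathSet a b) :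
    N.leafArc c ⊆ connectedComponentIn (Ω \ N.pathSet a b) z := by
  have hle := pathBetween_le (G := N.graph) a b
  have key : ∀ u v, (N.graph.pathBetween a c).Adj u v → ¬ (N.graph.pathBetween a b).Adj u v →
      a ∉ N.graph.branch u v → c ∈ N.graph.branch u v ∧ b ∉ N.graph.branch u v := by
    intro u v h1 h2 h3
    constructor
    · rcases (pathBetween_adj_iff_branch h.isTree h1.1).1 h1 with h4 | h4
      exacts [absurd h4.1 h3, h4.2]
    · exact fun h4 => h2 ((pathBetween_adj_iff_branch h.isTree h1.1).2 (Or.inr ⟨h3, h4⟩))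
  obtain ⟨u, v, huv, hzu | hzu⟩ := hz
  · have hn : ¬ (N.graph.pathBetween a b).Adj u v := fun e => hz' ⟨u, v, e, Or.inl hzu⟩
    by_cases hau : a ∈ N.graph.branch u v
    · have hau' : a ∉ N.graph.branch v u := fun e => (mem_branch_swap h.isTree huv.1 a).1 e hau
      obtain ⟨h1, h2⟩ := key v u huv.symm (fun e => hn e.symm) hau'
      exact h.leafArc_subset_of_mem_branch hc huv.1.symm h1 hau' h2 (by rwa [image_arc_symm huv.1])
    · obtain ⟨h1, h2⟩ := key u v huv hn hau
      exact h.leafArc_subset_of_mem_branch hc huv.1 h1 hau h2 hzu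
  · have hui : (N.site u).IsInner := inner_iff.2 ⟨z, hzu⟩
    have hn : ∀ x, ¬ (N.graph.pathBetween a b).Adj u x := fun x e => hz' ⟨u, x, e, Or.inr hzu⟩
    have hua : u ≠ a := fun e => ha (e ▸ hui)
    obtain ⟨w, hw, haw⟩ : ∃ w, (N.graph.pathBetween a c).Adj u w ∧ a ∉ N.graph.branch u w := by
      by_cases hau : a ∈ N.graph.branch u v
      · obtain ⟨w, hwv, hw, -⟩ := exists_other_pathBetween_adj h.isTree huv hua
          (fun e => hc (e ▸ hui))
        refine ⟨w, hw, fun e => hwv ?_⟩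
        exact (existsUnique_branch h.isTree hua).unique ⟨hw.1, e⟩ ⟨huv.1, hau⟩
      · exact ⟨v, huv, hau⟩
    obtain ⟨h1, h2⟩ := key u w hw (hn w) haw
    obtain ⟨T, hT, hTs, hT1, -, hT3⟩ := exists_isPreconnected_of_adj hle hw.1 hw.1 hui hn
    change T ⊆ Ω \ N.pathSet a b at hTs
    have hm : N.arc u w (1 / 2) ∈ N.arc u w '' Ioo 0 1 := ⟨1 / 2, by norm_num, rfl⟩
    rw [connectedComponentIn_eq (hT.subset_connectedComponentIn (hT3 z hzu) hTs (hT1 hm))]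
    exact h.leafArc_subset_of_mem_branch hc hw.1 h1 haw h2 hm

/-- From a common point one could follow the path to `a` without meeting the path from `b` to `c`;
the arc of `a` would then lie on the side of `y`, but it lies on the side of `x`. -/
theorem disjoint_side_of_notMem (h : N.IsTrivalentTree) (ha : ¬ (N.site a).IsInner)
    (hb : ¬ (N.site b).IsInner) {x y z : ℂ}
    (hy : y ∉ connectedComponentIn (Ω \ N.pathSet b c) x) (hz : z ∈ N.leafArc a)
    (hzx : z ∈ connectedComponentIn (Ω \ N.pathSet b c) x) :
    Disjoint (connectedComponentIn (Ω \ N.pathSet b c) y) (N.pathSet a b) := by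
  rw [Set.disjoint_left]
  intro w hw hw'
  rw [pathSet_comm] at hw'
  have := h.leafArc_subset_of_mem_pathSet hb ha hw' (connectedComponentIn_subset _ _ hw).2 hz
  exact hy (mem_connectedComponentIn_trans hzx
    (mem_connectedComponentIn_symm (mem_connectedComponentIn_trans hw this)))

variable [Finite V]

theorem exists_mem_pathSet (h : N.IsTrivalentTree) (a : V) {z : ℂ} (hz : z ∈ N.carrier) :
    ∃ c, ¬ (N.site c).IsInner ∧ z ∈ N.pathSet a c := by
  rw [carrier_eq] at hz
  obtain ⟨u, v, huv, hz⟩ := hz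
  by_cases hau : a ∈ N.graph.branch u v
  · obtain ⟨c, hc, hc'⟩ := h.exists_mem_branch huv.symm
    exact ⟨c, hc', u, v, (pathBetween_adj_iff_branch h.isTree huv).2
      (Or.inl ⟨hau, (mem_branch_swap h.isTree huv c).1 hc⟩), hz⟩
  · obtain ⟨c, hc, hc'⟩ := h.exists_mem_branch huv
    exact ⟨c, hc', u, v, (pathBetween_adj_iff_branch h.isTree huv).2 (Or.inr ⟨hau, hc⟩), hz⟩

/-- Were `y` also across the path `ab`, its side of `ab` would be contained in its side of `bc`. The
arc of `a` borders the former, so it lies in the closure of the latter; yet it is neither in that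
side, being on the side of `x`, nor on the path `bc`. -/
theorem mem_side_of_notMem_side (h : N.IsTrivalentTree) (ha : ¬ (N.site a).IsInner)
    (hb : ¬ (N.site b).IsInner) (hc : ¬ (N.site c).IsInner) (hab : a ≠ b) (hac : a ≠ c)
    {x y za zc : ℂ} (hyΩ : y ∈ Ω \ N.pathSet b c)
    (hy : y ∉ connectedComponentIn (Ω \ N.pathSet b c) x) (hza : za ∈ N.leafArc a)
    (hzax : za ∈ connectedComponentIn (Ω \ N.pathSet b c) x) (hzc : zc ∈ N.leafArc c)
    (hzcx : zc ∈ connectedComponentIn (Ω \ N.pathSet a b) x) :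
    y ∈ connectedComponentIn (Ω \ N.pathSet a b) x := by
  by_contra hy'
  have d1 := h.disjoint_side_of_notMem ha hb hy hza hzax
  have hyab : y ∈ Ω \ N.pathSet a b :=
    ⟨hyΩ.1, d1.notMem_of_mem_left (mem_connectedComponentIn hyΩ)⟩
  have d2 : Disjoint (connectedComponentIn (Ω \ N.pathSet a b) y) (N.pathSet b c) := by
    rw [pathSet_comm b c, pathSet_comm a b]
    rw [pathSet_comm a b] at hy' hzcx
    exact h.disjoint_side_of_notMem hc hb hy' hzc hzcx
  have hsub : connectedComponentIn (Ω \ N.pathSet a b) y ⊆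
      connectedComponentIn (Ω \ N.pathSet b c) y :=
    isPreconnected_connectedComponentIn.subset_connectedComponentIn (mem_connectedComponentIn hyab)
      fun z hz => ⟨(connectedComponentIn_subset _ _ hz).1, d2.notMem_of_mem_left hz⟩
  have hza' : za ∉ connectedComponentIn (Ω \ N.pathSet b c) y := fun e =>
    hy (mem_connectedComponentIn_trans hzax (mem_connectedComponentIn_symm e))
  obtain ⟨v, hv, s, hs, rfl⟩ := hza
  have hcl := h.arc_mem_closure_side ha hb
    (pathBetween_adj_start h.isTree hab (h.eq_of_adj ha) hv) hs hyab
  have hle := pathBetween_le (G := N.graph) b c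
  have hso : IsOpen (Ω \ N.pathSet b c) := isOpen_diff_carrierOf h.isOpen hle
  have hfr : N.arc a v s ∈ frontier (connectedComponentIn (Ω \ N.pathSet b c) y) := by
    rw [hso.connectedComponentIn.frontier_eq]
    exact ⟨closure_mono hsub hcl, hza'⟩
  exact (h.disjoint_leafArc_pathSet ha hab hac).notMem_of_mem_left ⟨v, hv, s, hs, rfl⟩
    (frontier_connectedComponentIn_inter_subset (isClosed_carrierOf_union h.isOpen hle) y
      ⟨hfr, N.arc_mem _ _ hv hs⟩)

/-- A point off the tripod formed by three exterior vertices is separated from the first, second or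
third vertex by the path between the two others. -/
theorem not_mem_three_sides (h : N.IsTrivalentTree) (ha : ¬ (N.site a).IsInner)
    (hb : ¬ (N.site b).IsInner) (hc : ¬ (N.site c).IsInner) (hab : a ≠ b) (hac : a ≠ c)
    (hbc : b ≠ c) {x za zb zc : ℂ} (hx : x ∈ Ω \ N.carrier) (hza : za ∈ N.leafArc a)
    (hzax : za ∈ connectedComponentIn (Ω \ N.pathSet b c) x) (hzb : zb ∈ N.leafArc b)
    (hzbx : zb ∈ connectedComponentIn (Ω \ N.pathSet a c) x) (hzc : zc ∈ N.leafArc c)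
    (hzcx : zc ∈ connectedComponentIn (Ω \ N.pathSet a b) x) : False := by
  -- A point `y` across `bc` from `x` lies on the side of `x` both for `ab` and for `ac`. So `k`
  -- agrees at `a`, `b`, `c`, and not even the whole tripod separates `x` from `y`.
  obtain ⟨y, hyΩ, hy⟩ := h.exists_notMem_side hb hc hbc x
  have h1 := h.mem_side_of_notMem_side ha hb hc hab hac hyΩ hy hza hzax hzc hzcx
  have h2 : y ∈ connectedComponentIn (Ω \ N.pathSet a c) x := by
    rw [pathSet_comm b c] at hyΩ hy hzax
    exact h.mem_side_of_notMem_side ha hc hb hac hab hyΩ hy hza hzax hzb hzbx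
  have hle1 := pathBetween_le (G := N.graph) a b
  have hle2 := pathBetween_le (G := N.graph) a c
  have hle := sup_le hle1 hle2
  have hcar : N.carrierOf (N.graph.pathBetween a b ⊔ N.graph.pathBetween a c) =
      N.pathSet a b ∪ N.pathSet a c := carrierOf_sup N _ _
  have hxN : x ∉ N.carrierOf (N.graph.pathBetween a b ⊔ N.graph.pathBetween a c) := fun e =>
    hx.2 (by rw [carrier_eq]; exact carrierOf_mono N hle e)
  have hyN : y ∉ N.carrierOf (N.graph.pathBetween a b ⊔ N.graph.pathBetween a c) := by
    rw [hcar]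
    rintro (e | e)
    · exact (connectedComponentIn_subset _ _ h1).2 e
    · exact (connectedComponentIn_subset _ _ h2).2 e
  obtain ⟨ℓ, C, hsep⟩ := exists_isSeparator h.isOpen h.isSimplyConnected hx.1 hyΩ.1
  obtain ⟨g, k, hg, hk⟩ := exists_isArcLog_sepFun h.isOpen h.isTree hle hsep hxN hyN
  have hmono : ∀ {H'}, H' ≤ N.graph.pathBetween a b ⊔ N.graph.pathBetween a c →
      N.IsArcLog H' (sepFun x y ℓ) g k := fun hH' =>
    ⟨fun z hz => hg.exp_eq z (carrierOf_mono N hH' hz), hg.inner_eq,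
      fun u v huv => hg.isLogLift u v (hH' huv)⟩
  obtain ⟨p, -⟩ := h.isTree.exists_walk_pathBetween a b
  obtain ⟨q, -⟩ := h.isTree.exists_walk_pathBetween a c
  have e1 := (hmono le_sup_left).eq_of_mem_component h.isOpen hle1 hsep
    ⟨hx.1, fun e => hxN (hcar ▸ Or.inl e)⟩ h1 ha hb p
  have e2 := (hmono le_sup_right).eq_of_mem_component h.isOpen hle2 hsep
    ⟨hx.1, fun e => hxN (hcar ▸ Or.inr e)⟩ h2 ha hc q
  obtain ⟨va, hva, -⟩ := N.exists_adj a
  have hka := hk a va (Or.inl (pathBetween_adj_start h.isTree hab (h.eq_of_adj ha) hva)) ha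
  have := hg.mem_component h.isOpen hle hsep ⟨hx.1, hxN⟩ ⟨hyΩ.1, hyN⟩ hka (by
    rintro u v (huv | huv) hu
    · rcases h.exterior_on_path huv hu with rfl | rfl
      exacts [rfl, e1.symm]
    · rcases h.exterior_on_path huv hu with rfl | rfl
      exacts [rfl, e2.symm])
  exact hy (connectedComponentIn_mono x (sdiff_subset_sdiff_right
    (carrierOf_mono N (pathBetween_le_sup a b c))) this)

theorem exists_exterior_pair (h : N.IsTrivalentTree) :
    ∃ a b, a ≠ b ∧ ¬ (N.site a).IsInner ∧ ¬ (N.site b).IsInner := by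
  obtain ⟨u⟩ := h.isTree.1.nonempty
  obtain ⟨v, huv, -⟩ := N.exists_adj u
  obtain ⟨a, ha, ha'⟩ := h.exists_mem_branch huv
  obtain ⟨b, hb, hb'⟩ := h.exists_mem_branch huv.symm
  exact ⟨a, b, fun e => (mem_branch_swap h.isTree huv b).1 hb (e ▸ ha), ha', hb'⟩

/-- Every region is one side of a path between two exterior vertices. -/
theorem exists_side_disjoint (h : N.IsTrivalentTree) {x : ℂ} (hx : x ∈ Ω \ N.carrier) :
    ∃ a b, a ≠ b ∧ ¬ (N.site a).IsInner ∧ ¬ (N.site b).IsInner ∧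
      Disjoint (connectedComponentIn (Ω \ N.pathSet a b) x) N.carrier := by
  -- Induction on the number of exterior vertices whose arc meets the side of `x`. If that side
  -- meets the network, it contains the arc of some exterior vertex `c`, and one of `a`, `b` is
  -- replaced by `c`.
  have main : ∀ n a b, a ≠ b → ¬ (N.site a).IsInner → ¬ (N.site b).IsInner →
      {c | ¬ (N.site c).IsInner ∧
        (N.leafArc c ∩ connectedComponentIn (Ω \ N.pathSet a b) x).Nonempty}.ncard = n →
      ∃ a b, a ≠ b ∧ ¬ (N.site a).IsInner ∧ ¬ (N.site b).IsInner ∧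
        Disjoint (connectedComponentIn (Ω \ N.pathSet a b) x) N.carrier := by
    intro n
    induction n using Nat.strong_induction_on with
    | _ n ih =>
      intro a b hab ha hb hn
      by_cases hE : Disjoint (connectedComponentIn (Ω \ N.pathSet a b) x) N.carrier
      · exact ⟨a, b, hab, ha, hb, hE⟩
      obtain ⟨z, hz, hzN⟩ := Set.not_disjoint_iff.1 hE
      obtain ⟨c, hc, hzc⟩ := h.exists_mem_pathSet a hzN
      have hzab := (connectedComponentIn_subset _ _ hz).2
      have hcb : b ≠ c := by
        rintro rfl
        exact hzab hzc
      have hca : a ≠ c := by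
        rintro rfl
        obtain ⟨u, v, huv, -⟩ := hzc
        exact huv.2 (Reachable.refl _)
      obtain ⟨zc, hzc'⟩ := leafArc_nonempty (N := N) c
      have hzcx := mem_connectedComponentIn_trans hz
        (h.leafArc_subset_of_mem_pathSet ha hc hzc hzab hzc')
      have hxn : ∀ a b, x ∉ N.pathSet a b := fun a b e =>
        hx.2 (by rw [carrier_eq]; exact carrierOf_mono N (pathBetween_le a b) e)
      -- When the arc of the discarded vertex `b` is not on the new side of `x`, the new side does
      -- not meet the old path. So it is contained in the old side and no longer meets the arc of
      -- `c`. `not_mem_three_sides` guarantees that one of the two replacements is of this kind.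
      have step : ∀ a b, ¬ (N.site a).IsInner → ¬ (N.site b).IsInner →
          {c | ¬ (N.site c).IsInner ∧
            (N.leafArc c ∩ connectedComponentIn (Ω \ N.pathSet a b) x).Nonempty}.ncard = n → a ≠ c →
          zc ∈ connectedComponentIn (Ω \ N.pathSet a b) x →
          ¬ (N.leafArc b ∩ connectedComponentIn (Ω \ N.pathSet a c) x).Nonempty →
          ∃ a b, a ≠ b ∧ ¬ (N.site a).IsInner ∧ ¬ (N.site b).IsInner ∧
            Disjoint (connectedComponentIn (Ω \ N.pathSet a b) x) N.carrier := by
        intro a b ha hb hn hac hzcx hemp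
        have hsub : connectedComponentIn (Ω \ N.pathSet a c) x ⊆
            connectedComponentIn (Ω \ N.pathSet a b) x := by
          refine isPreconnected_connectedComponentIn.subset_connectedComponentIn
            (mem_connectedComponentIn ⟨hx.1, hxn a c⟩) fun w hw =>
              ⟨(connectedComponentIn_subset _ _ hw).1, fun hw' => hemp ?_⟩
          obtain ⟨zb, hzb⟩ := leafArc_nonempty (N := N) b
          exact ⟨zb, hzb, mem_connectedComponentIn_trans hw (h.leafArc_subset_of_mem_pathSet ha hb
            hw' (connectedComponentIn_subset _ _ hw).2 hzb)⟩
        refine ih _ ?_ a c hac ha hc rfl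
        rw [← hn]
        refine Set.ncard_lt_ncard ⟨fun d hd => ⟨hd.1, hd.2.mono (inter_subset_inter_right _ hsub)⟩,
          fun hcon => ?_⟩ (Set.toFinite _)
        obtain ⟨w, hw, hw'⟩ := (hcon (show c ∈ _ from ⟨hc, zc, hzc', hzcx⟩)).2
        refine (connectedComponentIn_subset _ _ hw').2 ?_
        rw [pathSet_comm]
        exact h.leafArc_subset_pathSet hc hac.symm hw
      by_cases h1 : (N.leafArc b ∩ connectedComponentIn (Ω \ N.pathSet a c) x).Nonempty
      · by_cases h2 : (N.leafArc a ∩ connectedComponentIn (Ω \ N.pathSet b c) x).Nonempty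
        · obtain ⟨zb, hzb, hzbx⟩ := h1
          obtain ⟨za, hza, hzax⟩ := h2
          exact (h.not_mem_three_sides ha hb hc hab hca hcb hx hza hzax hzb hzbx hzc' hzcx).elim
        · rw [pathSet_comm] at hn hzcx
          exact step b a hb ha hn hcb hzcx h2
      · exact step a b ha hb hn hca hzcx h1
  obtain ⟨a, b, hab, ha, hb⟩ := h.exists_exterior_pair
  exact main _ a b hab ha hb rfl

end IsTrivalentTree

end PlanarNetwork

/-! ### Regions as faces, and the existence and uniqueness of the coloring. -/

namespace PlanarNetwork

open SimpleGraph

variable {Ω : Set Plane} {V : Type*} {N : PlanarNetwork Ω V}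

theorem region_nonempty (R : N.Region) : R.1.Nonempty := by
  obtain ⟨_, x, hx, rfl⟩ := R
  exact ⟨x, mem_connectedComponentIn hx⟩

theorem region_subset (R : N.Region) : R.1 ⊆ Ω \ N.carrier := by
  obtain ⟨_, x, hx, rfl⟩ := R
  exact connectedComponentIn_subset _ _

theorem region_eq (R : N.Region) {x : ℂ} (hx : x ∈ R.1) :
    R.1 = connectedComponentIn (Ω \ N.carrier) x := by
  obtain ⟨_, y, hy, rfl⟩ := R
  exact connectedComponentIn_eq hx

theorem isPreconnected_region (R : N.Region) : IsPreconnected R.1 := by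
  obtain ⟨_, y, hy, rfl⟩ := R
  exact isPreconnected_connectedComponentIn

theorem region_ext {R S : N.Region} {x : ℂ} (hR : x ∈ R.1) (hS : x ∈ S.1) : R = S :=
  Subtype.ext ((region_eq R hR).trans (region_eq S hS).symm)

/-- The region that contains a given point. -/
def regionOf (N : PlanarNetwork Ω V) (x : ℂ) (hx : x ∈ Ω \ N.carrier) : N.Region :=
  ⟨connectedComponentIn (Ω \ N.carrier) x, x, hx, rfl⟩

theorem mem_regionOf {x : ℂ} (hx : x ∈ Ω \ N.carrier) : x ∈ (N.regionOf x hx).1 :=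
  mem_connectedComponentIn hx

theorem pathSet_subset_carrier (a b : V) : N.pathSet a b ⊆ N.carrier := by
  rw [carrier_eq]
  exact carrierOf_mono N (pathBetween_le a b)

theorem region_subset_diff_pathSet (R : N.Region) (a b : V) : R.1 ⊆ Ω \ N.pathSet a b :=
  (region_subset R).trans (sdiff_subset_sdiff_right (pathSet_subset_carrier a b))

/-- The region `R` is a side of the path between the exterior vertices `a` and `b`. -/
structure IsSide (N : PlanarNetwork Ω V) (R : N.Region) (a b : V) : Prop where
  ne : a ≠ b
  left : ¬ (N.site a).IsInner
  right : ¬ (N.site b).IsInner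
  eq : ∀ x ∈ R.1, R.1 = connectedComponentIn (Ω \ N.pathSet a b) x

theorem isSide_regionOf {x : ℂ} (hx : x ∈ Ω \ N.carrier) {a b : V} (hab : a ≠ b)
    (ha : ¬ (N.site a).IsInner) (hb : ¬ (N.site b).IsInner)
    (hd : Disjoint (connectedComponentIn (Ω \ N.pathSet a b) x) N.carrier) :
    N.IsSide (N.regionOf x hx) a b := by
  have e : (N.regionOf x hx).1 = connectedComponentIn (Ω \ N.pathSet a b) x := by
    refine Subset.antisymm (connectedComponentIn_mono x
      (sdiff_subset_sdiff_right (pathSet_subset_carrier a b))) ?_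
    exact isPreconnected_connectedComponentIn.subset_connectedComponentIn
      (mem_connectedComponentIn ⟨hx.1, fun e => hx.2 (pathSet_subset_carrier a b e)⟩)
      fun z hz => ⟨(connectedComponentIn_subset _ _ hz).1, hd.notMem_of_mem_left hz⟩
  refine ⟨hab, ha, hb, fun y hy => ?_⟩
  rw [e] at hy ⊢
  exact connectedComponentIn_eq hy

theorem IsArcLog.mono {H H' : SimpleGraph V} {f g : ℂ → ℂ} {k : V → ℂ} (h : N.IsArcLog H f g k)
    (hH : H' ≤ H) : N.IsArcLog H' f g k :=
  ⟨fun z hz => h.exp_eq z (carrierOf_mono N hH hz), h.inner_eq,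
    fun u v huv => h.isLogLift u v (hH huv)⟩

namespace IsTrivalentTree

variable [Finite V] {a b c : V}

theorem exists_isSide (h : N.IsTrivalentTree) (R : N.Region) : ∃ a b, N.IsSide R a b := by
  obtain ⟨x, hx⟩ := region_nonempty R
  have hx' := region_subset R hx
  obtain ⟨a, b, hab, ha, hb, hd⟩ := h.exists_side_disjoint hx'
  rw [region_ext hx (mem_regionOf hx')]
  exact ⟨a, b, isSide_regionOf hx' hab ha hb hd⟩

theorem mem_of_frontier (h : N.IsTrivalentTree) {R : N.Region} (hR : N.IsSide R a b) {z : ℂ}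
    (hz : z ∈ closure R.1) (hzN : z ∈ N.carrier) (hzΩ : z ∈ Ω) : z ∈ N.pathSet a b := by
  obtain ⟨x, hx⟩ := region_nonempty R
  have hle := pathBetween_le (G := N.graph) a b
  have hso : IsOpen (Ω \ N.pathSet a b) := isOpen_diff_carrierOf h.isOpen hle
  refine frontier_connectedComponentIn_inter_subset (isClosed_carrierOf_union h.isOpen hle) x
    ⟨?_, hzΩ⟩
  change z ∈ frontier (connectedComponentIn (Ω \ N.pathSet a b) x)
  rw [hso.connectedComponentIn.frontier_eq, ← hR.eq x hx]
  exact ⟨hz, fun e => (region_subset R e).2 hzN⟩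

/-- A region is a side of its path: the frontier of a side within `Ω` lies on the path, and
conversely each arc of the path lies in the frontier of each side. -/
theorem borders_iff (h : N.IsTrivalentTree) {R : N.Region} (hR : N.IsSide R a b) {u v : V}
    (huv : N.graph.Adj u v) : N.Borders R u v ↔ (N.graph.pathBetween a b).Adj u v := by
  obtain ⟨x, hx⟩ := region_nonempty R
  constructor
  · intro hB
    have h2 : (1 / 2 : ℝ) ∈ Ioo (0 : ℝ) 1 := by norm_num
    exact arc_adj_of_mem_carrierOf (pathBetween_le a b) huv h2 (h.mem_of_frontier hR
      (frontier_subset_closure (hB ⟨_, h2, rfl⟩)) (Or.inr ⟨u, v, huv, _, h2, rfl⟩)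
      (N.arc_mem _ _ huv h2))
  · intro hP
    rw [Borders, hR.eq x hx]
    exact h.arc_subset_frontier_side hR.left hR.right hP (region_subset_diff_pathSet R a b hx)

/-- A region is determined by the ends of its path and by whether it contains a fixed reference
point off the path, because the path has at most two sides. -/
theorem finite_region (h : N.IsTrivalentTree) : Finite N.Region := by
  classical
  choose a b hab using h.exists_isSide
  let pt : V → V → ℂ := fun a b =>
    if hn : (Ω \ N.pathSet a b).Nonempty then hn.choose else 0
  refine Finite.of_injective (fun R => (a R, b R, pt (a R) (b R) ∈ R.1)) ?_
  intro R S hRS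
  simp only [Prod.mk.injEq, eq_iff_iff] at hRS
  obtain ⟨e1, e2, e3⟩ := hRS
  rw [← e1, ← e2] at e3
  have hR := hab R
  have hS := hab S
  rw [← e1, ← e2] at hS
  obtain ⟨r, hr⟩ := region_nonempty R
  obtain ⟨s, hs⟩ := region_nonempty S
  have hr' := region_subset_diff_pathSet R (a R) (b R) hr
  have hs' := region_subset_diff_pathSet S (a R) (b R) hs
  have hpt : pt (a R) (b R) ∈ Ω \ N.pathSet (a R) (b R) := by
    have hn : (Ω \ N.pathSet (a R) (b R)).Nonempty := ⟨r, hr'⟩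
    simp only [pt, hn, dite_true]
    exact hn.choose_spec
  by_cases hp : pt (a R) (b R) ∈ R.1
  · exact region_ext hp (e3.1 hp)
  · rcases h.side_or hR.left hR.right hR.ne hpt hr' hs' with h1 | h1 | h1
    · refine absurd ?_ hp
      rw [hR.eq r hr]
      exact mem_connectedComponentIn_symm h1
    · refine absurd (e3.2 ?_) hp
      rw [hS.eq s hs]
      exact mem_connectedComponentIn_symm h1
    · rw [← hR.eq r hr] at h1
      exact region_ext h1 hs

/-- On both sides of a path between exterior vertices there is a region that borders a given arc of
the path. -/
theorem exists_region_borders (h : N.IsTrivalentTree) (ha : ¬ (N.site a).IsInner)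
    (hb : ¬ (N.site b).IsInner) {u v : V} (huv : (N.graph.pathBetween a b).Adj u v) {x : ℂ}
    (hx : x ∈ Ω \ N.pathSet a b) :
    ∃ R : N.Region, R.1 ⊆ connectedComponentIn (Ω \ N.pathSet a b) x ∧ N.Borders R u v := by
  set S := connectedComponentIn (Ω \ N.pathSet a b) x with hS
  have h2 : (1 / 2 : ℝ) ∈ Ioo (0 : ℝ) 1 := by norm_num
  -- Removing all other arcs leaves an open neighbourhood of the midpoint of `uv`, in which points
  -- of `S` lie in regions contained in `S`.
  have hle : N.graph.deleteEdges {s(u, v)} ≤ N.graph := deleteEdges_le _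
  have hO := isOpen_diff_carrierOf h.isOpen hle
  have hzO : N.arc u v (1 / 2) ∈ Ω \ N.carrierOf (N.graph.deleteEdges {s(u, v)}) := by
    refine ⟨N.arc_mem _ _ huv.1 h2, fun e => ?_⟩
    have := arc_adj_of_mem_carrierOf hle huv.1 h2 e
    rw [deleteEdges_adj] at this
    exact this.2 rfl
  have hcl := hO.inter_closure ⟨hzO, h.arc_mem_closure_side ha hb huv h2 hx⟩
  have hsub : (Ω \ N.carrierOf (N.graph.deleteEdges {s(u, v)})) ∩ S ⊆
      ⋃ R : {R : N.Region // R.1 ⊆ S}, R.1.1 := by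
    rintro z ⟨hz, hzS⟩
    have hzN : z ∈ Ω \ N.carrier := by
      refine ⟨hz.1, fun e => ?_⟩
      rw [carrier_eq] at e
      obtain ⟨u', v', h', hz'⟩ := e
      by_cases hE : s(u', v') = s(u, v)
      · refine (connectedComponentIn_subset _ _ hzS).2 ⟨u', v', ?_, hz'⟩
        rcases Sym2.eq_iff.1 hE with ⟨rfl, rfl⟩ | ⟨rfl, rfl⟩
        exacts [huv, huv.symm]
      · exact hz.2 ⟨u', v', by rw [deleteEdges_adj]; exact ⟨h', hE⟩, hz'⟩
    refine mem_iUnion.2 ⟨⟨N.regionOf z hzN, ?_⟩, mem_regionOf hzN⟩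
    rw [hS, connectedComponentIn_eq hzS]
    exact connectedComponentIn_mono z (sdiff_subset_sdiff_right (pathSet_subset_carrier a b))
  -- Finiteness lets the closure pass inside the union, so a single region accumulates at the
  -- midpoint.
  have := h.finite_region
  have hcl' := closure_mono hsub hcl
  rw [closure_iUnion_of_finite, mem_iUnion] at hcl'
  obtain ⟨⟨R, hRS⟩, hz⟩ := hcl'
  obtain ⟨i, j, hij⟩ := h.exists_isSide R
  refine ⟨R, hRS, (h.borders_iff hij huv.1).2 ?_⟩
  exact arc_adj_of_mem_carrierOf (pathBetween_le i j) huv.1 h2 (h.mem_of_frontier hij hz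
    (Or.inr ⟨u, v, huv.1, _, h2, rfl⟩) (N.arc_mem _ _ huv.1 h2))

/-- Regions on the same side of a path between exterior vertices that border the same arc of the path
are equal. -/
theorem eq_of_borders (h : N.IsTrivalentTree) (ha : ¬ (N.site a).IsInner)
    (hb : ¬ (N.site b).IsInner) {u v : V} (huv : (N.graph.pathBetween a b).Adj u v)
    {R S : N.Region} {r s : ℂ} (hr : r ∈ R.1) (hs : s ∈ S.1)
    (hrs : s ∈ connectedComponentIn (Ω \ N.pathSet a b) r) (hR : N.Borders R u v)
    (hS : N.Borders S u v) : R = S := by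
  have hrN := region_subset R hr
  have hsN := region_subset S hs
  have hrN' := hrN
  have hsN' := hsN
  rw [carrier_eq] at hrN' hsN'
  obtain ⟨ℓ, C, hsep⟩ := exists_isSeparator h.isOpen h.isSimplyConnected hrN.1 hsN.1
  obtain ⟨g, k, hg, hk⟩ := exists_isArcLog_sepFun h.isOpen h.isTree le_rfl hsep hrN'.2 hsN'.2
  have key : ∀ c d, ¬ (N.site c).IsInner → ¬ (N.site d).IsInner →
      s ∈ connectedComponentIn (Ω \ N.pathSet c d) r → k c = k d := by
    intro c d hc hd hcd
    obtain ⟨p, -⟩ := h.isTree.exists_walk_pathBetween c d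
    exact (hg.mono (pathBetween_le c d)).eq_of_mem_component h.isOpen (pathBetween_le c d) hsep
      (region_subset_diff_pathSet R c d hr) hcd hc hd p
  -- If the path from `c` to `d` does not use `uv`, the two regions are joined across the arc `uv`
  -- in its complement.
  have key' : ∀ c d, ¬ (N.site c).IsInner → ¬ (N.site d).IsInner →
      ¬ (N.graph.pathBetween c d).Adj u v → k c = k d := by
    intro c d hc hd hcd
    refine key c d hc hd ?_
    have hJ : N.arc u v '' Ioo 0 1 ⊆ Ω \ N.pathSet c d := by
      rintro _ ⟨t, ht, rfl⟩
      exact ⟨N.arc_mem _ _ huv.1 ht, fun e =>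
        hcd (arc_adj_of_mem_carrierOf (pathBetween_le c d) huv.1 ht e)⟩
    have hz : N.arc u v (1 / 2) ∈ N.arc u v '' Ioo 0 1 := ⟨_, by norm_num, rfl⟩
    have hcon : ∀ Q : N.Region, N.Borders Q u v → ∀ q ∈ Q.1,
        N.arc u v (1 / 2) ∈ connectedComponentIn (Ω \ N.pathSet c d) q := by
      intro Q hQ q hq
      exact ((isPreconnected_region Q).subset_closure subset_union_left (union_subset subset_closure
        (hQ.trans frontier_subset_closure))).subset_connectedComponentIn (Or.inl hq)
        (union_subset (region_subset_diff_pathSet Q c d) hJ) (Or.inr hz)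
    exact mem_connectedComponentIn_trans (hcon R hR r hr)
      (mem_connectedComponentIn_symm (hcon S hS s hs))
  have hkab := key a b ha hb hrs
  -- Since `uv` lies between `a` and `b`, it is missing from the path from `c` to `a` or from the
  -- one to `b`.
  have hall : ∀ c, ¬ (N.site c).IsInner → k c = k a := by
    intro c hc
    by_cases h1 : (N.graph.pathBetween c a).Adj u v
    · rw [hkab]
      refine key' c b hc hb fun h2 => ?_
      rw [pathBetween_adj_iff_branch h.isTree huv.1] at h1 h2 huv
      tauto
    · exact key' c a hc ha h1
  obtain ⟨va, hva, -⟩ := N.exists_adj a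
  have := hg.mem_component h.isOpen le_rfl hsep hrN' hsN' (hk a va hva ha)
    fun u v _ hu => hall u hu
  rw [← carrier_eq, ← region_eq R hr] at this
  exact region_ext this hs

/-- Exterior vertices chosen in both branches at `uv` put this edge on a path with two sides. Each
side contains a region along the arc, and `eq_of_borders` leaves room for no other. -/
theorem exists_two_borders (h : N.IsTrivalentTree) {u v : V} (huv : N.graph.Adj u v) :
    ∃ R S : N.Region, R ≠ S ∧ ∀ Q : N.Region, N.Borders Q u v ↔ Q = R ∨ Q = S := by
  obtain ⟨a, ha, ha'⟩ := h.exists_mem_branch huv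
  obtain ⟨b, hb, hb'⟩ := h.exists_mem_branch huv.symm
  rw [mem_branch_swap h.isTree huv] at hb
  have hP : (N.graph.pathBetween a b).Adj u v :=
    (pathBetween_adj_iff_branch h.isTree huv).2 (Or.inl ⟨ha, hb⟩)
  have hab : a ≠ b := fun e => hb (e ▸ ha)
  -- The point `0` is arbitrary; only some point off the path is wanted.
  obtain ⟨x, hx, -⟩ := h.exists_notMem_side ha' hb' hab 0
  obtain ⟨y, hy, hxy⟩ := h.exists_notMem_side ha' hb' hab x
  obtain ⟨R, hR, hRB⟩ := h.exists_region_borders ha' hb' hP hx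
  obtain ⟨S, hS, hSB⟩ := h.exists_region_borders ha' hb' hP hy
  obtain ⟨r, hr⟩ := region_nonempty R
  obtain ⟨s, hs⟩ := region_nonempty S
  refine ⟨R, S, ?_, fun Q => ⟨fun hQ => ?_, ?_⟩⟩
  · rintro rfl
    exact hxy (mem_connectedComponentIn_trans (hR hr) (mem_connectedComponentIn_symm (hS hr)))
  · obtain ⟨q, hq⟩ := region_nonempty Q
    rcases h.side_or ha' hb' hab hx hy (region_subset_diff_pathSet Q a b hq) with h1 | h1 | h1
    · exact absurd h1 hxy
    · exact Or.inl (h.eq_of_borders ha' hb' hP hq hr (mem_connectedComponentIn_trans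
        (mem_connectedComponentIn_symm h1) (hR hr)) hQ hRB)
    · exact Or.inr (h.eq_of_borders ha' hb' hP hq hs (mem_connectedComponentIn_trans
        (mem_connectedComponentIn_symm h1) (hS hs)) hQ hSB)
  · rintro (rfl | rfl)
    exacts [hRB, hSB]

theorem isFaceSystem (h : N.IsTrivalentTree) :
    N.graph.IsFaceSystem fun (R : N.Region) u v => N.Borders R u v where
  exists_two u v huv := h.exists_two_borders huv
  exists_path R := by
    obtain ⟨a, b, hab⟩ := h.exists_isSide R
    exact ⟨a, b, hab.ne, h.eq_of_adj hab.left, h.eq_of_adj hab.right,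
      fun u v huv => h.borders_iff hab huv⟩
  valence v := by
    by_cases hv : (N.site v).IsInner
    · right
      obtain ⟨x, y, z, hxy, hxz, hyz, e⟩ := Set.ncard_eq_three.1 (h.trivalent v hv)
      refine ⟨![x, y, z], ?_, fun w => ?_⟩
      · intro i j hij
        fin_cases i <;> fin_cases j <;> simp_all
      · rw [← mem_neighborSet, e]
        simp [Fin.exists_fin_succ, eq_comm]
    · left
      obtain ⟨w, hw⟩ := Set.ncard_eq_one.1 (h.simple v hv)
      refine ⟨w, fun x => ?_⟩
      rw [← mem_neighborSet, hw, mem_singleton_iff]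

end IsTrivalentTree

theorem isThreeColoring_iff (c : N.Region → Fin 3) :
    N.IsThreeColoring c ↔
      ∀ f g u v, f ≠ g → N.graph.Adj u v → N.Borders f u v → N.Borders g u v → c f ≠ c g :=
  ⟨fun h f g u v hfg huv hf hg => h f g ⟨hfg, u, v, huv, hf, hg⟩,
    fun h f g ⟨hfg, u, v, huv, hf, hg⟩ => h f g u v hfg huv hf hg⟩

theorem IsTrivalentTree.exists_isThreeColoring [Finite V] (h : N.IsTrivalentTree) :
    ∃ c : N.Region → Fin 3, N.IsThreeColoring c ∧ ∀ c' : N.Region → Fin 3, N.IsThreeColoring c' →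
      ∃ π : Equiv.Perm (Fin 3), c' = π ∘ c := by
  obtain ⟨c, hc⟩ := h.isFaceSystem.exists_coloring h.isTree
  refine ⟨c, (isThreeColoring_iff c).2 hc, fun c' hc' => ?_⟩
  exact h.isFaceSystem.coloring_unique h.isTree hc ((isThreeColoring_iff c').1 hc')

end PlanarNetwork

/-! ### Change of the logarithm along a moving path. -/

theorem SimpleGraph.Iso.pathBetween_adj_iff {V W : Type*} {G : SimpleGraph V} {G' : SimpleGraph W}
    (φ : G ≃g G') (hG : G.IsTree) (hG' : G'.IsTree) (a b u v : V) :
    (G'.pathBetween (φ a) (φ b)).Adj (φ u) (φ v) ↔ (G.pathBetween a b).Adj u v := by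
  classical
  obtain ⟨p, hp⟩ := hG.1.exists_isPath a b
  have hp' : (p.map φ.toHom).IsPath := hp.map φ.injective
  have e1 := mem_edges_iff_pathBetween_adj hG.2 hp (u := u) (v := v)
  have e2 := mem_edges_iff_pathBetween_adj hG'.2 hp' (u := φ u) (v := φ v)
  refine e2.symm.trans (Iff.trans ?_ e1)
  rw [Walk.edges_map]
  have : s(φ u, φ v) = Sym2.map φ.toHom s(u, v) := rfl
  rw [this]
  exact List.mem_map_of_injective (Sym2.map.injective φ.injective)

namespace PlanarNetwork

variable {Ω : Set Plane} {V W : Type*} {N : PlanarNetwork Ω V} {N' : PlanarNetwork Ω W}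

/-- Telescoping. The homomorphism lets a walk in the first graph index arcs of the second network,
so that the two ends of a homotopy can be compared term by term. -/
theorem IsArcLog.sum_logChange_map {H : SimpleGraph V} {H' : SimpleGraph W} (φ : H →g H')
    {f g : ℂ → ℂ} {k : W → ℂ} (h : N'.IsArcLog H' f g k) {u v : V} (p : H.Walk u v) :
    (p.darts.map fun d => logChange fun s => f (N'.arc (φ d.fst) (φ d.snd) s)).sum =
      k (φ v) - k (φ u) := by
  induction p with
  | nil => simp
  | cons e p ih =>
    simp only [SimpleGraph.Walk.darts_cons, List.map_cons, List.sum_cons, ih]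
    rw [(h.isLogLift _ _ (φ.map_adj e)).logChange_eq]
    ring

theorem IsTrivalentTree.of_homotopy (hN : N.IsTrivalentTree) (h : NetworkHomotopy N N') :
    N'.IsTrivalentTree where
  isOpen := hN.isOpen
  isSimplyConnected := hN.isSimplyConnected
  isTree := h.iso.isTree_iff.1 hN.isTree
  trivalent v hv := by
    obtain ⟨u, rfl⟩ := h.iso.surjective v
    rw [← hN.trivalent u ((h.isInner_iff u).1 hv), ← Set.ncard_image_of_injective _ h.iso.injective]
    congr 1
    ext w
    obtain ⟨w, rfl⟩ := h.iso.surjective w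
    simpa using h.iso.map_adj_iff
  simple v hv := by
    obtain ⟨u, rfl⟩ := h.iso.surjective v
    rw [← hN.simple u (fun e => hv ((h.isInner_iff u).2 e)),
      ← Set.ncard_image_of_injective _ h.iso.injective]
    congr 1
    ext w
    obtain ⟨w, rfl⟩ := h.iso.surjective w
    simpa using h.iso.map_adj_iff

end PlanarNetwork

namespace NetworkHomotopy

open PlanarNetwork
open SimpleGraph (pathBetween_le)

variable {Ω : Set Plane} {V W : Type*} {N : PlanarNetwork Ω V} {N' : PlanarNetwork Ω W}
  (h : NetworkHomotopy N N')

/-- The moving arcs and vertices of the subgraph `H` never hit the point `x`. -/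
def Avoids (H : SimpleGraph V) (x : Plane) : Prop :=
  ∀ t ∈ Icc (0 : ℝ) 1, ∀ u v, H.Adj u v →
    (∀ s ∈ Ioo (0 : ℝ) 1, h.arc u v t s ≠ x) ∧ ((N.site u).IsInner → h.vertex u t 0 ≠ x)

variable {h}

theorem avoids_of_notMem_sweptSet {H : SimpleGraph V} (hH : H ≤ N.graph) {x : Plane}
    (hx : x ∉ h.sweptSet) : h.Avoids H x := by
  intro t ht u v huv
  refine ⟨fun s hs e => hx ⟨t, ht, Or.inr ⟨u, v, hH huv, s, hs, e.symm⟩⟩, fun hu e => hx ?_⟩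
  exact ⟨t, ht, Or.inl ⟨u, hu, e.symm⟩⟩

theorem Avoids.notMem_carrierOf {H : SimpleGraph V} (hH : H ≤ N.graph) {x : Plane}
    (hx : h.Avoids H x) : x ∉ N.carrierOf H := by
  rintro ⟨u, v, huv, ⟨s, hs, e⟩ | hu⟩
  · exact (hx 0 (by simp) u v huv).1 s hs (by rw [h.arc_zero u v (hH huv) s hs, e])
  · refine (hx 0 (by simp) u v huv).2 (inner_iff.2 ⟨x, hu⟩) ?_
    rw [h.vertex_zero, hu]
    rfl

theorem Avoids.notMem_pathSet (hN : N.IsTrivalentTree) {a b : V} {x : Plane}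
    (hx : h.Avoids (N.graph.pathBetween a b) x) : x ∉ N'.pathSet (h.iso a) (h.iso b) := by
  have hN' := hN.of_homotopy h
  rintro ⟨u, v, huv, hz⟩
  obtain ⟨u, rfl⟩ := h.iso.surjective u
  obtain ⟨v, rfl⟩ := h.iso.surjective v
  rw [h.iso.pathBetween_adj_iff hN.isTree hN'.isTree] at huv
  rcases hz with ⟨s, hs, e⟩ | hu
  · exact (hx 1 (by simp) u v huv).1 s hs (by rw [h.arc_one u v huv.1 s hs, e])
  · refine (hx 1 (by simp) u v huv).2 ((h.isInner_iff u).1 (inner_iff.2 ⟨x, hu⟩)) ?_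
    rw [h.vertex_one, hu]
    rfl

theorem eventually_dist_lt {u v : V} (huv : N.graph.Adj u v) {ε : ℝ} (hε : 0 < ε) :
    ∀ᶠ s in 𝓝[>] (0 : ℝ), ∀ t ∈ Icc (0 : ℝ) 1, dist (h.arc u v t s) (h.vertex u t s) < ε := by
  filter_upwards [Metric.tendstoUniformlyOn_iff.1 (h.arc_end u v huv) ε hε] with s hs t ht
  have := hs t ht
  rwa [dist_comm, Real.dist_0_eq_abs, abs_of_nonneg dist_nonneg] at this

/-- The moving arcs leave every compact subset of `Ω` at exterior vertices, uniformly in time. -/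
theorem eventually_notMem (hΩ : IsOpen Ω) {u v : V} (huv : N.graph.Adj u v)
    (hu : ¬ (N.site u).IsInner) {C : Set Plane} (hC : IsCompact C) (hCΩ : C ⊆ Ω) :
    ∀ᶠ s in 𝓝[>] (0 : ℝ), ∀ t ∈ Icc (0 : ℝ) 1, h.arc u v t s ∉ C := by
  have hv := N.site_valid u
  have ht := h.vertex_exterior u hu
  cases hsu : N.site u with
  | inner p => exact absurd (inner_iff.2 ⟨p, hsu⟩) hu
  | boundary p =>
    rw [hsu] at hv ht
    have hp : p ∉ C := fun e => by
      have h1 : p ∈ frontier Ω := hv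
      rw [hΩ.frontier_eq] at h1
      exact h1.2 (hCΩ e)
    obtain ⟨ε, hε, hb⟩ := Metric.isOpen_iff.1 hC.isClosed.isOpen_compl p hp
    filter_upwards [eventually_dist_lt (h := h) huv hε] with s hs t ht'
    have := hs t ht'
    rw [ht] at this
    exact hb this
  | infinity σ =>
    rw [hsu] at hv ht
    obtain ⟨R, hR⟩ := hC.isBounded.exists_norm_le
    filter_upwards [eventually_dist_lt (h := h) huv one_pos, hv.2.eventually_gt_atTop (R + 1)]
      with s hs hσ t ht' hmem
    have h1 := hs t ht'
    rw [ht, dist_comm, dist_eq_norm] at h1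
    change ‖σ s - h.arc u v t s‖ < 1 at h1
    have h2 := norm_sub_norm_le (σ s) (h.arc u v t s)
    linarith [hR _ hmem]

theorem continuousWithinAt_arc {u v : V} (huv : N.graph.Adj u v) {t s : ℝ}
    (ht : t ∈ Icc (0 : ℝ) 1) (hs : s ∈ Ioo (0 : ℝ) 1) :
    Tendsto (fun q : ℝ × ℝ => h.arc u v q.1 q.2) (𝓝[Icc 0 1 ×ˢ Icc 0 1] (t, s))
      (𝓝 (h.arc u v t s)) := by
  refine (h.arc_continuous u v huv (t, s) ⟨ht, hs⟩).mono_left ?_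
  refine le_inf (inf_le_left) (le_principal_iff.2 ?_)
  rw [nhdsWithin_prod_eq]
  exact prod_mem_prod self_mem_nhdsWithin (mem_nhdsWithin_of_mem_nhds (Ioo_mem_nhds hs.1 hs.2))

/-- The moving arc with its first end added, if that is an interior vertex. -/
noncomputable def closedArc (h : NetworkHomotopy N N') (u v : V) (q : ℝ × ℝ) : Plane :=
  if q.2 ≤ 0 then h.vertex u q.1 0 else h.arc u v q.1 q.2

theorem tendsto_closedArc {u v : V} (huv : N.graph.Adj u v) (hu : (N.site u).IsInner) {t : ℝ}
    (ht : t ∈ Icc (0 : ℝ) 1) :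
    Tendsto (h.closedArc u v) (𝓝[Icc 0 1 ×ˢ Icc 0 1] (t, 0)) (𝓝 (h.vertex u t 0)) := by
  have hfst : Tendsto (fun q : ℝ × ℝ => h.vertex u q.1 0) (𝓝[Icc 0 1 ×ˢ Icc 0 1] (t, 0))
      (𝓝 (h.vertex u t 0)) := by
    refine Tendsto.comp (h.vertex_continuous u 0 t ht) ?_
    rw [nhdsWithin_prod_eq]
    exact tendsto_fst
  refine tendsto_of_tendsto_of_dist hfst ?_
  rw [Metric.tendsto_nhds]
  intro ε hε
  obtain ⟨δ, hδ, hd⟩ := mem_nhdsGT_iff_exists_Ioo_subset.1 (eventually_dist_lt (h := h) huv hε)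
  have h1 : ∀ᶠ q : ℝ × ℝ in 𝓝[Icc 0 1 ×ˢ Icc 0 1] (t, 0), q.2 < δ :=
    mem_nhdsWithin_of_mem_nhds (continuous_snd.continuousAt.eventually (gt_mem_nhds hδ))
  filter_upwards [h1, self_mem_nhdsWithin] with q hq hq'
  rw [Real.dist_0_eq_abs, abs_of_nonneg dist_nonneg, closedArc]
  split_ifs with h0
  · rwa [dist_self]
  · rw [dist_comm, h.vertex_inner u hu q.1 0 q.2]
    exact hd ⟨not_le.1 h0, hq⟩ q.1 hq'.1

theorem continuousOn_closedArc {u v : V} (huv : N.graph.Adj u v) (hu : (N.site u).IsInner) :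
    ContinuousOn (h.closedArc u v) (Icc 0 1 ×ˢ Ico 0 1) := by
  rintro ⟨t, s⟩ ⟨ht, hs⟩
  have hmono : Icc (0 : ℝ) 1 ×ˢ Ico (0 : ℝ) 1 ⊆ Icc 0 1 ×ˢ Icc 0 1 :=
    prod_mono_right Ico_subset_Icc_self
  rcases eq_or_lt_of_le hs.1 with h0 | h0
  · change 0 = s at h0
    subst h0
    have := tendsto_closedArc (h := h) huv hu ht
    rw [ContinuousWithinAt]
    simp only [closedArc, le_refl, if_true] at this ⊢
    exact this.mono_left (nhdsWithin_mono _ hmono)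
  · change 0 < s at h0
    have := continuousWithinAt_arc (h := h) huv ht (s := s) ⟨h0, hs.2⟩
    have e : h.closedArc u v (t, s) = h.arc u v t s := if_neg (not_le.2 h0)
    rw [ContinuousWithinAt, e]
    refine (this.mono_left (nhdsWithin_mono _ hmono)).congr' ?_
    have h1 : ∀ᶠ q : ℝ × ℝ in 𝓝[Icc 0 1 ×ˢ Ico 0 1] (t, s), 0 < q.2 :=
      mem_nhdsWithin_of_mem_nhds (continuous_snd.continuousAt.eventually (lt_mem_nhds h0))
    filter_upwards [h1] with q hq
    exact (if_neg (not_le.2 hq)).symm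

open Classical in
/-- The value of `f` at a moving interior vertex, and `1` at an exterior vertex. -/
noncomputable def vertexValue (h : NetworkHomotopy N N') (f : ℂ → ℂ) (u : V) (t : ℝ) : ℂ :=
  if (N.site u).IsInner then f (h.vertex u t 0) else 1

/-- The values of `f` along a moving arc, extended to both ends. -/
noncomputable def arcValue (h : NetworkHomotopy N N') (f : ℂ → ℂ) (u v : V) (q : ℝ × ℝ) : ℂ :=
  if q.2 ≤ 0 then h.vertexValue f u q.1 else if 1 ≤ q.2 then h.vertexValue f v q.1
    else f (h.arc u v q.1 q.2)

theorem arcValue_symm {u v : V} (huv : N.graph.Adj u v) {f : ℂ → ℂ} {q : ℝ × ℝ}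
    (hq : q ∈ Icc (0 : ℝ) 1 ×ˢ Icc (0 : ℝ) 1) :
    h.arcValue f v u (q.1, 1 - q.2) = h.arcValue f u v q := by
  simp only [arcValue, tsub_le_iff_right, zero_add]
  have e1 : (1 : ℝ) ≤ 1 - q.2 ↔ q.2 ≤ 0 := ⟨fun h => by linarith, fun h => by linarith⟩
  simp only [e1]
  by_cases h0 : q.2 ≤ 0
  · have : ¬ (1 : ℝ) ≤ q.2 := by linarith
    rw [if_neg this, if_pos h0, if_pos h0]
  · by_cases h1 : (1 : ℝ) ≤ q.2
    · rw [if_pos h1, if_neg h0, if_pos h1]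
    · rw [if_neg h1, if_neg h0, if_neg h0, if_neg h1, h.arc_symm v u huv.symm q.1 hq.1
        (q.2) ⟨not_le.1 h0, not_le.1 h1⟩]

variable {x y : ℂ} {ℓ : ℂ → ℂ} {C : Set ℂ} {H : SimpleGraph V}

/-- At an interior end the closed moving arc is continuous. At an exterior end the separator equals
`1` off a compact subset of `Ω`, which the moving arc leaves uniformly in time. Only the pole `y`
has to be avoided here. -/
theorem continuousWithinAt_arcValue (hΩ : IsOpen Ω) (hH : H ≤ N.graph)
    (hs : IsSeparator Ω x y ℓ C) (hy : h.Avoids H y) {u v : V} (huv : H.Adj u v) {t s : ℝ}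
    (ht : t ∈ Icc (0 : ℝ) 1) (hs0 : 0 ≤ s) (hs1 : s < 1) :
    ContinuousWithinAt (h.arcValue (sepFun x y ℓ) u v) (Icc 0 1 ×ˢ Icc 0 1) (t, s) := by
  have hlt : ∀ᶠ q : ℝ × ℝ in 𝓝[Icc 0 1 ×ˢ Icc 0 1] (t, s), q.2 < 1 :=
    mem_nhdsWithin_of_mem_nhds (continuous_snd.continuousAt.eventually (gt_mem_nhds hs1))
  rw [ContinuousWithinAt]
  rcases eq_or_lt_of_le hs0 with h0 | h0
  · subst h0
    have e : h.arcValue (sepFun x y ℓ) u v (t, 0) = h.vertexValue (sepFun x y ℓ) u t := by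
      simp [arcValue]
    rw [e]
    by_cases hu : (N.site u).IsInner
    · simp only [vertexValue, hu, if_true]
      refine Tendsto.congr' ?_ ((hs.continuousAt ((hy t ht u v huv).2 hu)).tendsto.comp
        (tendsto_closedArc (h := h) (hH huv) hu ht))
      filter_upwards [hlt] with q hq
      simp only [Function.comp, closedArc, arcValue, vertexValue, hu, if_true, not_le.2 hq, if_false]
      split_ifs <;> rfl
    · simp only [vertexValue, hu, if_false]
      obtain ⟨δ, hδ, hd⟩ := mem_nhdsGT_iff_exists_Ioo_subset.1
        (eventually_notMem (h := h) hΩ (hH huv) hu hs.isCompact hs.subset)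
      have h1 : ∀ᶠ q : ℝ × ℝ in 𝓝[Icc 0 1 ×ˢ Icc 0 1] (t, 0), q.2 < δ :=
        mem_nhdsWithin_of_mem_nhds (continuous_snd.continuousAt.eventually (gt_mem_nhds hδ))
      refine tendsto_const_nhds.congr' ?_
      filter_upwards [hlt, h1, self_mem_nhdsWithin] with q hq hq1 hq'
      simp only [arcValue, vertexValue, hu, if_false, not_le.2 hq]
      split_ifs with h3
      · rfl
      · exact (hs.eq_one (hd ⟨not_le.1 h3, hq1⟩ q.1 hq'.1)).symm
  · have e : h.arcValue (sepFun x y ℓ) u v (t, s) = sepFun x y ℓ (h.arc u v t s) := by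
      simp [arcValue, not_le.2 h0, not_le.2 hs1]
    rw [e]
    refine Tendsto.congr' ?_ ((hs.continuousAt ((hy t ht u v huv).1 s ⟨h0, hs1⟩)).tendsto.comp
      (continuousWithinAt_arc (h := h) (hH huv) ht ⟨h0, hs1⟩))
    have h1 : ∀ᶠ q : ℝ × ℝ in 𝓝[Icc 0 1 ×ˢ Icc 0 1] (t, s), 0 < q.2 :=
      mem_nhdsWithin_of_mem_nhds (continuous_snd.continuousAt.eventually (lt_mem_nhds h0))
    filter_upwards [hlt, h1] with q hq hq1
    simp [arcValue, not_le.2 hq, not_le.2 hq1]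

theorem continuousOn_arcValue (hΩ : IsOpen Ω) (hH : H ≤ N.graph) (hs : IsSeparator Ω x y ℓ C)
    (hy : h.Avoids H y) {u v : V} (huv : H.Adj u v) :
    ContinuousOn (h.arcValue (sepFun x y ℓ) u v) (Icc 0 1 ×ˢ Icc 0 1) := by
  rintro ⟨t, s⟩ ⟨ht, hs'⟩
  rcases lt_or_eq_of_le hs'.2 with h1 | h1
  · exact continuousWithinAt_arcValue hΩ hH hs hy huv ht hs'.1 h1
  · change s = 1 at h1
    subst h1
    have h2 := continuousWithinAt_arcValue hΩ hH hs hy huv.symm ht le_rfl one_pos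
    have h3 : ContinuousWithinAt (fun q : ℝ × ℝ => (q.1, 1 - q.2)) (Icc 0 1 ×ˢ Icc 0 1) (t, 1) := by
      fun_prop
    refine (h2.comp_of_eq h3 ?_ (by simp)).congr ?_ ?_
    · rintro q ⟨hq, hq'⟩
      exact ⟨hq, by linarith [hq'.2], by linarith [hq'.1]⟩
    · exact fun q hq => (arcValue_symm (h := h) (hH huv) hq).symm
    · exact (arcValue_symm (h := h) (hH huv) ⟨ht, by simp⟩).symm

theorem vertexValue_ne_zero (hx : h.Avoids H x) (hy : h.Avoids H y) {u v : V} (huv : H.Adj u v)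
    {t : ℝ} (ht : t ∈ Icc (0 : ℝ) 1) : h.vertexValue (sepFun x y ℓ) u t ≠ 0 := by
  rw [vertexValue]
  split_ifs with hu
  · exact IsSeparator.ne_zero ((hx t ht u v huv).2 hu) ((hy t ht u v huv).2 hu)
  · exact one_ne_zero

/-- On the closed square of times and parameters the value has no zero, so one logarithm `G` exists
there; the change along the arc at time `t` is `G t 1 - G t 0`. -/
theorem logChange_arc (hΩ : IsOpen Ω) (hH : H ≤ N.graph) (hs : IsSeparator Ω x y ℓ C)
    (hx : h.Avoids H x) (hy : h.Avoids H y) {u v : V} (huv : H.Adj u v) :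
    ContinuousOn (fun t => logChange fun s => sepFun x y ℓ (h.arc u v t s)) (Icc 0 1) ∧
      ∀ t ∈ Icc (0 : ℝ) 1, Complex.exp (logChange fun s => sepFun x y ℓ (h.arc u v t s)) =
        h.vertexValue (sepFun x y ℓ) v t / h.vertexValue (sepFun x y ℓ) u t := by
  have hc := continuousOn_arcValue hΩ hH hs hy huv
  set Φ := h.arcValue (sepFun x y ℓ) u v with hΦ
  have hne : ∀ t ∈ Icc (0 : ℝ) 1, ∀ s ∈ Icc (0 : ℝ) 1, Φ (t, s) ≠ 0 := by
    intro t ht s hs'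
    simp only [hΦ, arcValue]
    split_ifs with h0 h1
    · exact vertexValue_ne_zero hx hy huv ht
    · exact vertexValue_ne_zero hx hy huv.symm ht
    · have hs2 : s ∈ Ioo (0 : ℝ) 1 := ⟨not_le.1 h0, not_le.1 h1⟩
      exact IsSeparator.ne_zero ((hx t ht u v huv).1 s hs2) ((hy t ht u v huv).1 s hs2)
  have m0 : (0 : ℝ) ∈ Icc (0 : ℝ) 1 := by simp
  have m1 : (1 : ℝ) ∈ Icc (0 : ℝ) 1 := by simp
  -- Lifted twice: along the parameter at time `0`, and from there in time.
  obtain ⟨G₀, hG₀, hG₀e, -⟩ := exists_log_homotopy (X := Unit) (S := univ)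
    (H := fun s _ => Φ (0, s)) (g := fun _ => Complex.log (Φ (0, 0)))
    (hc.comp (f := fun q : ℝ × Unit => ((0 : ℝ), q.1)) (by fun_prop) fun q hq => ⟨m0, hq.1⟩)
    (fun s hs' _ _ => hne 0 m0 s hs') continuousOn_const
    (fun _ _ => Complex.exp_log (hne 0 m0 0 m0))
  obtain ⟨G, hG, hGe, -⟩ := exists_log_homotopy (X := ℝ) (S := Icc 0 1)
    (H := fun t s => Φ (t, s)) (g := fun s => G₀ s ()) hc hne
    (hG₀.comp (f := fun s : ℝ => (s, ())) (by fun_prop) fun s hs' => ⟨hs', mem_univ _⟩)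
    (fun s hs' => hG₀e s hs' () (mem_univ _))
  have hlift : ∀ t ∈ Icc (0 : ℝ) 1,
      IsLogLift (fun s => sepFun x y ℓ (h.arc u v t s)) (G t) (G t 0) (G t 1) := by
    intro t ht
    have hGt : ContinuousOn (G t) (Icc 0 1) :=
      hG.comp (f := fun s : ℝ => (t, s)) (by fun_prop) fun s hs' => ⟨ht, hs'⟩
    refine ⟨hGt.mono Ioo_subset_Icc_self, fun s hs' => ?_, ?_, ?_⟩
    · rw [hGe t ht s (Ioo_subset_Icc_self hs')]
      simp [hΦ, arcValue, not_le.2 hs'.1, not_le.2 hs'.2]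
    · exact (hGt 0 m0).mono_left (nhdsWithin_le_of_mem (mem_of_superset Ioo_mem_nhdsGT_zero
        Ioo_subset_Icc_self))
    · exact (hGt 1 m1).mono_left (nhdsWithin_le_of_mem (mem_of_superset Ioo_mem_nhdsLT_one
        Ioo_subset_Icc_self))
  have heq : ∀ t ∈ Icc (0 : ℝ) 1, (logChange fun s => sepFun x y ℓ (h.arc u v t s)) =
      G t 1 - G t 0 := fun t ht => (hlift t ht).logChange_eq
  constructor
  · refine ContinuousOn.congr (ContinuousOn.sub ?_ ?_) heq
    · exact hG.comp (f := fun t : ℝ => (t, (1 : ℝ))) (by fun_prop) fun t ht => ⟨ht, m1⟩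
    · exact hG.comp (f := fun t : ℝ => (t, (0 : ℝ))) (by fun_prop) fun t ht => ⟨ht, m0⟩
  · intro t ht
    rw [heq t ht, Complex.exp_sub, hGe t ht 1 m1, hGe t ht 0 m0]
    simp [hΦ, arcValue, not_le.2 (zero_lt_one' ℝ)]

theorem sum_logChange_arc (hΩ : IsOpen Ω) (hH : H ≤ N.graph) (hs : IsSeparator Ω x y ℓ C)
    (hx : h.Avoids H x) (hy : h.Avoids H y) {u v : V} (p : H.Walk u v)
    (hu : ∀ t ∈ Icc (0 : ℝ) 1, h.vertexValue (sepFun x y ℓ) u t ≠ 0) :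
    ContinuousOn (fun t => (p.darts.map fun d =>
      logChange fun s => sepFun x y ℓ (h.arc d.fst d.snd t s)).sum) (Icc 0 1) ∧
      ∀ t ∈ Icc (0 : ℝ) 1, Complex.exp (p.darts.map fun d =>
        logChange fun s => sepFun x y ℓ (h.arc d.fst d.snd t s)).sum =
        h.vertexValue (sepFun x y ℓ) v t / h.vertexValue (sepFun x y ℓ) u t := by
  induction p with
  | nil => exact ⟨by simpa using continuousOn_const, fun t ht => by simp [div_self (hu t ht)]⟩
  | cons e p ih =>
    have hw := fun t ht => vertexValue_ne_zero (ℓ := ℓ) hx hy e.symm (t := t) ht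
    obtain ⟨h1, h2⟩ := ih hw
    obtain ⟨h3, h4⟩ := logChange_arc hΩ hH hs hx hy e
    simp only [SimpleGraph.Walk.darts_cons, List.map_cons, List.sum_cons]
    refine ⟨h3.add h1, fun t ht => ?_⟩
    rw [Complex.exp_add, h2 t ht, h4 t ht]
    have := hw t ht
    have := hu t ht
    field_simp

/-- Points which are never hit by a moving path between exterior vertices lie on the same side of the
path in the beginning if and only if they do in the end. -/
theorem side_iff [Finite V] (hN : N.IsTrivalentTree) {a b : V} (ha : ¬ (N.site a).IsInner)
    (hb : ¬ (N.site b).IsInner) (hxΩ : x ∈ Ω) (hyΩ : y ∈ Ω)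
    (hx : h.Avoids (N.graph.pathBetween a b) x) (hy : h.Avoids (N.graph.pathBetween a b) y) :
    y ∈ connectedComponentIn (Ω \ N.pathSet a b) x ↔
      y ∈ connectedComponentIn (Ω \ N'.pathSet (h.iso a) (h.iso b)) x := by
  have hN' := hN.of_homotopy h
  have : Finite W := Finite.of_equiv V h.iso.toEquiv
  have hle := pathBetween_le (G := N.graph) a b
  have hle' := pathBetween_le (G := N'.graph) (h.iso a) (h.iso b)
  have ha' : ¬ (N'.site (h.iso a)).IsInner := fun e => ha ((h.isInner_iff a).1 e)
  have hb' : ¬ (N'.site (h.iso b)).IsInner := fun e => hb ((h.isInner_iff b).1 e)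
  obtain ⟨ℓ, C, hs⟩ := exists_isSeparator hN.isOpen hN.isSimplyConnected hxΩ hyΩ
  have hx0 := hx.notMem_carrierOf hle
  have hy0 := hy.notMem_carrierOf hle
  have hx1 := hx.notMem_pathSet hN
  have hy1 := hy.notMem_pathSet hN
  obtain ⟨g, k, hg, hk⟩ := exists_isArcLog_sepFun hN.isOpen hN.isTree hle hs hx0 hy0
  obtain ⟨g', k', hg', hk'⟩ := exists_isArcLog_sepFun hN.isOpen hN'.isTree hle' hs hx1 hy1
  rw [hN.side_iff ha hb hs ⟨hxΩ, hx0⟩ ⟨hyΩ, hy0⟩ hg hk,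
    hN'.side_iff ha' hb' hs ⟨hxΩ, hx1⟩ ⟨hyΩ, hy1⟩ hg' hk']
  obtain ⟨p, -⟩ := hN.isTree.exists_walk_pathBetween a b
  let φ : N.graph.pathBetween a b →g N'.graph.pathBetween (h.iso a) (h.iso b) :=
    ⟨h.iso, fun e => (h.iso.pathBetween_adj_iff hN.isTree hN'.isTree a b _ _).2 e⟩
  obtain ⟨hc, he⟩ := sum_logChange_arc hN.isOpen hle hs hx hy p (by simp [vertexValue, ha])
  -- Both ends are exterior with value `1`, so the exponential of the total change is `1` at all
  -- times and the change is a constant multiple of `2πi`.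
  obtain ⟨n, hn⟩ := isPreconnected_Icc.exists_int_of_exp_eq hc
    (continuousOn_const (c := (0 : ℂ))) fun t ht => by
      rw [he t ht]
      simp [vertexValue, ha, hb]
  have e0 := hn 0 (by simp)
  have e1 := hn 1 (by simp)
  have s0 := hg.sum_logChange_map SimpleGraph.Hom.id p
  have s1 := hg'.sum_logChange_map φ p
  have c0 : (p.darts.map fun d => logChange fun s => sepFun x y ℓ (h.arc d.fst d.snd 0 s)) =
      p.darts.map fun d => logChange fun s => sepFun x y ℓ (N.arc d.fst d.snd s) :=
    List.map_congr_left fun d _ => logChange_congr fun s hs => by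
      rw [h.arc_zero _ _ (hle d.adj) s hs]
  have c1 : (p.darts.map fun d => logChange fun s => sepFun x y ℓ (h.arc d.fst d.snd 1 s)) =
      p.darts.map fun d => logChange fun s => sepFun x y ℓ (N'.arc (φ d.fst) (φ d.snd) s) :=
    List.map_congr_left fun d _ => logChange_congr fun s hs => by
      rw [h.arc_one _ _ (hle d.adj) s hs]
      rfl
  rw [c0] at e0
  rw [c1, s1] at e1
  have e2 := s0.symm.trans (e0.trans e1.symm)
  change k b - k a = k' (h.iso b) - k' (h.iso a) at e2
  constructor
  · intro e
    rw [e, sub_self] at e2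
    exact (sub_eq_zero.1 e2.symm).symm
  · intro e
    rw [e, sub_self] at e2
    exact (sub_eq_zero.1 e2).symm

end NetworkHomotopy

/-! ### Regions and pairs of exterior vertices. -/

namespace PlanarNetwork

variable {Ω : Set Plane} {V : Type*} {N : PlanarNetwork Ω V}

theorem IsSide.symm {R : N.Region} {a b : V} (h : N.IsSide R a b) : N.IsSide R b a :=
  ⟨h.ne.symm, h.right, h.left, by rw [pathSet_comm]; exact h.eq⟩

theorem notMem_pathSet_self (a : V) {z : ℂ} : z ∉ N.pathSet a a := by
  rintro ⟨u, v, huv, -⟩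
  exact huv.2 (SimpleGraph.Reachable.refl _)

/-- All exterior vertices besides `a` and `b` lie on the same side of the path between `a`
and `b`. -/
def IsFacePair (N : PlanarNetwork Ω V) (a b : V) : Prop :=
  ∀ c d, ¬ (N.site c).IsInner → ¬ (N.site d).IsInner → c ≠ a → c ≠ b → d ≠ a → d ≠ b →
    ∀ z ∈ N.leafArc c, N.leafArc d ⊆ connectedComponentIn (Ω \ N.pathSet a b) z

theorem notMem_region_of_mem_leafArc {R : N.Region} {c : V} {z : ℂ} (hz : z ∈ N.leafArc c) : z ∉ R.1 :=
  fun e => (region_subset R e).2 (IsTrivalentTree.leafArc_subset_carrier hz)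

namespace IsTrivalentTree

variable {a b c d : V}

theorem leafArc_mem_diff (hN : N.IsTrivalentTree) (hc : ¬ (N.site c).IsInner) (hca : c ≠ a)
    (hcb : c ≠ b) {z : ℂ} (hz : z ∈ N.leafArc c) : z ∈ Ω \ N.pathSet a b :=
  ⟨leafArc_subset_domain hz, (hN.disjoint_leafArc_pathSet hc hca hcb).notMem_of_mem_left hz⟩

/-- The arc at `a` borders the region, so it belongs to the path from `c` to `d`, whose only
exterior vertices are its ends. -/
theorem eq_or_eq_of_isSide [Finite V] (hN : N.IsTrivalentTree) {R : N.Region} (h : N.IsSide R a b)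
    (h' : N.IsSide R c d) : a = c ∨ a = d := by
  obtain ⟨v, hv, -⟩ := N.exists_adj a
  have h1 := (hN.borders_iff h hv).2
    (SimpleGraph.pathBetween_adj_start hN.isTree h.ne (hN.eq_of_adj h.left) hv)
  exact hN.exterior_on_path ((hN.borders_iff h' hv).1 h1) h.left

/-- The exterior vertices of the boundary of a region are determined by the region. -/
theorem pair_eq_of_isSide [Finite V] (hN : N.IsTrivalentTree) {R : N.Region} (h : N.IsSide R a b)
    (h' : N.IsSide R c d) : (c = a ∧ d = b) ∨ (c = b ∧ d = a) := by
  have h1 := hN.eq_or_eq_of_isSide h h'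
  have h2 := hN.eq_or_eq_of_isSide h.symm h'
  have h3 := h.ne
  rcases h1 with rfl | rfl <;> rcases h2 with rfl | rfl <;> simp_all

/-- A path between exterior vertices has at most one side which is a region, if there is a third
exterior vertex. -/
theorem isSide_unique [Finite V] (hN : N.IsTrivalentTree) {R S : N.Region} (hR : N.IsSide R a b)
    (hS : N.IsSide S a b) (hc : ¬ (N.site c).IsInner) (hca : c ≠ a) (hcb : c ≠ b) : R = S := by
  obtain ⟨r, hr⟩ := region_nonempty R
  obtain ⟨s, hs⟩ := region_nonempty S
  obtain ⟨z, hz⟩ := leafArc_nonempty (N := N) c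
  rcases hN.side_or hR.left hR.right hR.ne (hN.leafArc_mem_diff hc hca hcb hz)
    (region_subset_diff_pathSet R a b hr) (region_subset_diff_pathSet S a b hs) with h1 | h1 | h1
  · refine absurd ?_ (notMem_region_of_mem_leafArc (R := R) hz)
    rw [hR.eq r hr]
    exact mem_connectedComponentIn_symm h1
  · refine absurd ?_ (notMem_region_of_mem_leafArc (R := S) hz)
    rw [hS.eq s hs]
    exact mem_connectedComponentIn_symm h1
  · rw [← hR.eq r hr] at h1
    exact region_ext h1 hs

/-- The arc of a third exterior vertex always lies on the side opposite to the region. Membership is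
thus expressed through arcs near exterior vertices, which can be followed along a homotopy. -/
theorem mem_iff_of_isSide [Finite V] (hN : N.IsTrivalentTree) {R : N.Region} (hR : N.IsSide R a b)
    (hc : ¬ (N.site c).IsInner) (hca : c ≠ a) (hcb : c ≠ b) {x : ℂ} (hx : x ∈ Ω \ N.pathSet a b) :
    x ∈ R.1 ↔ ¬ N.leafArc c ⊆ connectedComponentIn (Ω \ N.pathSet a b) x := by
  obtain ⟨z, hz⟩ := leafArc_nonempty (N := N) c
  constructor
  · intro hxR hsub
    rw [← hR.eq x hxR] at hsub
    exact notMem_region_of_mem_leafArc hz (hsub hz)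
  · intro hnot
    obtain ⟨r, hr⟩ := region_nonempty R
    rcases hN.side_or hR.left hR.right hR.ne (region_subset_diff_pathSet R a b hr) hx
      (hN.leafArc_mem_diff hc hca hcb hz) with h1 | h1 | h1
    · rwa [hR.eq r hr]
    · rw [← hR.eq r hr] at h1
      exact absurd h1 (notMem_region_of_mem_leafArc hz)
    · exact absurd (fun w hw => mem_connectedComponentIn_trans h1
        (hN.leafArc_subset_side hc hca hcb hz hw)) hnot

/-- The region fills one of the two sides, which leaves only the other one for the arcs at further
exterior vertices. -/
theorem isFacePair_of_isSide [Finite V] (hN : N.IsTrivalentTree) {R : N.Region}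
    (hR : N.IsSide R a b) : N.IsFacePair a b := by
  intro c d hc hd hca hcb hda hdb z hz w hw
  by_contra hcon
  obtain ⟨r, hr⟩ := region_nonempty R
  rcases hN.side_or hR.left hR.right hR.ne (region_subset_diff_pathSet R a b hr)
    (hN.leafArc_mem_diff hc hca hcb hz) (hN.leafArc_mem_diff hd hda hdb hw) with h1 | h1 | h1
  · rw [← hR.eq r hr] at h1
    exact notMem_region_of_mem_leafArc hz h1
  · rw [← hR.eq r hr] at h1
    exact notMem_region_of_mem_leafArc hw h1
  · exact hcon h1

/-- The side opposite to the other exterior vertices contains no point of the network, as any such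
point could be followed on that side to an exterior vertex. -/
theorem exists_isSide_of_isFacePair [Finite V] (hN : N.IsTrivalentTree) (hab : a ≠ b)
    (ha : ¬ (N.site a).IsInner) (hb : ¬ (N.site b).IsInner) (h : N.IsFacePair a b)
    (hc : ¬ (N.site c).IsInner) (hca : c ≠ a) (hcb : c ≠ b) : ∃ R, N.IsSide R a b := by
  obtain ⟨z, hz⟩ := leafArc_nonempty (N := N) c
  obtain ⟨y, hy, hyz⟩ := hN.exists_notMem_side ha hb hab z
  have hd : Disjoint (connectedComponentIn (Ω \ N.pathSet a b) y) N.carrier := by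
    rw [Set.disjoint_left]
    intro w hw hwN
    obtain ⟨d, hd, hwd⟩ := hN.exists_mem_pathSet a hwN
    have hwab := (connectedComponentIn_subset _ _ hw).2
    have hda : d ≠ a := by
      rintro rfl
      exact notMem_pathSet_self _ hwd
    have hdb : d ≠ b := by
      rintro rfl
      exact hwab hwd
    obtain ⟨q, hq⟩ := leafArc_nonempty (N := N) d
    have h1 := hN.leafArc_subset_of_mem_pathSet ha hd hwd hwab hq
    exact hyz (mem_connectedComponentIn_trans (h c d hc hd hca hcb hda hdb z hz hq)
      (mem_connectedComponentIn_symm (mem_connectedComponentIn_trans hw h1)))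
  exact ⟨_, isSide_regionOf ⟨hy.1, hd.notMem_of_mem_left (mem_connectedComponentIn hy)⟩ hab ha hb hd⟩

/-- If there are only two exterior vertices, there are only two regions. -/
theorem exists_two_regions [Finite V] (hN : N.IsTrivalentTree) (hab : a ≠ b)
    (ha : ¬ (N.site a).IsInner) (hall : ∀ c, ¬ (N.site c).IsInner → c = a ∨ c = b) :
    (∀ R, N.IsSide R a b) ∧ ∀ R : N.Region, ∃ S, R ≠ S ∧ ∀ Q : N.Region, Q = R ∨ Q = S := by
  have hside : ∀ R, N.IsSide R a b := by
    intro R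
    obtain ⟨i, j, hij⟩ := hN.exists_isSide R
    rcases hall i hij.left with rfl | rfl <;> rcases hall j hij.right with rfl | rfl
    · exact absurd rfl hij.ne
    · exact hij
    · exact hij.symm
    · exact absurd rfl hij.ne
  refine ⟨hside, fun R => ?_⟩
  obtain ⟨v, hv, -⟩ := N.exists_adj a
  obtain ⟨S, T, hST, h⟩ := hN.exists_two_borders hv
  have h' : ∀ Q : N.Region, Q = S ∨ Q = T := fun Q => (h Q).1 ((hN.borders_iff (hside Q) hv).2
    (SimpleGraph.pathBetween_adj_start hN.isTree hab (hN.eq_of_adj ha) hv))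
  rcases h' R with rfl | rfl
  · exact ⟨T, hST, h'⟩
  · exact ⟨S, hST.symm, fun Q => (h' Q).symm⟩

end IsTrivalentTree

end PlanarNetwork

theorem exists_equiv_of_two {α β : Type*} {x y : α} {x' y' : β} (hxy : x ≠ y)
    (h : ∀ z, z = x ∨ z = y) (hxy' : x' ≠ y') (h' : ∀ z, z = x' ∨ z = y') :
    ∃ e : α ≃ β, e x = x' ∧ e y = y' := by
  classical
  refine ⟨Equiv.ofBijective (fun z => if z = x then x' else y') ⟨?_, ?_⟩, if_pos rfl, if_neg hxy.symm⟩
  · intro z w hzw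
    rcases h z with rfl | rfl <;> rcases h w with rfl | rfl <;>
      simp_all [eq_comm]
  · intro z
    rcases h' z with rfl | rfl
    · exact ⟨x, by simp⟩
    · exact ⟨y, by simp [hxy.symm]⟩

theorem exists_equiv_of_relation {α β : Type*} (r : α → β → Prop) (h₁ : ∀ x, ∃ y, r x y)
    (h₂ : ∀ y, ∃ x, r x y) (h₃ : ∀ x y y', r x y → r x y' → y = y')
    (h₄ : ∀ x x' y, r x y → r x' y → x = x') : ∃ e : α ≃ β, ∀ x, r x (e x) := by
  choose f hf using h₁
  refine ⟨Equiv.ofBijective f ⟨fun x x' e => h₄ x x' (f x) (hf x) (e ▸ hf x'), fun y => ?_⟩, hf⟩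
  obtain ⟨x, hx⟩ := h₂ y
  exact ⟨x, h₃ x _ _ (hf x) hx⟩

/-! ### Matching the regions at the two ends of a homotopy. -/

namespace NetworkHomotopy

open PlanarNetwork PlanarNetwork.IsTrivalentTree
open SimpleGraph (pathBetween_le)

variable {Ω : Set Plane} {V W : Type*} {N : PlanarNetwork Ω V} {N' : PlanarNetwork Ω W}
  {h : NetworkHomotopy N N'} {a b c d : V}

theorem not_isInner_iso {v : V} (hv : ¬ (N.site v).IsInner) : ¬ (N'.site (h.iso v)).IsInner :=
  fun e => hv ((h.isInner_iff v).1 e)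

/-- Near its exterior vertex the arc of `c` leaves every compact subset of `Ω`, in particular what
is swept by half an arc starting at an interior vertex. Half arcs suffice, since the other half is
seen from the other end. -/
theorem eventually_ne_arc (hΩ : IsOpen Ω) {c' u v : V} (hcc : N.graph.Adj c c')
    (hc : ¬ (N.site c).IsInner) (huv : N.graph.Adj u v) (hcu : c ≠ u) :
    ∀ᶠ s in 𝓝[>] (0 : ℝ), ∀ t ∈ Icc (0 : ℝ) 1, ∀ t' ∈ Icc (0 : ℝ) 1,
      (∀ s' ∈ Ioc (0 : ℝ) (1 / 2), h.arc u v t' s' ≠ h.arc c c' t s) ∧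
      ((N.site u).IsInner → h.vertex u t' 0 ≠ h.arc c c' t s) := by
  by_cases hu : (N.site u).IsInner
  · have hK : IsCompact (h.closedArc u v '' (Icc 0 1 ×ˢ Icc 0 (1 / 2))) :=
      (isCompact_Icc.prod isCompact_Icc).image_of_continuousOn
        ((continuousOn_closedArc (h := h) huv hu).mono (prod_mono_right fun s hs =>
          ⟨hs.1, hs.2.trans_lt (by norm_num)⟩))
    have hKΩ : h.closedArc u v '' (Icc 0 1 ×ˢ Icc 0 (1 / 2)) ⊆ Ω := by
      rintro _ ⟨q, ⟨hq, hq'⟩, rfl⟩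
      rw [closedArc]
      split_ifs with h0
      · exact h.vertex_mem u hu _ hq _
      · exact h.arc_mem u v huv _ hq _ ⟨not_le.1 h0, hq'.2.trans_lt (by norm_num)⟩
    filter_upwards [eventually_notMem (h := h) hΩ hcc hc hK hKΩ] with s hs t ht t' ht'
    refine ⟨fun s' hs' e => hs t ht ⟨(t', s'), ⟨ht', hs'.1.le, hs'.2⟩, ?_⟩, fun _ e =>
      hs t ht ⟨(t', 0), ⟨ht', by norm_num⟩, ?_⟩⟩
    · rw [closedArc, if_neg (not_le.2 hs'.1), e]
    · rw [closedArc, if_pos le_rfl, e]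
  -- If `u` is exterior too, the part of its arc near `u` stays within `δ / 2` of the curve attached
  -- to `u`, which is at distance at least `δ` from the one attached to `c`; the rest of the half
  -- arc sweeps a compact set.
  · obtain ⟨δ, hδ, hsep⟩ := N.site_separated c u hcu
    obtain ⟨η, hη, hη'⟩ := mem_nhdsGT_iff_exists_Ioo_subset.1
      (eventually_dist_lt (h := h) huv (half_pos hδ))
    have hm : 0 < min δ η := lt_min hδ hη
    have hK : IsCompact ((fun q : ℝ × ℝ => h.arc u v q.1 q.2) ''
        (Icc 0 1 ×ˢ Icc (min δ η) (1 / 2))) :=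
      (isCompact_Icc.prod isCompact_Icc).image_of_continuousOn
        ((h.arc_continuous u v huv).mono (prod_mono_right fun s hs =>
          ⟨hm.trans_le hs.1, hs.2.trans_lt (by norm_num)⟩))
    have hKΩ : (fun q : ℝ × ℝ => h.arc u v q.1 q.2) '' (Icc 0 1 ×ˢ Icc (min δ η) (1 / 2)) ⊆ Ω := by
      rintro _ ⟨q, ⟨hq, hq'⟩, rfl⟩
      exact h.arc_mem u v huv _ hq _ ⟨hm.trans_le hq'.1, hq'.2.trans_lt (by norm_num)⟩
    filter_upwards [eventually_notMem (h := h) hΩ hcc hc hK hKΩ,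
      eventually_dist_lt (h := h) hcc (half_pos hδ), Ioo_mem_nhdsGT hδ] with s hs hs2 hs3 t ht t' ht'
    refine ⟨fun s' hs' e => ?_, fun h' => absurd h' hu⟩
    rcases lt_or_ge s' (min δ η) with h1 | h1
    · have h2 := hsep s hs3 s' ⟨hs'.1, h1.trans_le (min_le_left _ _)⟩
      have h3 := hs2 t ht
      have h4 := hη' ⟨hs'.1, h1.trans_le (min_le_right _ _)⟩ t' ht'
      rw [h.vertex_exterior c hc, dist_comm] at h3
      rw [h.vertex_exterior u hu, e] at h4
      have h5 := dist_triangle ((N.site c).track s) (h.arc c c' t s) ((N.site u).track s')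
      linarith
    · exact hs t ht ⟨(t', s'), ⟨ht', h1, hs'.2⟩, e⟩

theorem eventually_avoids_arc [Finite V] (hN : N.IsTrivalentTree) {c' : V}
    (hcc : N.graph.Adj c c') (hc : ¬ (N.site c).IsInner) (hca : c ≠ a) (hcb : c ≠ b) :
    ∀ᶠ s in 𝓝[>] (0 : ℝ), ∀ t ∈ Icc (0 : ℝ) 1,
      h.Avoids (N.graph.pathBetween a b) (h.arc c c' t s) := by
  have key : ∀ᶠ s in 𝓝[>] (0 : ℝ), ∀ q : {q : V × V // (N.graph.pathBetween a b).Adj q.1 q.2},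
      ∀ t ∈ Icc (0 : ℝ) 1, ∀ t' ∈ Icc (0 : ℝ) 1,
      (∀ s' ∈ Ioc (0 : ℝ) (1 / 2), h.arc q.1.1 q.1.2 t' s' ≠ h.arc c c' t s) ∧
      ((N.site q.1.1).IsInner → h.vertex q.1.1 t' 0 ≠ h.arc c c' t s) := by
    rw [eventually_all]
    rintro ⟨⟨u, v⟩, huv⟩
    refine eventually_ne_arc hN.isOpen hcc hc huv.1 ?_
    rintro rfl
    rcases hN.exterior_on_path huv hc with e | e
    exacts [hca e, hcb e]
  filter_upwards [key] with s hs t ht t' ht' u v huv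
  refine ⟨fun s' hs' => ?_, (hs ⟨(u, v), huv⟩ t ht t' ht').2⟩
  rcases le_or_gt s' (1 / 2) with h1 | h1
  · exact (hs ⟨(u, v), huv⟩ t ht t' ht').1 s' ⟨hs'.1, h1⟩
  · have := (hs ⟨(v, u), huv.symm⟩ t ht t' ht').1 (1 - s') ⟨by linarith [hs'.2], by linarith⟩
    rwa [← h.arc_symm v u huv.1.symm t' ht' s' hs'] at this

/-- Near an exterior vertex off a moving path there are points of its arc that are never hit by the
path. -/
theorem exists_avoids_leafArc [Finite V] (hN : N.IsTrivalentTree) (hc : ¬ (N.site c).IsInner)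
    (hca : c ≠ a) (hcb : c ≠ b) : ∃ p ∈ N.leafArc c, h.Avoids (N.graph.pathBetween a b) p ∧
      N'.leafArc (h.iso c) ⊆ connectedComponentIn (Ω \ N'.pathSet (h.iso a) (h.iso b)) p := by
  obtain ⟨c', hcc, -⟩ := N.exists_adj c
  obtain ⟨s, hs, hs'⟩ := ((eventually_avoids_arc (h := h) hN hcc hc hca hcb).and
    Ioo_mem_nhdsGT_zero).exists
  have m0 : (0 : ℝ) ∈ Icc (0 : ℝ) 1 := by simp
  have m1 : (1 : ℝ) ∈ Icc (0 : ℝ) 1 := by simp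
  refine ⟨h.arc c c' 0 s, ⟨c', hcc, s, hs', (h.arc_zero c c' hcc s hs').symm⟩, hs 0 m0, ?_⟩
  -- Following the chosen point of the arc of `c` in time joins it to the final arc without meeting
  -- the final path: at no time does the path hit any position of this point.
  have hT : IsPreconnected ((fun t => h.arc c c' t s) '' Icc 0 1) :=
    isPreconnected_Icc.image _ ((h.arc_continuous c c' hcc).comp (f := fun t : ℝ => (t, s))
      (by fun_prop) fun t ht => ⟨ht, hs'⟩)
  have hTs : (fun t => h.arc c c' t s) '' Icc 0 1 ⊆ Ω \ N'.pathSet (h.iso a) (h.iso b) := by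
    rintro _ ⟨t, ht, rfl⟩
    exact ⟨h.arc_mem c c' hcc t ht s hs', (hs t ht).notMem_pathSet hN⟩
  have h1 := hT.subset_connectedComponentIn ⟨0, m0, rfl⟩ hTs ⟨1, m1, rfl⟩
  rw [connectedComponentIn_eq h1]
  refine (hN.of_homotopy h).leafArc_subset_side (not_isInner_iso hc)
    (fun e => hca (h.iso.injective e)) (fun e => hcb (h.iso.injective e))
    ⟨h.iso c', h.iso.map_adj_iff.2 hcc, s, hs', (h.arc_one c c' hcc s hs').symm⟩

/-- The side of a moving path on which the arc of an exterior vertex lies does not change, relatively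
to points that are never hit. -/
theorem leafArc_subset_iff [Finite V] (hN : N.IsTrivalentTree) (ha : ¬ (N.site a).IsInner)
    (hb : ¬ (N.site b).IsInner) (hc : ¬ (N.site c).IsInner) (hca : c ≠ a) (hcb : c ≠ b) {x : ℂ}
    (hxΩ : x ∈ Ω) (hx : h.Avoids (N.graph.pathBetween a b) x) :
    N.leafArc c ⊆ connectedComponentIn (Ω \ N.pathSet a b) x ↔
      N'.leafArc (h.iso c) ⊆ connectedComponentIn (Ω \ N'.pathSet (h.iso a) (h.iso b)) x := by
  obtain ⟨p, hp, hpa, hp'⟩ := exists_avoids_leafArc (h := h) hN hc hca hcb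
  have h1 := side_iff hN ha hb hxΩ (leafArc_subset_domain hp) hx hpa
  constructor
  · intro h2 w hw
    exact mem_connectedComponentIn_trans (h1.1 (h2 hp)) (hp' hw)
  · intro h2 w hw
    obtain ⟨q, hq⟩ := leafArc_nonempty (N := N') (h.iso c)
    exact mem_connectedComponentIn_trans (h1.2 (mem_connectedComponentIn_trans (h2 hq)
      (mem_connectedComponentIn_symm (hp' hq)))) (hN.leafArc_subset_side hc hca hcb hp hw)

theorem isFacePair_iff [Finite V] (hN : N.IsTrivalentTree) (ha : ¬ (N.site a).IsInner)
    (hb : ¬ (N.site b).IsInner) : N.IsFacePair a b ↔ N'.IsFacePair (h.iso a) (h.iso b) := by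
  have hN' := hN.of_homotopy h
  constructor
  · intro hF c d hc hd hca hcb hda hdb z hz
    obtain ⟨c, rfl⟩ := h.iso.surjective c
    obtain ⟨d, rfl⟩ := h.iso.surjective d
    have hc' : ¬ (N.site c).IsInner := fun e => hc ((h.isInner_iff c).2 e)
    have hd' : ¬ (N.site d).IsInner := fun e => hd ((h.isInner_iff d).2 e)
    rw [h.iso.injective.ne_iff] at hca hcb hda hdb
    obtain ⟨p, hp, hpa, hp'⟩ := exists_avoids_leafArc (h := h) hN hc' hca hcb
    rw [← connectedComponentIn_eq (hp' hz)]
    exact (leafArc_subset_iff hN ha hb hd' hda hdb (leafArc_subset_domain hp) hpa).1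
      (hF c d hc' hd' hca hcb hda hdb p hp)
  · intro hF c d hc hd hca hcb hda hdb z hz
    obtain ⟨p, hp, hpa, hp'⟩ := exists_avoids_leafArc (h := h) hN hc hca hcb
    obtain ⟨q, hq⟩ := leafArc_nonempty (N := N') (h.iso c)
    have h1 := hF (h.iso c) (h.iso d) (not_isInner_iso hc) (not_isInner_iso hd)
      (h.iso.injective.ne hca) (h.iso.injective.ne hcb) (h.iso.injective.ne hda)
      (h.iso.injective.ne hdb) q hq
    rw [← connectedComponentIn_eq (hp' hq)] at h1
    have h2 := (leafArc_subset_iff hN ha hb hd hda hdb (leafArc_subset_domain hp) hpa).2 h1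
    rwa [connectedComponentIn_eq (hN.leafArc_subset_side hc hca hcb hp hz)] at h2

theorem borders_iff_of_isSide [Finite V] (hN : N.IsTrivalentTree) {R : N.Region} {S : N'.Region}
    (hR : N.IsSide R a b) (hS : N'.IsSide S (h.iso a) (h.iso b)) {u v : V}
    (huv : N.graph.Adj u v) : N.Borders R u v ↔ N'.Borders S (h.iso u) (h.iso v) := by
  have hN' := hN.of_homotopy h
  have : Finite W := Finite.of_equiv V h.iso.toEquiv
  rw [hN.borders_iff hR huv, hN'.borders_iff hS (h.iso.map_adj_iff.2 huv),
    h.iso.pathBetween_adj_iff hN.isTree hN'.isTree]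

/-- Both regions have the same pair of exterior vertices and border the same arcs, so the pair
cannot tell them apart; only points that are never hit can. -/
theorem exists_identifiesRegions_of_two [Finite V] (hN : N.IsTrivalentTree) (hab : a ≠ b)
    (ha : ¬ (N.site a).IsInner) (hb : ¬ (N.site b).IsInner)
    (hall : ∀ c, ¬ (N.site c).IsInner → c = a ∨ c = b) : ∃ Φ, h.IdentifiesRegions Φ := by
  have hN' := hN.of_homotopy h
  have : Finite W := Finite.of_equiv V h.iso.toEquiv
  obtain ⟨hs, htwo⟩ := hN.exists_two_regions hab ha hall
  obtain ⟨hs', htwo'⟩ := hN'.exists_two_regions (h.iso.injective.ne hab) (not_isInner_iso ha)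
    (b := h.iso b) (fun c hc => by
      obtain ⟨c, rfl⟩ := h.iso.surjective c
      rcases hall c (fun e => hc ((h.isInner_iff c).2 e)) with rfl | rfl
      exacts [Or.inl rfl, Or.inr rfl])
  have hav : ∀ x, x ∉ h.sweptSet → h.Avoids (N.graph.pathBetween a b) x := fun x hx =>
    avoids_of_notMem_sweptSet (pathBetween_le a b) hx
  have hin : ∀ x ∈ Ω, x ∉ h.sweptSet → x ∈ Ω \ N.carrier ∧ x ∈ Ω \ N'.carrier := by
    intro x hxΩ hx
    refine ⟨⟨hxΩ, ?_⟩, hxΩ, ?_⟩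
    · rw [carrier_eq]
      exact (avoids_of_notMem_sweptSet le_rfl hx).notMem_carrierOf le_rfl
    · intro e
      obtain ⟨d, hd, hxd⟩ := hN'.exists_mem_pathSet (h.iso a) e
      obtain ⟨d, rfl⟩ := h.iso.surjective d
      exact (avoids_of_notMem_sweptSet (pathBetween_le a d) hx).notMem_pathSet hN hxd
  obtain ⟨R, R', hRR⟩ : ∃ (R : N.Region) (R' : N'.Region),
      ∀ x ∈ Ω, x ∉ h.sweptSet → (x ∈ R.1 ↔ x ∈ R'.1) := by
    -- One unhit point fixes the matching, and `side_iff` makes all other unhit points agree with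
    -- it. If every point is hit, any bijection will do.
    by_cases hE : ∃ x ∈ Ω, x ∉ h.sweptSet
    · obtain ⟨p, hpΩ, hp⟩ := hE
      obtain ⟨h1, h2⟩ := hin p hpΩ hp
      refine ⟨N.regionOf p h1, N'.regionOf p h2, fun x hxΩ hx => ?_⟩
      rw [(hs _).eq p (mem_regionOf h1), (hs' _).eq p (mem_regionOf h2)]
      exact side_iff hN ha hb hpΩ hxΩ (hav p hp) (hav x hx)
    · obtain ⟨x, hx, -⟩ := hN.exists_notMem_side ha hb hab 0
      obtain ⟨va, hva, -⟩ := N.exists_adj a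
      obtain ⟨R, -⟩ := hN.exists_two_borders hva
      obtain ⟨R', -⟩ := hN'.exists_two_borders (h.iso.map_adj_iff.2 hva)
      exact ⟨R, R', fun x hxΩ hx => absurd ⟨x, hxΩ, hx⟩ hE⟩
  obtain ⟨S, hRS, hQ⟩ := htwo R
  obtain ⟨S', hRS', hQ'⟩ := htwo' R'
  obtain ⟨Φ, hΦR, hΦS⟩ := exists_equiv_of_two hRS hQ hRS' hQ'
  refine ⟨Φ, fun Q u v huv => borders_iff_of_isSide hN (hs Q) (hs' (Φ Q)) huv,
    fun x hxΩ hx Q => ?_⟩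
  rcases hQ Q with rfl | rfl
  · rw [hΦR]
    exact hRR x hxΩ hx
  · rw [hΦS]
    obtain ⟨h1, h2⟩ := hin x hxΩ hx
    have e1 : x ∈ Q.1 ↔ x ∉ R.1 := by
      refine ⟨fun h3 h4 => hRS (region_ext h4 h3), fun h3 => ?_⟩
      rcases hQ (N.regionOf x h1) with e | e
      · exact absurd (e ▸ mem_regionOf h1) h3
      · exact e ▸ mem_regionOf h1
    have e2 : x ∈ S'.1 ↔ x ∉ R'.1 := by
      refine ⟨fun h3 h4 => hRS' (region_ext h4 h3), fun h3 => ?_⟩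
      rcases hQ' (N'.regionOf x h2) with e | e
      · exact absurd (e ▸ mem_regionOf h2) h3
      · exact e ▸ mem_regionOf h2
    rw [e1, e2, hRR x hxΩ hx]

/-- A third exterior vertex singles out one side of the path between `a` and `b`, so a region is
determined by its pair of exterior vertices, and being such a pair is invariant under the homotopy
(`isFacePair_iff`). -/
theorem exists_identifiesRegions_of_three [Finite V] (hN : N.IsTrivalentTree)
    (hall : ∀ a b, ∃ c, ¬ (N.site c).IsInner ∧ c ≠ a ∧ c ≠ b) : ∃ Φ, h.IdentifiesRegions Φ := by
  have hN' := hN.of_homotopy h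
  have : Finite W := Finite.of_equiv V h.iso.toEquiv
  have hback : ∀ {v : V}, ¬ (N'.site (h.iso v)).IsInner → ¬ (N.site v).IsInner :=
    fun {v} hv e => hv ((h.isInner_iff v).2 e)
  obtain ⟨Φ, hΦ⟩ := exists_equiv_of_relation
    (fun (R : N.Region) (S : N'.Region) => ∃ a b, N.IsSide R a b ∧ N'.IsSide S (h.iso a) (h.iso b))
    (by
      intro R
      obtain ⟨a, b, hab⟩ := hN.exists_isSide R
      obtain ⟨c, hc, hca, hcb⟩ := hall a b
      obtain ⟨S, hS⟩ := hN'.exists_isSide_of_isFacePair (h.iso.injective.ne hab.ne)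
        (not_isInner_iso hab.left) (not_isInner_iso hab.right)
        ((isFacePair_iff hN hab.left hab.right).1 (hN.isFacePair_of_isSide hab))
        (not_isInner_iso hc) (h.iso.injective.ne hca) (h.iso.injective.ne hcb)
      exact ⟨S, a, b, hab, hS⟩)
    (by
      intro S
      obtain ⟨a, b, hab⟩ := hN'.exists_isSide S
      obtain ⟨a, rfl⟩ := h.iso.surjective a
      obtain ⟨b, rfl⟩ := h.iso.surjective b
      obtain ⟨c, hc, hca, hcb⟩ := hall a b
      obtain ⟨R, hR⟩ := hN.exists_isSide_of_isFacePair (fun e => hab.ne (congrArg h.iso e))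
        (hback hab.left) (hback hab.right)
        ((isFacePair_iff hN (hback hab.left) (hback hab.right)).2 (hN'.isFacePair_of_isSide hab))
        hc hca hcb
      exact ⟨R, a, b, hR, hab⟩)
    (by
      rintro R S T ⟨a, b, hR, hS⟩ ⟨a', b', hR', hT⟩
      have hT' : N'.IsSide T (h.iso a) (h.iso b) := by
        rcases hN.pair_eq_of_isSide hR hR' with ⟨rfl, rfl⟩ | ⟨rfl, rfl⟩
        exacts [hT, hT.symm]
      obtain ⟨c, hc, hca, hcb⟩ := hall a b
      exact hN'.isSide_unique hS hT' (not_isInner_iso hc) (h.iso.injective.ne hca)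
        (h.iso.injective.ne hcb))
    (by
      rintro R S T ⟨a, b, hR, hT⟩ ⟨a', b', hS, hT'⟩
      have hS' : N.IsSide S a b := by
        rcases hN'.pair_eq_of_isSide hT hT' with ⟨e1, e2⟩ | ⟨e1, e2⟩ <;>
          rw [h.iso.injective.eq_iff] at e1 e2 <;> subst e1 <;> subst e2
        exacts [hS, hS.symm]
      obtain ⟨c, hc, hca, hcb⟩ := hall a b
      exact hN.isSide_unique hR hS' hc hca hcb)
  refine ⟨Φ, fun R u v huv => ?_, fun x hxΩ hx R => ?_⟩
  · obtain ⟨a, b, hR, hS⟩ := hΦ R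
    exact borders_iff_of_isSide hN hR hS huv
  · obtain ⟨a, b, hR, hS⟩ := hΦ R
    obtain ⟨c, hc, hca, hcb⟩ := hall a b
    have hav := avoids_of_notMem_sweptSet (pathBetween_le a b) hx
    rw [hN.mem_iff_of_isSide hR hc hca hcb ⟨hxΩ, hav.notMem_carrierOf (pathBetween_le a b)⟩,
      hN'.mem_iff_of_isSide hS (not_isInner_iso hc) (h.iso.injective.ne hca)
        (h.iso.injective.ne hcb) ⟨hxΩ, hav.notMem_pathSet hN⟩,
      leafArc_subset_iff hN hR.left hR.right hc hca hcb hxΩ hav]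

theorem exists_identifiesRegions [Finite V] (hN : N.IsTrivalentTree) :
    ∃ Φ, h.IdentifiesRegions Φ := by
  obtain ⟨a, b, hab, ha, hb⟩ := hN.exists_exterior_pair
  by_cases hall : ∀ a b, ∃ c, ¬ (N.site c).IsInner ∧ c ≠ a ∧ c ≠ b
  · exact exists_identifiesRegions_of_three hN hall
  · push Not at hall
    obtain ⟨i, j, hij⟩ := hall
    -- All exterior vertices lie in `{i, j}`, which the distinct exterior vertices `a` and `b`
    -- exhaust.
    refine exists_identifiesRegions_of_two hN hab ha hb fun c hc => ?_
    have h1 := hij a ha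
    have h2 := hij b hb
    have h3 := hij c hc
    by_cases ha' : a = i <;> by_cases hc' : c = i <;> by_cases hb' : b = i <;> simp_all

theorem isThreeColoring_comp_symm {Φ : N.Region ≃ N'.Region} (hΦ : h.IdentifiesRegions Φ)
    (c : N.Region → Fin 3) : N.IsThreeColoring c ↔ N'.IsThreeColoring (c ∘ Φ.symm) := by
  constructor
  · rintro hc S T ⟨hST, u, v, huv, hS, hT⟩
    obtain ⟨u, rfl⟩ := h.iso.surjective u
    obtain ⟨v, rfl⟩ := h.iso.surjective v
    have huv' := h.iso.map_adj_iff.1 huv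
    refine hc _ _ ⟨fun e => hST (Φ.symm.injective e), u, v, huv', ?_, ?_⟩ <;>
      rwa [hΦ.1 _ u v huv', Equiv.apply_symm_apply]
  · rintro hc R S ⟨hRS, u, v, huv, hR, hS⟩
    have := hc (Φ R) (Φ S) ⟨fun e => hRS (Φ.injective e), h.iso u, h.iso v,
      h.iso.map_adj_iff.2 huv, (hΦ.1 R u v huv).1 hR, (hΦ.1 S u v huv).1 hS⟩
    simpa using this

end NetworkHomotopy

theorem mainTheorem5 (Ω : Set Plane) (hΩ : IsOpen Ω) (hΩs : IsSimplyConnected Ω)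
    {V : Type*} [Finite V] (N : PlanarNetwork Ω V)
    (htree : N.IsConnectedTreeLike) (htri : N.HasTrivalentInterior)
    (hsimple : N.HasSimpleBoundary) :
    (∃ c : N.Region → Fin 3, N.IsThreeColoring c ∧
      ∀ c' : N.Region → Fin 3, N.IsThreeColoring c' →
        ∃ π : Equiv.Perm (Fin 3), c' = π ∘ c) ∧
    ∀ {W : Type*} (N' : PlanarNetwork Ω W),
      SameTopologicalClass N N' → HaveSameColorings N N' := by
  have hN : N.IsTrivalentTree := ⟨hΩ, hΩs, ⟨htree.1, htree.2⟩, htri, hsimple⟩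
  refine ⟨hN.exists_isThreeColoring, fun N' _ h => ?_⟩
  obtain ⟨Φ, hΦ⟩ := NetworkHomotopy.exists_identifiesRegions (h := h) hN
  exact ⟨Φ, hΦ, NetworkHomotopy.isThreeColoring_comp_symm hΦ⟩
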